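/- Let $k$ be a perfect field of characteristic $p\ge 3$. A finite supergroup scheme $G$ over $k$ is given by its group algebra $kG$, a finite dimensional cocommutative $\mathbb Z/2$-graded Hopf algebra, and $H^{*,*}(G,k)=\operatorname{Ext}^{*,*}_{kG}(k,k)$, where the first degree is cohomological and the second is the internal $\mathbb Z/2$-degree. For $m,n\ge 1$ let $E^-_{m,n}$ be the finite supergroup scheme with group algebra $$kE^-_{m,n}=k[s_1,\dots,s_{n-1},s_n,\sigma]/(s_1^p,\dots,s_{n-1}^p,\,s_n^{p^m},\,\sigma^2-s_n^p),$$ with $s_1,\dots,s_n$ even and $\sigma$ odd, and with comultiplication $$\Delta(s_i)=S_{i-1}(s_1\otimes 1,\dots,s_i\otimes 1,\,1\otimes s_1,\dots,1\otimes s_i),\qquad \Delta(\sigma)=\sigma\otimes 1+1\otimes\sigma,$$ where $S_0,S_1,\dots$ are the polynomials that give the addition of $p$-typical Witt vectors. In particular $E^-_{1,n}\cong\mathbb G_{a(n)}\times\mathbb G_a^-$. For $m\geq 2$ let $E^-_{m,n}\to E^-_{m-1,n}$ be the surjective homomorphism with $s_i\mapsto s_i$, $\sigma\mapsto\sigma$.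 In $H^{*,*}(\mathbb G_{a(n)}\times\mathbb G_a^-,k)$, in terms of bar cochains on $kE^-_{1,n}$ and its basis of monomials $s^\alpha\sigma^e=s_1^{\alpha_1}\cdots s_n^{\alpha_n}\sigma^{e}$ ($0\le\alpha_j<p$, $e\in\{0,1\}$), let $\lambda_i$ be the class of the 1-cocycle that is $1$ on $s_i$ and $0$ on the other monomials, $\zeta$ the class of the 1-cocycle that is $1$ on $\sigma$ and $0$ on the other monomials, and $x_i$ the class of the 2-cocycle that is $-1$ on the pairs $(s_i^a,s_i^b)$ with $a+b=p$, $1\le a,b\le p-1$, and $0$ on all other pairs of monomials. Products are the products of cochains, $(f\cup g)(a,b)=f(a)g(b)$. **Theorem.** Let $n\ge 1$. Then $$H^{*,*}(E^-_{1,n},k)=k[x_1,\dots,x_n,\zeta]\otimes\Lambda(\lambda_1,\dots,\lambda_n),\qquad |x_i|=(2,0),\ |\zeta|=(1,1),\ |\lambda_i|=(1,0),$$ and for every $m\ge 2$ there are classes $x_{m,i},\zeta_m,\lambda_{m,i}$ ($1\le i\le n$) such that $$H^{*,*}(E^-_{m,n},k)=k[x_{m,1},\dots,x_{m,n},\zeta_m]\otimes\Lambda(\lambda_{m,1},\dots,\lambda_{m,n}),$$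 with $|x_{m,i}|=(2,0)$, $|\zeta_m|=(1,1)$ and $|\lambda_{m,i}|=(1,0)$. Here $\otimes$ is the graded tensor product with respect to cohomological degree (so $\zeta_m\lambda_{m,i}=-\lambda_{m,i}\zeta_m$). These classes can be chosen for all $m\ge 2$ simultaneously so that the following hold. (1) For $m\ge 3$ the inflation map $H^{*,*}(E^-_{m-1,n},k)\to H^{*,*}(E^-_{m,n},k)$ sends $x_{m-1,i}$ to $x_{m,i}$ for $1\le i\le n-1$, $x_{m-1,n}$ to $0$, $\zeta_{m-1}$ to $\zeta_m$, and $\lambda_{m-1,i}$ to $\lambda_{m,i}$ for $1\le i\le n$. (2) The inflation map $H^{*,*}(\mathbb G_{a(n)}\times\mathbb G_a^-,k)\to H^{*,*}(E^-_{2,n},k)$ along $E^-_{2,n}\to E^-_{1,n}$ sends $x_i$ to $x_{2,i}$ for $1\le i\le n-1$, $x_n$ to $\zeta_2^2$, $\zeta$ to $\zeta_2$, and $\lambda_i$ to $\lambda_{2,i}$ for $1\le i\le n$. The kernel of $$H^{2,0}(\mathbb G_{a(n)}\times\mathbb G_a^-,k)\to H^{2,0}(E^-_{2,n},k)$$ is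 one dimensional, spanned by $\zeta^2-x_n$. -/

import Mathlib

set_option linter.unusedSectionVars false
set_option linter.unusedVariables false

open scoped TensorProduct DirectSum

universe u v w

noncomputable section

/-- A finite supergroup scheme `G` over `k`, given by its group algebra `A = kG`: a finite
dimensional `ℤ/2`-graded cocommutative Hopf algebra. The comultiplication is multiplicative for the
`ℤ/2`-graded tensor product, in which `(a ⊗ b)(a' ⊗ b') = (-1)^{|b||a'|} aa' ⊗ bb'`. -/
class SupergroupAlgebra (k : Type u) (A : Type v) [Field k] [Ring A] [Algebra k A]
    extends Coalgebra k A where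
  /-- `par 0` is the even part and `par 1` the odd part. -/
  par : ZMod 2 → Submodule k A
  [graded : GradedAlgebra par]
  finite : Module.Finite k A
  counit_one : counit (1 : A) = 1
  counit_mul : ∀ a b : A, counit (a * b) = counit a * counit b
  counit_odd : ∀ a ∈ par 1, counit a = 0
  comul_one : GradedTensorProduct.of k par par (comul (1 : A)) = 1
  comul_mul : ∀ a b : A, GradedTensorProduct.of k par par (comul (a * b)) =
    GradedTensorProduct.of k par par (comul a) * GradedTensorProduct.of k par par (comul b)
  comul_mem : ∀ t, ∀ a ∈ par t, comul a ∈
    ⨆ i : ZMod 2, LinearMap.range (TensorProduct.map (par i).subtype (par (t - i)).subtype)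
  comul_comm : ∀ a : A, GradedTensorProduct.comm par par (GradedTensorProduct.of k par par (comul a))
    = GradedTensorProduct.of k par par (comul a)
  antipode : A →ₗ[k] A
  antipode_mem : ∀ t, ∀ a ∈ par t, antipode a ∈ par t
  antipode_left : ∀ a : A, LinearMap.mul' k A (TensorProduct.map antipode LinearMap.id (comul a)) =
    algebraMap k A (counit a)
  antipode_right : ∀ a : A, LinearMap.mul' k A (TensorProduct.map LinearMap.id antipode (comul a)) =
    algebraMap k A (counit a)

attribute [reducible, instance] SupergroupAlgebra.graded

namespace SupergroupAlgebra

section Cochains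

variable {k : Type u} {A : Type v} [Field k] [Ring A] [Algebra k A]

/-! ### The cochain complex of `kG` with coefficients in `k` -/

/-- `q`-cochains: `q`-linear forms on `kG`, that is `Hom_{kG}(kG ⊗ (kG)^{⊗ q}, k)` for the bar
resolution `kG ⊗ (kG)^{⊗ *}` of the trivial module `k`. -/
def Cochain (k : Type u) (A : Type v) [Field k] [Ring A] [Algebra k A] (q : ℕ) : Type _ :=
  MultilinearMap k (fun _ : Fin q => A) k

instance (q : ℕ) : AddCommGroup (Cochain k A q) :=
  inferInstanceAs (AddCommGroup (MultilinearMap k (fun _ : Fin q => A) k))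

instance (q : ℕ) : Module k (Cochain k A q) :=
  inferInstanceAs (Module k (MultilinearMap k (fun _ : Fin q => A) k))

instance (q : ℕ) : FunLike (Cochain k A q) (Fin q → A) k :=
  inferInstanceAs (FunLike (MultilinearMap k (fun _ : Fin q => A) k) (Fin q → A) k)

namespace Cochain

@[ext]
theorem ext {q : ℕ} {f g : Cochain k A q} (h : ∀ a, f a = g a) : f = g := DFunLike.ext _ _ h

@[simp]
theorem zero_apply {q : ℕ} (a : Fin q → A) : (0 : Cochain k A q) a = 0 := rfl

@[simp]
theorem add_apply {q : ℕ} (f g : Cochain k A q) (a : Fin q → A) : (f + g) a = f a + g a := rfl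

@[simp]
theorem smul_apply {q : ℕ} (c : k) (f : Cochain k A q) (a : Fin q → A) :
    (c • f) a = c * f a := rfl

/-- The cochain given by a multilinear form. -/
def ofMultilinear {q : ℕ} (f : MultilinearMap k (fun _ : Fin q => A) k) : Cochain k A q := f

/-- The multilinear form underlying a cochain. -/
def toMultilinear {q : ℕ} (f : Cochain k A q) : MultilinearMap k (fun _ : Fin q => A) k := f

@[simp]
theorem ofMultilinear_apply {q : ℕ} (f : MultilinearMap k (fun _ : Fin q => A) k)
    (a : Fin q → A) : ofMultilinear f a = f a := rfl

@[simp]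
theorem toMultilinear_apply {q : ℕ} (f : Cochain k A q) (a : Fin q → A) :
    f.toMultilinear a = f a := rfl

end Cochain


/-- The cup product `(f ∪ g)(a, b) = f(a) g(b)`. -/
def cup {q r : ℕ} (f : Cochain k A q) (g : Cochain k A r) : Cochain k A (q + r) :=
  .ofMultilinear (((LinearMap.mul' k k).compMultilinearMap
    (f.toMultilinear.domCoprod g.toMultilinear)).domDomCongr finSumFinEquiv)

theorem cup_apply {q r : ℕ} (f : Cochain k A q) (g : Cochain k A r) (a : Fin (q + r) → A) :
    cup f g a = f (fun i => a (Fin.castAdd r i)) * g (fun j => a (Fin.natAdd q j)) := by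
  simp [cup, MultilinearMap.domCoprod_apply]

/-- Merging two neighbouring arguments is linear in each argument. -/
theorem contractNth_update {q : ℕ} (j : Fin q) [DecidableEq (Fin (q + 1))] (a : Fin (q + 1) → A)
    (i : Fin (q + 1)) : ∃ (i' : Fin q) (T : A →ₗ[k] A),
      ∀ x, Fin.contractNth j.castSucc (· * ·) (Function.update a i x) =
        Function.update (Fin.contractNth j.castSucc (· * ·) a) i' (T x) := by
  have key : ∀ (i' : Fin q) (T : A → A),
      (∀ x (l : Fin q), Fin.contractNth j.castSucc (· * ·) (Function.update a i x) l =
        if l = i' then T x else Fin.contractNth j.castSucc (· * ·) a l) →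
      ∀ x, Fin.contractNth j.castSucc (· * ·) (Function.update a i x) =
        Function.update (Fin.contractNth j.castSucc (· * ·) a) i' (T x) := by
    intro i' T h x
    funext l
    rw [h, Function.update_apply]
  have hi := i.isLt
  have hj := j.isLt
  rcases lt_trichotomy (i : ℕ) (j : ℕ) with h | h | h
  · refine ⟨⟨i, by omega⟩, LinearMap.id, key _ _ fun x l => ?_⟩
    simp only [Fin.contractNth, Function.update_apply, Fin.ext_iff, Fin.val_castSucc, Fin.val_succ,
      LinearMap.id_apply]
    split_ifs <;> first | rfl | omega
  · refine ⟨j, LinearMap.mulRight k (a j.succ), key _ _ fun x l => ?_⟩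
    by_cases hl : l = j
    · subst hl
      simp [Fin.contractNth, Function.update_apply, Fin.ext_iff, h]
    · have hl' : (l : ℕ) ≠ j := fun h' => hl (Fin.ext h')
      simp only [Fin.contractNth, Function.update_apply, Fin.ext_iff, Fin.val_castSucc,
        Fin.val_succ]
      split_ifs <;> first | rfl | omega
  · by_cases h1 : (i : ℕ) = j + 1
    · refine ⟨j, LinearMap.mulLeft k (a j.castSucc), key _ _ fun x l => ?_⟩
      by_cases hl : l = j
      · subst hl
        simp [Fin.contractNth, Function.update_apply, Fin.ext_iff, h1]
      · have hl' : (l : ℕ) ≠ j := fun h' => hl (Fin.ext h')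
        simp only [Fin.contractNth, Function.update_apply, Fin.ext_iff, Fin.val_castSucc,
          Fin.val_succ]
        split_ifs <;> first | rfl | omega
    · refine ⟨⟨i - 1, by omega⟩, LinearMap.id, key _ _ fun x l => ?_⟩
      simp only [Fin.contractNth, Function.update_apply, Fin.ext_iff, Fin.val_castSucc,
        Fin.val_succ, LinearMap.id_apply]
      split_ifs <;> first | rfl | omega

/-- The face `a ↦ f(a_0, …, a_j a_{j+1}, …, a_q)` of a cochain. -/
def face {q : ℕ} (j : Fin q) : Cochain k A q →ₗ[k] Cochain k A (q + 1) where
  toFun f := .ofMultilinear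
    { toFun a := f.toMultilinear (Fin.contractNth j.castSucc (· * ·) a)
      map_update_add' a i x y := by
        obtain ⟨i', T, h⟩ := contractNth_update (k := k) j a i
        simp [h]
      map_update_smul' a i c x := by
        obtain ⟨i', T, h⟩ := contractNth_update (k := k) j a i
        simp [h] }
  map_add' _ _ := rfl
  map_smul' _ _ := rfl

theorem face_apply {q : ℕ} (j : Fin q) (f : Cochain k A q) (a : Fin (q + 1) → A) :
    face j f a = f (Fin.contractNth j.castSucc (· * ·) a) := rfl

theorem mk_eq {q r : ℕ} (h : r = q) (f : Cochain k A q) (g : Cochain k A r)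
    (hfg : ∀ a : Fin q → A, f a = g (fun i => a (Fin.cast h i))) :
    GradedMonoid.mk (A := fun q => Cochain k A q) q f = GradedMonoid.mk r g := by
  subst h
  congr 1
  ext a
  exact hfg a

/-- The 0-cochain with value `c`. -/
def constCochain (c : k) : Cochain k A 0 := .ofMultilinear (MultilinearMap.constOfIsEmpty k _ c)

@[simp]
theorem constCochain_apply (c : k) (a : Fin 0 → A) : constCochain c a = c := rfl

instance : GradedMonoid.GOne (fun q : ℕ => Cochain k A q) :=
  ⟨constCochain 1⟩

instance : GradedMonoid.GMul (fun q : ℕ => Cochain k A q) :=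
  ⟨fun f g => cup f g⟩

theorem gone_apply (a : Fin 0 → A) :
    (GradedMonoid.GOne.one : Cochain k A 0) a = 1 := rfl

theorem gmul_eq {q r : ℕ} (f : Cochain k A q) (g : Cochain k A r) :
    GradedMonoid.GMul.mul (A := fun q : ℕ => Cochain k A q) f g = cup f g := rfl

theorem mk_mul_mk {q r : ℕ} (f : Cochain k A q) (g : Cochain k A r) :
    GradedMonoid.mk (A := fun q => Cochain k A q) q f * GradedMonoid.mk r g =
      GradedMonoid.mk (q + r) (cup f g) := rfl

/-- The cup product makes the sum of all cochain spaces a graded ring. -/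
instance : DirectSum.GRing (fun q : ℕ => Cochain k A q) where
  mul_zero f := by ext; simp [gmul_eq, cup_apply]
  zero_mul f := by ext; simp [gmul_eq, cup_apply]
  mul_add f g h := by ext; simp [gmul_eq, cup_apply, mul_add]
  add_mul f g h := by ext; simp [gmul_eq, cup_apply, add_mul]
  one_mul := by
    rintro ⟨q, f⟩
    refine mk_eq (zero_add q).symm (cup (GradedMonoid.GOne.one) f) f fun a => ?_
    rw [cup_apply, gone_apply, one_mul]
    congr 1
    ext i
    congr 1
    ext
    simp
  mul_one := by
    rintro ⟨q, f⟩
    refine mk_eq rfl (cup f (GradedMonoid.GOne.one)) f fun a => ?_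
    rw [cup_apply, gone_apply, mul_one]
    rfl
  mul_assoc := by
    rintro ⟨q, f⟩ ⟨r, g⟩ ⟨s, h⟩
    refine mk_eq (add_assoc q r s).symm (cup (cup f g) h) (cup f (cup g h)) fun a => ?_
    simp only [cup_apply, mul_assoc]
    congr 3
    ext i
    congr 1
    ext
    simp [add_assoc]
  natCast n := n • GradedMonoid.GOne.one
  natCast_zero := by simp
  natCast_succ n := by simp [add_smul]
  intCast n := n • GradedMonoid.GOne.one
  intCast_ofNat n := by simp
  intCast_negSucc_ofNat n := by rw [Int.negSucc_eq, neg_smul, ← natCast_zsmul]; simp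

instance : DirectSum.GAlgebra k (fun q : ℕ => Cochain k A q) where
  toFun := 
    { toFun r := constCochain r
      map_zero' := rfl
      map_add' _ _ := rfl }
  map_one := rfl
  map_mul r s := by
    refine mk_eq rfl _ (cup (constCochain r)
      (constCochain s)) fun a => ?_
    rw [cup_apply]
    rfl
  commutes r := by
    rintro ⟨q, f⟩
    refine mk_eq (Nat.add_comm q 0) (cup (constCochain r) f)
      (cup f (constCochain r)) fun a => ?_
    rw [cup_apply, cup_apply, constCochain_apply, constCochain_apply, mul_comm]
    congr 2
    ext i
    congr 1
    ext
    simp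
  smul_def r := by
    rintro ⟨q, f⟩
    refine mk_eq (Nat.zero_add q) (r • f)
      (cup (constCochain r) f) fun a => ?_
    rw [cup_apply]
    simp only [Cochain.smul_apply, constCochain_apply]
    congr 2
    ext i
    congr 1
    ext
    simp

variable (k A) in
/-- The ring of all cochains. -/
abbrev Cochains : Type _ := ⨁ q : ℕ, Cochain k A q


/-- A homogeneous cochain as an element of the ring of all cochains. -/
abbrev Cochain.toCochains {q : ℕ} (f : Cochain k A q) : Cochains k A :=
  DirectSum.lof k ℕ (fun q => Cochain k A q) q f

theorem toCochains_mul {q r : ℕ} (f : Cochain k A q) (g : Cochain k A r) :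
    f.toCochains * g.toCochains = (cup f g).toCochains :=
  DirectSum.of_mul_of _ _

/-- The degree involution, multiplication by `(-1)^q` on `q`-cochains. -/
def signMap : Cochains k A →ₗ[k] Cochains k A :=
  DirectSum.toModule k ℕ _ fun q => (-1 : k) ^ q • DirectSum.lof k ℕ (fun q => Cochain k A q) q

/-- The sum `∑_j (-1)^{j+1} f(a_0, …, a_j a_{j+1}, …, a_q)` of the inner faces. -/
def innerD : Cochains k A →ₗ[k] Cochains k A :=
  DirectSum.toModule k ℕ _ fun q => DirectSum.lof k ℕ (fun q => Cochain k A q) (q + 1) ∘ₗ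
    ∑ j : Fin q, (-1 : k) ^ ((j : ℕ) + 1) • face j

theorem signMap_lof {q : ℕ} (f : Cochain k A q) :
    signMap f.toCochains = (-1 : k) ^ q • f.toCochains := by
  simp [signMap, Cochain.toCochains]

theorem innerD_lof {q : ℕ} (f : Cochain k A q) :
    innerD f.toCochains = ∑ j : Fin q, (-1 : k) ^ ((j : ℕ) + 1) • (face j f).toCochains := by
  simp [innerD, Cochain.toCochains]

theorem cochains_induction {P : Cochains k A → Prop} (z : Cochains k A) (h0 : P 0)
    (h1 : ∀ (q : ℕ) (f : Cochain k A q), P f.toCochains)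
    (h2 : ∀ x y, P x → P y → P (x + y)) : P z :=
  DirectSum.induction_on z h0 h1 h2

theorem signMap_mul (z w : Cochains k A) : signMap (z * w) = signMap z * signMap w := by
  induction z using cochains_induction with
  | h0 => simp
  | h2 x y hx hy => simp [add_mul, hx, hy]
  | h1 q f =>
    induction w using cochains_induction with
    | h0 => simp
    | h2 x y hx hy => simp only [mul_add, map_add, hx, hy]
    | h1 r g =>
      rw [toCochains_mul, signMap_lof, signMap_lof, signMap_lof, smul_mul_smul_comm,
        toCochains_mul, pow_add]

theorem signMap_signMap (z : Cochains k A) : signMap (signMap z) = z := by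
  induction z using cochains_induction with
  | h0 => simp
  | h2 x y hx hy => simp [hx, hy]
  | h1 q f => simp [signMap_lof, smul_smul, ← mul_pow]

theorem signMap_innerD (z : Cochains k A) : signMap (innerD z) = - innerD (signMap z) := by
  induction z using cochains_induction with
  | h0 => simp
  | h2 x y hx hy => simp only [map_add, hx, hy, neg_add]
  | h1 q f =>
    simp only [signMap_lof, innerD_lof, map_sum, map_smul, pow_succ, Finset.smul_sum]
    rw [← Finset.sum_neg_distrib]
    refine Finset.sum_congr rfl fun j _ => ?_
    simp [smul_smul, mul_comm]

theorem toCochains_congr {q r : ℕ} (h : r = q) (f : Cochain k A q) (g : Cochain k A r)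
    (hfg : ∀ a : Fin q → A, f a = g (fun i => a (Fin.cast h i))) :
    f.toCochains = g.toCochains :=
  DirectSum.of_eq_of_gradedMonoid_eq (mk_eq h f g hfg)

theorem innerD_mul (z w : Cochains k A) :
    innerD (z * w) = innerD z * w + signMap z * innerD w := by
  induction z using cochains_induction with
  | h0 => simp
  | h2 x y hx hy => simp only [add_mul, map_add, hx, hy]; abel
  | h1 q f =>
    induction w using cochains_induction with
    | h0 => simp
    | h2 x y hx hy => simp only [mul_add, map_add, hx, hy]; abel
    | h1 r g =>
      rw [toCochains_mul, innerD_lof, innerD_lof, innerD_lof, signMap_lof, Fin.sum_univ_add,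
        Finset.sum_mul, Finset.mul_sum]
      congr 1
      · refine Finset.sum_congr rfl fun j _ => ?_
        rw [smul_mul_assoc, toCochains_mul]
        congr 1
        refine toCochains_congr (by omega) _ _ fun a => ?_
        rw [face_apply, cup_apply, cup_apply, face_apply]
        congr 2
        · ext i
          simp only [Fin.contractNth]
          have := j.isLt
          simp only [Fin.val_natAdd, Fin.val_castSucc, Fin.val_castAdd]
          rw [if_neg (by omega), if_neg (by omega)]
          congr 1
          ext
          simp
          omega
      · refine Finset.sum_congr rfl fun j _ => ?_
        rw [smul_mul_smul_comm, toCochains_mul]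
        congr 1
        · simp [pow_add]
        refine toCochains_congr (by omega) _ _ fun a => ?_
        rw [face_apply, cup_apply, cup_apply, face_apply]
        congr 2
        · ext i
          have := i.isLt
          simp only [Fin.contractNth, Fin.val_natAdd, Fin.val_castSucc, Fin.val_castAdd]
          rw [if_pos (by omega)]
          rfl
        · ext i
          simp only [Fin.contractNth, Fin.val_natAdd, Fin.val_castSucc, add_lt_add_iff_left,
            add_right_inj]
          rfl

section Augmented

variable (ε : A →ₐ[k] k)

/-- The augmentation as a 1-cochain. -/
def augCochain : Cochain k A 1 :=
  .ofMultilinear (MultilinearMap.ofSubsingleton k A k (0 : Fin 1) ε.toLinearMap)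

/-- The differential. On a `q`-cochain `f` it is
`(df)(a_0, …, a_q) = ε(a_0) f(a_1, …, a_q) + ∑_{j < q} (-1)^{j+1} f(a_0, …, a_j a_{j+1}, …, a_q)
  + (-1)^{q+1} f(a_0, …, a_{q-1}) ε(a_q)`. -/
def d : Cochains k A →ₗ[k] Cochains k A :=
  innerD + LinearMap.mulLeft k (augCochain ε).toCochains -
    LinearMap.mulRight k (augCochain ε).toCochains ∘ₗ signMap

theorem d_apply (z : Cochains k A) : d ε z =
    innerD z + (augCochain ε).toCochains * z - signMap z * (augCochain ε).toCochains := rfl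

theorem d_mul (z w : Cochains k A) : d ε (z * w) = d ε z * w + signMap z * d ε w := by
  simp only [d_apply, innerD_mul, signMap_mul, add_mul, mul_add, sub_mul, mul_sub, mul_assoc]
  abel

theorem signMap_d (z : Cochains k A) : signMap (d ε z) = - d ε (signMap z) := by
  simp only [d_apply, map_add, map_sub, signMap_mul, signMap_innerD, signMap_lof]
  simp only [pow_one, neg_smul, one_smul, neg_mul, mul_neg]
  abel

theorem d_algebraMap (c : k) : d ε (algebraMap k (Cochains k A) c) = 0 := by
  have h : algebraMap k (Cochains k A) c = (constCochain c : Cochain k A 0).toCochains := rfl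
  rw [d_apply, h, innerD_lof, signMap_lof, ← h]
  simp [Algebra.commutes]

/-- The algebra of cocycles. -/
def Cocycles : Subalgebra k (Cochains k A) where
  carrier := {z | d ε z = 0}
  mul_mem' {z w} hz hw := by
    have hz' : d ε z = 0 := hz
    have hw' : d ε w = 0 := hw
    simp [d_mul, hz', hw']
  add_mem' {z w} hz hw := by
    have hz' : d ε z = 0 := hz
    have hw' : d ε w = 0 := hw
    simp [hz', hw']
  algebraMap_mem' c := d_algebraMap ε c

/-- The coboundaries, an ideal of the algebra of cocycles. -/
def Coboundaries : Ideal (Cocycles ε) where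
  carrier := {z | ∃ c, d ε c = z}
  add_mem' := by
    rintro _ _ ⟨c, hc⟩ ⟨c', hc'⟩
    exact ⟨c + c', by simp [hc, hc']⟩
  zero_mem' := ⟨0, by simp⟩
  smul_mem' := by
    rintro ⟨w, hw⟩ ⟨z, hz⟩ ⟨c, hc⟩
    refine ⟨signMap w * c, ?_⟩
    have hw' : d ε (signMap w) = 0 := by
      rw [← neg_eq_zero, ← signMap_d, show d ε w = 0 from hw, map_zero]
    change d ε c = z at hc
    simp [d_mul, hw', signMap_signMap, hc]

instance : (Coboundaries ε).IsTwoSided where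
  mul_mem_of_left := by
    rintro ⟨z, hz⟩ ⟨w, hw⟩ ⟨c, hc⟩
    refine ⟨c * w, ?_⟩
    change d ε c = z at hc
    simp [d_mul, hc, show d ε w = 0 from hw]

/-- The cohomology algebra `Ext_A(k, k)` of the augmented algebra `ε : A → k`, computed from the bar
resolution. -/
def ExtAlg : Type _ := Cocycles ε ⧸ Coboundaries ε

instance : Ring (ExtAlg ε) := inferInstanceAs (Ring (Cocycles ε ⧸ Coboundaries ε))

instance : Algebra k (ExtAlg ε) := inferInstanceAs (Algebra k (Cocycles ε ⧸ Coboundaries ε))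

/-- The class of a cocycle. -/
def cls : Cocycles ε →ₐ[k] ExtAlg ε := Ideal.Quotient.mkₐ k (Coboundaries ε)

/-- The cochain `z` is a cocycle and represents the class `h`. -/
def Represents (z : Cochains k A) (h : ExtAlg ε) : Prop :=
  ∃ hz : z ∈ Cocycles ε, cls ε ⟨z, hz⟩ = h

end Augmented

section Inflation

variable {B : Type w} [Ring B] [Algebra k B]

/-- The pullback `(φ^* f)(a_1, …, a_q) = f(φ a_1, …, φ a_q)`. -/
def pullCochain (φ : A →ₐ[k] B) (q : ℕ) : Cochain k B q →ₗ[k] Cochain k A q where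
  toFun f := .ofMultilinear (f.toMultilinear.compLinearMap fun _ => φ.toLinearMap)
  map_add' _ _ := rfl
  map_smul' _ _ := rfl

theorem pullCochain_apply (φ : A →ₐ[k] B) (q : ℕ) (f : Cochain k B q) (a : Fin q → A) :
    pullCochain φ q f a = f (fun i => φ (a i)) := rfl

/-- The pullback as a homomorphism of cochain algebras. -/
def pull (φ : A →ₐ[k] B) : Cochains k B →ₐ[k] Cochains k A :=
  DirectSum.toAlgebra k _
    (fun q => DirectSum.lof k ℕ (fun q => Cochain k A q) q ∘ₗ pullCochain φ q) rfl
    (fun {q r} f g => by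
      exact (toCochains_mul (pullCochain φ q f) (pullCochain φ r g)).symm)

theorem pull_lof (φ : A →ₐ[k] B) {q : ℕ} (f : Cochain k B q) :
    pull φ f.toCochains = (pullCochain φ q f).toCochains := by
  exact DirectSum.toAddMonoid_of (fun q => ((DirectSum.lof k ℕ (fun q => Cochain k A q) q) ∘ₗ
    pullCochain φ q).toAddMonoidHom) q f

theorem pull_signMap (φ : A →ₐ[k] B) (z : Cochains k B) :
    pull φ (signMap z) = signMap (pull φ z) := by
  induction z using cochains_induction with
  | h0 => simp
  | h2 x y hx hy => simp [hx, hy]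
  | h1 q f => simp [signMap_lof, pull_lof]

theorem pull_innerD (φ : A →ₐ[k] B) (z : Cochains k B) :
    pull φ (innerD z) = innerD (pull φ z) := by
  induction z using cochains_induction with
  | h0 => simp
  | h2 x y hx hy => simp [hx, hy]
  | h1 q f =>
    simp only [innerD_lof, pull_lof, map_sum, map_smul]
    refine Finset.sum_congr rfl fun j _ => ?_
    congr 2
    ext a
    rw [face_apply, pullCochain_apply, pullCochain_apply, face_apply]
    congr 1
    ext i
    simp only [Fin.contractNth]
    split_ifs <;> simp

theorem pull_d {ε : A →ₐ[k] k} {η : B →ₐ[k] k} (φ : A →ₐ[k] B) (h : ∀ a, η (φ a) = ε a)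
    (z : Cochains k B) : pull φ (d η z) = d ε (pull φ z) := by
  have h1 : pullCochain φ 1 (augCochain η) = augCochain ε := by
    ext a
    exact h _
  simp only [d_apply, map_add, map_sub, map_mul, pull_signMap, pull_innerD, pull_lof, h1]

/-- The homomorphism `Ext_B(k, k) → Ext_A(k, k)` induced by a homomorphism `φ : A → B` of augmented
algebras. -/
def extMap {ε : A →ₐ[k] k} {η : B →ₐ[k] k} (φ : A →ₐ[k] B) (h : ∀ a, η (φ a) = ε a) :
    ExtAlg η →ₐ[k] ExtAlg ε :=
  Ideal.Quotient.liftₐ (Coboundaries η)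
    ((cls ε).comp (((pull φ).comp (Cocycles η).val).codRestrict (Cocycles ε) fun z => by
      change d ε (pull φ z.1) = 0
      rw [← pull_d φ h, show d η z.1 = 0 from z.2, map_zero]))
    (by
      rintro ⟨z, hz⟩ ⟨c, hc⟩
      change d η c = z at hc
      refine Ideal.Quotient.eq_zero_iff_mem.mpr ⟨pull φ c, ?_⟩
      rw [← pull_d φ h, hc]
      rfl)

end Inflation

end Cochains

/-! ### Cohomology of finite supergroup schemes -/

section Supergroup

variable (k : Type u) (A : Type v) [Field k] [Ring A] [Algebra k A] [SupergroupAlgebra k A]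

/-- The augmentation `ε : kG → k`, given by the counit. -/
def aug : A →ₐ[k] k :=
  AlgHom.ofLinearMap Coalgebra.counit counit_one counit_mul

/-- Homomorphisms of finite supergroup schemes `G → G'`, given by homomorphisms `kG → kG'` of
`ℤ/2`-graded Hopf algebras. -/
structure Hom (B : Type w) [Ring B] [Algebra k B] [SupergroupAlgebra k B] extends A →ₐ[k] B where
  map_par : ∀ t, ∀ a ∈ (par t : Submodule k A), toAlgHom a ∈ (par t : Submodule k B)
  map_counit : ∀ a, Coalgebra.counit (R := k) (toAlgHom a) = Coalgebra.counit (R := k) a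
  map_comul : ∀ a, Coalgebra.comul (R := k) (toAlgHom a) =
    TensorProduct.map toAlgHom.toLinearMap toAlgHom.toLinearMap (Coalgebra.comul (R := k) a)

/-- The `q`-cochains of internal degree `t`: those vanishing on homogeneous arguments whose total
degree is different from `t`. -/
def cochainPar (q : ℕ) (t : ZMod 2) : Submodule k (Cochain k A q) where
  carrier := {f | ∀ (s : Fin q → ZMod 2) (a : Fin q → A),
    (∀ i, a i ∈ (par (s i) : Submodule k A)) → ∑ i, s i ≠ t → f a = 0}
  add_mem' hf hg s a ha hs := by simp [hf s a ha hs, hg s a ha hs]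
  zero_mem' _ _ _ _ := rfl
  smul_mem' c f hf s a ha hs := by simp [hf s a ha hs]

/-- The cohomology algebra `H^{*,*}(G, k) = Ext^{*,*}_{kG}(k, k)`. -/
abbrev Cohomology : Type _ := ExtAlg (aug k A)

/-- The part `H^{q,t}(G, k)` of cohomological degree `q` and internal degree `t`: the classes of the
`q`-cocycles of internal degree `t`. -/
def bideg (q : ℕ) (t : ZMod 2) : Submodule k (Cohomology k A) :=
  (((cochainPar k A q t).map (DirectSum.lof k ℕ (fun q => Cochain k A q) q)).comap
    (Cocycles (aug k A)).val.toLinearMap).map (cls (aug k A)).toLinearMap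

variable {k A} {B : Type w} [Ring B] [Algebra k B] [SupergroupAlgebra k B]

/-- The inflation map `H^{*,*}(G', k) → H^{*,*}(G, k)` along `φ : G → G'`. -/
def inflation (φ : Hom k A B) : Cohomology k B →ₐ[k] Cohomology k A :=
  extMap φ.toAlgHom φ.map_counit

end Supergroup

/-! ### The group algebra of `E^-_{m,n}` -/

namespace WittElementary

section Witt

variable {p : ℕ} [Fact p.Prime] {R : Type v} [CommRing R] {S : Type w} [CommRing S] {n : ℕ}

/-- The Witt vector `(v_0, …, v_{n-1}, 0, 0, …)`. -/
def wittVec (p : ℕ) {R : Type v} [CommRing R] {n : ℕ} (v : Fin n → R) : WittVector p R :=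
  WittVector.mk p fun j => if h : j < n then v ⟨j, h⟩ else 0

/-- `S_i(v_0, …, v_i, v'_0, …, v'_i)`, for the polynomials `S_i` which give the addition of Witt
vectors. -/
def wittSum (p : ℕ) [Fact p.Prime] {R : Type v} [CommRing R] {n : ℕ} (v v' : Fin n → R)
    (i : Fin n) : R := (wittVec p v + wittVec p v').coeff i

/-- The components of the negative of a Witt vector. -/
def wittNeg (p : ℕ) [Fact p.Prime] {R : Type v} [CommRing R] {n : ℕ} (v : Fin n → R)
    (i : Fin n) : R := (-wittVec p v).coeff i

theorem wittVec_coeff (v : Fin n → R) (i : Fin n) : (wittVec p v).coeff i = v i := by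
  simp [wittVec]

theorem truncate_eq_iff {x y : WittVector p R} :
    WittVector.truncate n x = WittVector.truncate n y ↔ ∀ i : Fin n, x.coeff i = y.coeff i := by
  constructor
  · intro h i
    rw [← WittVector.coeff_truncate, h, WittVector.coeff_truncate]
  · intro h
    ext i
    rw [WittVector.coeff_truncate, WittVector.coeff_truncate, h]

theorem truncate_wittVec_coeff (x : WittVector p R) :
    WittVector.truncate n (wittVec p fun i : Fin n => x.coeff i) = WittVector.truncate n x :=
  truncate_eq_iff.mpr fun i => by rw [wittVec_coeff]

theorem map_wittVec (f : R →+* S) (v : Fin n → R) :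
    WittVector.map f (wittVec p v) = wittVec p (fun i => f (v i)) := by
  ext j
  simp only [WittVector.map_coeff, wittVec, WittVector.coeff_mk]
  split_ifs <;> simp

theorem map_wittSum (f : R →+* S) (v v' : Fin n → R) (i : Fin n) :
    f (wittSum p v v' i) = wittSum p (fun i => f (v i)) (fun i => f (v' i)) i := by
  rw [wittSum, wittSum, ← map_wittVec, ← map_wittVec, ← map_add, WittVector.map_coeff]

theorem map_wittNeg (f : R →+* S) (v : Fin n → R) (i : Fin n) :
    f (wittNeg p v i) = wittNeg p (fun i => f (v i)) i := by
  rw [wittNeg, wittNeg, ← map_wittVec, ← map_neg, WittVector.map_coeff]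

theorem wittSum_assoc (u v w : Fin n → R) :
    wittSum p (wittSum p u v) w = wittSum p u (wittSum p v w) := by
  funext i
  refine truncate_eq_iff.mp ?_ i
  unfold wittSum
  rw [map_add, map_add, truncate_wittVec_coeff, truncate_wittVec_coeff, map_add, map_add, add_assoc]

theorem wittSum_comm (u v : Fin n → R) : wittSum p u v = wittSum p v u := by
  funext i
  rw [wittSum, wittSum, add_comm]

theorem wittVec_zero : wittVec p (fun _ : Fin n => (0 : R)) = 0 := by
  ext j
  simp [wittVec]

theorem wittSum_zero_left (v : Fin n → R) : wittSum p (fun _ => 0) v = v := by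
  funext i
  rw [wittSum, wittVec_zero, zero_add, wittVec_coeff]

theorem wittSum_zero_right (v : Fin n → R) : wittSum p v (fun _ => 0) = v := by
  rw [wittSum_comm, wittSum_zero_left]

theorem wittSum_neg_left (v : Fin n → R) : wittSum p (wittNeg p v) v = fun _ => 0 := by
  funext i
  rw [← wittVec_coeff (p := p) (fun _ : Fin n => (0 : R)) i]
  refine truncate_eq_iff.mp ?_ i
  unfold wittNeg
  rw [map_add, truncate_wittVec_coeff, ← map_add, neg_add_cancel, wittVec_zero]

theorem wittSum_neg_right (v : Fin n → R) : wittSum p v (wittNeg p v) = fun _ => 0 := by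
  rw [wittSum_comm, wittSum_neg_left]

theorem coeff_add_of_zero (x y : WittVector p R) (N : ℕ) (hx : ∀ j < N, x.coeff j = 0)
    (hy : ∀ j < N, y.coeff j = 0) : (x + y).coeff N = x.coeff N + y.coeff N := by
  have key : ∀ z : WittVector p R, (∀ j < N, z.coeff j = 0) →
      z = (WittVector.verschiebung)^[N] (z.shift N) :=
    fun z hz => WittVector.eq_iterate_verschiebung hz
  rw [key x hx, key y hy, ← iterate_map_add]
  have h : ∀ z : WittVector p R, ((WittVector.verschiebung)^[N] z).coeff N = z.coeff 0 := by
    intro z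
    have := WittVector.iterate_verschiebung_coeff z N 0
    rwa [zero_add] at this
  rw [h, h, h, WittVector.add_coeff_zero]

theorem coeff_frob [CharP R p] (x : WittVector p R) (j r : ℕ) :
    ((WittVector.frobenius^[r]) x).coeff j = x.coeff j ^ p ^ r := by
  induction r with
  | zero => simp
  | succ r ih => rw [Function.iterate_succ_apply', WittVector.coeff_frobenius_charP, ih, ← pow_mul,
      pow_succ]

theorem wittSum_pow [CharP R p] (v v' : Fin n → R) (i : Fin n) (r : ℕ)
    (hv : ∀ j < i, v j ^ p ^ r = 0) (hv' : ∀ j < i, v' j ^ p ^ r = 0) :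
    wittSum p v v' i ^ p ^ r = v i ^ p ^ r + v' i ^ p ^ r := by
  rw [wittSum, ← coeff_frob, iterate_map_add, coeff_add_of_zero]
  · rw [coeff_frob, coeff_frob, wittVec_coeff, wittVec_coeff]
  · intro j hj
    have := hv ⟨j, hj.trans i.isLt⟩ hj
    rwa [coeff_frob, ← wittVec_coeff (p := p) v ⟨j, hj.trans i.isLt⟩] at *
  · intro j hj
    have := hv' ⟨j, hj.trans i.isLt⟩ hj
    rwa [coeff_frob, ← wittVec_coeff (p := p) v' ⟨j, hj.trans i.isLt⟩] at *

theorem wittNeg_pow [CharP R p] (v : Fin n → R) (i : Fin n) (r : ℕ)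
    (hv : ∀ j ≤ i, v j ^ p ^ r = 0) : wittNeg p v i ^ p ^ r = 0 := by
  have hneg : ∀ N : ℕ, ∀ j : Fin n, (j : ℕ) = N → j ≤ i → wittNeg p v j ^ p ^ r = 0 := by
    intro N
    induction N using Nat.strong_induction_on with
    | _ N ih =>
      intro j hj hji
      have h : (wittSum p (wittNeg p v) v j) ^ p ^ r = 0 := by
        rw [wittSum_neg_left, zero_pow]
        exact (pow_pos (Fact.out : p.Prime).pos r).ne'
      rw [wittSum_pow, hv j hji, add_zero] at h
      · exact h
      · intro l hl
        exact ih l (by rw [← hj]; exact hl) l rfl (hl.le.trans hji)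
      · intro l hl
        exact hv l (hl.le.trans hji)
  exact hneg i i rfl le_rfl

end Witt

variable (k : Type u) [Field k] (p : ℕ) (m n : ℕ+)

/-- The exponents of the truncations: `s_i^p = 0` for `i < n` and `s_n^{p^m} = 0`. -/
def trunc (i : Fin n) : ℕ := if (i : ℕ) + 1 = n then p ^ (m : ℕ) else p

/-- The even part `k[s_1, …, s_n]/(s_1^p, …, s_{n-1}^p, s_n^{p^m})` of the group algebra. The
generator `s_i` has index `i - 1` in `Fin n`. -/
def EvenAlg : Type u :=
  MvPolynomial (Fin n) k ⧸ Ideal.span (Set.range fun i : Fin n =>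
    (MvPolynomial.X i : MvPolynomial (Fin n) k) ^ trunc p m n i)

instance : CommRing (EvenAlg k p m n) := inferInstanceAs (CommRing (_ ⧸ _))

instance : Algebra k (EvenAlg k p m n) := inferInstanceAs (Algebra k (MvPolynomial (Fin n) k ⧸ _))

namespace EvenAlg

/-- The generators `s_i`. -/
def s (i : Fin n) : EvenAlg k p m n := Ideal.Quotient.mk _ (MvPolynomial.X i)

theorem s_pow (i : Fin n) : s k p m n i ^ trunc p m n i = 0 := by
  exact Ideal.Quotient.eq_zero_iff_mem.mpr (Ideal.subset_span ⟨i, rfl⟩)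

variable {R : Type v} [CommRing R] [Algebra k R]

/-- The algebra homomorphism with prescribed values on the generators. -/
def lift (v : Fin n → R) (hv : ∀ i, v i ^ trunc p m n i = 0) : EvenAlg k p m n →ₐ[k] R :=
  Ideal.Quotient.liftₐ _ (MvPolynomial.aeval v) (by
    intro a ha
    have : Ideal.span (Set.range fun i : Fin n =>
        (MvPolynomial.X i : MvPolynomial (Fin n) k) ^ trunc p m n i) ≤
        RingHom.ker (MvPolynomial.aeval v : MvPolynomial (Fin n) k →ₐ[k] R) := by
      rw [Ideal.span_le]
      rintro _ ⟨i, rfl⟩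
      simp [RingHom.mem_ker, hv]
    exact this ha)

@[simp]
theorem lift_s (v : Fin n → R) (hv : ∀ i, v i ^ trunc p m n i = 0) (i : Fin n) :
    lift k p m n v hv (s k p m n i) = v i := by
  change MvPolynomial.aeval v (MvPolynomial.X i) = v i
  simp

variable {k p m n} in
theorem hom_ext {S : Type w} [Semiring S] [Algebra k S] {f g : EvenAlg k p m n →ₐ[k] S}
    (h : ∀ i, f (s k p m n i) = g (s k p m n i)) : f = g := by
  refine Ideal.Quotient.algHom_ext _ ?_
  exact MvPolynomial.algHom_ext h

variable [Fact p.Prime]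

theorem trunc_pos (i : Fin n) : 0 < trunc p m n i := by
  have := (Fact.out : p.Prime).pos
  unfold trunc
  split_ifs
  · exact pow_pos this _
  · exact this

theorem trunc_eq (i : Fin n) : ∃ r, 1 ≤ r ∧ trunc p m n i = p ^ r := by
  unfold trunc
  split_ifs
  · exact ⟨m, m.pos, rfl⟩
  · exact ⟨1, le_rfl, (pow_one p).symm⟩

theorem pow_trunc_of_lt {M : Type*} [MonoidWithZero M] {v : Fin n → M}
    (hv : ∀ i, v i ^ trunc p m n i = 0) {i j : Fin n} (hj : j < i) : v j ^ p = 0 := by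
  have h := hv j
  rwa [trunc, if_neg] at h
  have := i.isLt
  have : (j : ℕ) < i := hj
  omega

theorem pow_trunc_of_le {M : Type*} [MonoidWithZero M] {v : Fin n → M}
    (hv : ∀ i, v i ^ trunc p m n i = 0) {i j : Fin n} (hj : j ≤ i) : v j ^ trunc p m n i = 0 := by
  rcases hj.eq_or_lt with rfl | hlt
  · exact hv _
  · obtain ⟨r, hr, h⟩ := trunc_eq p m n i
    rw [h, ← Nat.sub_add_cancel hr, pow_succ', pow_mul, pow_trunc_of_lt p m n hv hlt, zero_pow]
    exact (pow_pos (Fact.out : p.Prime).pos _).ne'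

theorem wittSum_trunc [CharP R p] {v v' : Fin n → R} (hv : ∀ i, v i ^ trunc p m n i = 0)
    (hv' : ∀ i, v' i ^ trunc p m n i = 0) (i : Fin n) :
    wittSum p v v' i ^ trunc p m n i = 0 := by
  have h1 := fun j (hj : j ≤ i) => pow_trunc_of_le p m n hv hj
  have h2 := fun j (hj : j ≤ i) => pow_trunc_of_le p m n hv' hj
  obtain ⟨r, -, h⟩ := trunc_eq p m n i
  rw [h] at h1 h2 ⊢
  rw [wittSum_pow v v' i r (fun j hj => h1 j hj.le) (fun j hj => h2 j hj.le), h1 i le_rfl,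
    h2 i le_rfl, add_zero]

theorem wittNeg_trunc [CharP R p] {v : Fin n → R} (hv : ∀ i, v i ^ trunc p m n i = 0)
    (i : Fin n) : wittNeg p v i ^ trunc p m n i = 0 := by
  have h1 := fun j (hj : j ≤ i) => pow_trunc_of_le p m n hv hj
  obtain ⟨r, -, h⟩ := trunc_eq p m n i
  rw [h] at h1 ⊢
  exact wittNeg_pow v i r h1

/-- The counit, `s_i ↦ 0`. -/
def counit : EvenAlg k p m n →ₐ[k] k :=
  lift k p m n (fun _ => 0) fun i => zero_pow (trunc_pos p m n i).ne'

@[simp]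
theorem counit_s (i : Fin n) : counit k p m n (s k p m n i) = 0 := by
  simp [counit]

instance : Nontrivial (EvenAlg k p m n) := (counit k p m n).toRingHom.domain_nontrivial

instance : Nontrivial (EvenAlg k p m n ⊗[k] EvenAlg k p m n) :=
  (Algebra.TensorProduct.lift (counit k p m n) (counit k p m n)
    fun _ _ => Commute.all _ _).toRingHom.domain_nontrivial

variable [CharP k p]

instance : CharP (EvenAlg k p m n) p := charP_of_injective_algebraMap
  (algebraMap k (EvenAlg k p m n)).injective p

instance : CharP (EvenAlg k p m n ⊗[k] EvenAlg k p m n) p := charP_of_injective_algebraMap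
  (algebraMap k (EvenAlg k p m n ⊗[k] EvenAlg k p m n)).injective p

theorem s_tmul_one (i : Fin n) :
    (s k p m n i ⊗ₜ[k] (1 : EvenAlg k p m n)) ^ trunc p m n i = 0 := by
  rw [Algebra.TensorProduct.tmul_pow, s_pow, TensorProduct.zero_tmul]

theorem one_tmul_s (i : Fin n) :
    ((1 : EvenAlg k p m n) ⊗ₜ[k] s k p m n i) ^ trunc p m n i = 0 := by
  rw [Algebra.TensorProduct.tmul_pow, s_pow, TensorProduct.tmul_zero]

/-- The comultiplication,
`Δ(s_i) = S_{i-1}(s_1 ⊗ 1, …, s_i ⊗ 1, 1 ⊗ s_1, …, 1 ⊗ s_i)`. -/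
def comul : EvenAlg k p m n →ₐ[k] EvenAlg k p m n ⊗[k] EvenAlg k p m n :=
  lift k p m n (wittSum p (fun i => s k p m n i ⊗ₜ 1) (fun i => 1 ⊗ₜ s k p m n i))
    (wittSum_trunc p m n (s_tmul_one k p m n) (one_tmul_s k p m n))

theorem comul_s (i : Fin n) : comul k p m n (s k p m n i) =
    wittSum p (fun i => s k p m n i ⊗ₜ 1) (fun i => 1 ⊗ₜ s k p m n i) i := by
  simp [comul]

theorem map_comul_s {S : Type w} [CommRing S] [Algebra k S]
    (f : EvenAlg k p m n ⊗[k] EvenAlg k p m n →ₐ[k] S) (i : Fin n) :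
    f (comul k p m n (s k p m n i)) =
      wittSum p (fun i => f (s k p m n i ⊗ₜ 1)) (fun i => f (1 ⊗ₜ s k p m n i)) i := by
  rw [comul_s]
  exact map_wittSum f.toRingHom _ _ i

instance : Bialgebra k (EvenAlg k p m n) :=
  Bialgebra.ofAlgHom (comul k p m n) (counit k p m n)
    (by
      refine hom_ext fun i => ?_
      let u₁ := fun i => s k p m n i ⊗ₜ[k]
        ((1 : EvenAlg k p m n) ⊗ₜ[k] (1 : EvenAlg k p m n))
      let u₂ := fun i => (1 : EvenAlg k p m n) ⊗ₜ[k]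
        (s k p m n i ⊗ₜ[k] (1 : EvenAlg k p m n))
      let u₃ := fun i => (1 : EvenAlg k p m n) ⊗ₜ[k]
        ((1 : EvenAlg k p m n) ⊗ₜ[k] s k p m n i)
      trans wittSum p (wittSum p u₁ u₂) u₃ i
      · have h := map_comul_s k p m n
          ((Algebra.TensorProduct.assoc k k k (EvenAlg k p m n) (EvenAlg k p m n)
            (EvenAlg k p m n)).toAlgHom.comp (Algebra.TensorProduct.map (comul k p m n)
              (AlgHom.id k (EvenAlg k p m n)))) i
        refine h.trans ?_
        congr 1
        · funext j
          have h' := map_comul_s k p m n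
            ((Algebra.TensorProduct.assoc k k k (EvenAlg k p m n) (EvenAlg k p m n)
              (EvenAlg k p m n)).toAlgHom.comp Algebra.TensorProduct.includeLeft) j
          exact h'
        · funext j
          simp [u₃, Algebra.TensorProduct.one_def]
      · rw [wittSum_assoc]
        have h := map_comul_s k p m n (Algebra.TensorProduct.map
          (AlgHom.id k (EvenAlg k p m n)) (comul k p m n)) i
        refine Eq.trans ?_ h.symm
        congr 1
        · funext j
          simp [u₁, Algebra.TensorProduct.one_def]
        · funext j
          have h' := map_comul_s k p m n
            (Algebra.TensorProduct.includeRight (R := k) (A := EvenAlg k p m n)) j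
          exact h'.symm)
    (by
      refine hom_ext fun i => ?_
      refine (map_comul_s k p m n (Algebra.TensorProduct.map (counit k p m n)
        (AlgHom.id k (EvenAlg k p m n))) i).trans ?_
      simp [TensorProduct.zero_tmul, wittSum_zero_left])
    (by
      refine hom_ext fun i => ?_
      refine (map_comul_s k p m n (Algebra.TensorProduct.map (AlgHom.id k (EvenAlg k p m n))
        (counit k p m n)) i).trans ?_
      simp [TensorProduct.tmul_zero, wittSum_zero_right])

/-- The antipode. -/
def antipode : EvenAlg k p m n →ₐ[k] EvenAlg k p m n :=
  lift k p m n (wittNeg p (s k p m n)) (wittNeg_trunc p m n (s_pow k p m n))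

instance : HopfAlgebra k (EvenAlg k p m n) :=
  HopfAlgebra.ofAlgHom (antipode k p m n)
    (by
      refine hom_ext fun i => ?_
      refine (map_comul_s k p m n (Algebra.TensorProduct.lift (antipode k p m n)
        (AlgHom.id k (EvenAlg k p m n)) fun _ _ => Commute.all _ _) i).trans ?_
      have h : (Bialgebra.counitAlgHom k (EvenAlg k p m n)) (s k p m n i) = 0 :=
        counit_s k p m n i
      simp [antipode, wittSum_neg_left, h])
    (by
      refine hom_ext fun i => ?_
      refine (map_comul_s k p m n (Algebra.TensorProduct.lift (AlgHom.id k (EvenAlg k p m n))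
        (antipode k p m n) fun _ _ => Commute.all _ _) i).trans ?_
      have h : (Bialgebra.counitAlgHom k (EvenAlg k p m n)) (s k p m n i) = 0 :=
        counit_s k p m n i
      simp [antipode, wittSum_neg_right, h])

theorem comul_comm (b : EvenAlg k p m n) :
    TensorProduct.comm k _ _ (Coalgebra.comul (R := k) b) = Coalgebra.comul (R := k) b := by
  have h : ((Algebra.TensorProduct.comm k (EvenAlg k p m n) (EvenAlg k p m n)).toAlgHom.comp
      (comul k p m n)) = comul k p m n := by
    refine hom_ext fun i => ?_
    refine (map_comul_s k p m n (Algebra.TensorProduct.comm k (EvenAlg k p m n)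
      (EvenAlg k p m n)).toAlgHom i).trans ?_
    rw [comul_s, wittSum_comm]
    rfl
  exact DFunLike.congr_fun h b

instance : Module.Finite k (EvenAlg k p m n) := by
  have hft : Algebra.FiniteType k (EvenAlg k p m n) :=
    .of_surjective (f := (Ideal.Quotient.mkₐ k (Ideal.span (Set.range fun i : Fin n =>
      (MvPolynomial.X i : MvPolynomial (Fin n) k) ^ trunc p m n i)) :
        MvPolynomial (Fin n) k →ₐ[k] EvenAlg k p m n)) Ideal.Quotient.mk_surjective
  have hint : Algebra.IsIntegral k (EvenAlg k p m n) := by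
    refine ⟨fun b => ?_⟩
    obtain ⟨f, rfl⟩ := Ideal.Quotient.mk_surjective b
    induction f using MvPolynomial.induction_on with
    | C c => exact isIntegral_algebraMap
    | add f g hf hg => exact hf.add hg
    | mul_X f i hf =>
      have hs : IsIntegral k (s k p m n i) := IsIntegral.of_pow (trunc_pos p m n i)
        ((s_pow k p m n i).symm ▸ isIntegral_zero)
      exact IsIntegral.mul (A := EvenAlg k p m n) hf hs
  exact Algebra.IsIntegral.finite

/-- The index of the generator `s_n`. -/
def top : Fin n := ⟨n - 1, Nat.sub_lt n.pos Nat.one_pos⟩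

theorem comul_top_pow :
    Coalgebra.comul (R := k) (s k p m n (top n) ^ p) =
      (s k p m n (top n) ^ p) ⊗ₜ[k] (1 : EvenAlg k p m n) + 1 ⊗ₜ[k] (s k p m n (top n) ^ p) := by
  change comul k p m n (s k p m n (top n) ^ p) = _
  rw [map_pow, comul_s]
  have h := wittSum_pow (p := p) (fun i => s k p m n i ⊗ₜ[k] (1 : EvenAlg k p m n))
    (fun i => (1 : EvenAlg k p m n) ⊗ₜ[k] s k p m n i) (top n) 1
    (fun j hj => by rw [pow_one]; exact pow_trunc_of_lt p m n (s_tmul_one k p m n) hj)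
    (fun j hj => by rw [pow_one]; exact pow_trunc_of_lt p m n (one_tmul_s k p m n) hj)
  simpa [pow_one, Algebra.TensorProduct.tmul_pow] using h

end EvenAlg

/-- The group algebra
`kE^-_{m,n} = k[s_1, …, s_n, σ]/(s_1^p, …, s_{n-1}^p, s_n^{p^m}, σ² - s_n^p)`. The element
`b + b' σ` with `b, b'` in the even part is `⟨b, b'⟩`. -/
def GroupAlg : Type u :=
  QuadraticAlgebra (EvenAlg k p m n) (EvenAlg.s k p m n (EvenAlg.top n) ^ p) 0

instance : CommRing (GroupAlg k p m n) := inferInstanceAs (CommRing (QuadraticAlgebra _ _ _))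

instance : Algebra k (GroupAlg k p m n) := inferInstanceAs (Algebra k (QuadraticAlgebra _ _ _))

namespace GroupAlg

open EvenAlg (top)

/-- The inclusion `b ↦ b` of the even part. -/
def ev : EvenAlg k p m n →ₗ[k] GroupAlg k p m n where
  toFun b := (⟨b, 0⟩ : QuadraticAlgebra _ _ _)
  map_add' b c := QuadraticAlgebra.ext rfl (add_zero _).symm
  map_smul' c b := QuadraticAlgebra.ext rfl (smul_zero _).symm

/-- The map `b ↦ b σ` onto the odd part. -/
def od : EvenAlg k p m n →ₗ[k] GroupAlg k p m n where
  toFun b := (⟨0, b⟩ : QuadraticAlgebra _ _ _)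
  map_add' b c := QuadraticAlgebra.ext (add_zero _).symm rfl
  map_smul' c b := QuadraticAlgebra.ext (smul_zero _).symm rfl

/-- The component `b` of `b + b' σ`. -/
def re : GroupAlg k p m n →ₗ[k] EvenAlg k p m n where
  toFun a := QuadraticAlgebra.re a
  map_add' _ _ := rfl
  map_smul' _ _ := rfl

/-- The component `b'` of `b + b' σ`. -/
def im : GroupAlg k p m n →ₗ[k] EvenAlg k p m n where
  toFun a := QuadraticAlgebra.im a
  map_add' _ _ := rfl
  map_smul' _ _ := rfl

/-- The generators `s_i`. -/
def s (i : Fin n) : GroupAlg k p m n := ev k p m n (EvenAlg.s k p m n i)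

/-- The odd generator `σ`. -/
def σ : GroupAlg k p m n := od k p m n 1

variable {k p m n}

@[ext]
theorem ext {a b : GroupAlg k p m n} (h : re k p m n a = re k p m n b)
    (h' : im k p m n a = im k p m n b) : a = b := QuadraticAlgebra.ext h h'

@[simp] theorem re_ev (b : EvenAlg k p m n) : re k p m n (ev k p m n b) = b := rfl
@[simp] theorem im_ev (b : EvenAlg k p m n) : im k p m n (ev k p m n b) = 0 := rfl
@[simp] theorem re_od (b : EvenAlg k p m n) : re k p m n (od k p m n b) = 0 := rfl
@[simp] theorem im_od (b : EvenAlg k p m n) : im k p m n (od k p m n b) = b := rfl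

theorem re_mul (a b : GroupAlg k p m n) : re k p m n (a * b) =
    re k p m n a * re k p m n b +
      EvenAlg.s k p m n (top n) ^ p * im k p m n a * im k p m n b := rfl

theorem im_mul (a b : GroupAlg k p m n) : im k p m n (a * b) =
    re k p m n a * im k p m n b + im k p m n a * re k p m n b +
      0 * im k p m n a * im k p m n b := rfl

theorem eq_add (a : GroupAlg k p m n) :
    a = ev k p m n (re k p m n a) + od k p m n (im k p m n a) := by
  ext <;> simp

theorem ev_one : ev k p m n 1 = 1 := rfl

theorem ev_mul_ev (b c : EvenAlg k p m n) :
    ev k p m n b * ev k p m n c = ev k p m n (b * c) := by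
  ext <;> simp [re_mul, im_mul]

theorem ev_mul_od (b c : EvenAlg k p m n) :
    ev k p m n b * od k p m n c = od k p m n (b * c) := by
  ext <;> simp [re_mul, im_mul]

theorem od_mul_ev (b c : EvenAlg k p m n) :
    od k p m n b * ev k p m n c = od k p m n (b * c) := by
  ext <;> simp [re_mul, im_mul]

theorem od_mul_od (b c : EvenAlg k p m n) : od k p m n b * od k p m n c =
    ev k p m n (EvenAlg.s k p m n (top n) ^ p * (b * c)) := by
  ext <;> simp [re_mul, im_mul, mul_assoc]

theorem σ_sq : (σ k p m n) ^ 2 = s k p m n (top n) ^ p := by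
  have h : ∀ r : ℕ, s k p m n (top n) ^ r = ev k p m n (EvenAlg.s k p m n (top n) ^ r) := by
    intro r
    induction r with
    | zero => simp [ev_one]
    | succ r ih => rw [pow_succ, ih, s, ev_mul_ev, pow_succ]
  rw [h, sq, σ, od_mul_od, mul_one, mul_one]

theorem algebraMap_eq (c : k) : algebraMap k (GroupAlg k p m n) c =
    ev k p m n (algebraMap k (EvenAlg k p m n) c) := rfl

variable (k p m n) in
/-- The `ℤ/2`-grading: `s_1, …, s_n` are even and `σ` is odd. -/
def par (t : ZMod 2) : Submodule k (GroupAlg k p m n) :=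
  if t = 0 then LinearMap.ker (im k p m n) else LinearMap.ker (re k p m n)

theorem mem_par_zero {a : GroupAlg k p m n} : a ∈ par k p m n 0 ↔ im k p m n a = 0 := by
  simp [par]

theorem mem_par_one {a : GroupAlg k p m n} : a ∈ par k p m n 1 ↔ re k p m n a = 0 := by
  simp [par]

theorem ev_mem (b : EvenAlg k p m n) : ev k p m n b ∈ par k p m n 0 := mem_par_zero.mpr rfl

theorem od_mem (b : EvenAlg k p m n) : od k p m n b ∈ par k p m n 1 := mem_par_one.mpr rfl

theorem mem_par_cases {P : ZMod 2 → GroupAlg k p m n → Prop}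
    (h0 : ∀ b, P 0 (ev k p m n b)) (h1 : ∀ b, P 1 (od k p m n b))
    (t : ZMod 2) (a : GroupAlg k p m n) (ha : a ∈ par k p m n t) : P t a := by
  fin_cases t
  · have : a = ev k p m n (re k p m n a) := by
      ext
      · simp
      · simpa using mem_par_zero.mp ha
    rw [this]
    exact h0 _
  · have : a = od k p m n (im k p m n a) := by
      ext
      · simpa using mem_par_one.mp ha
      · simp
    rw [this]
    exact h1 _

instance : SetLike.GradedMonoid (par k p m n) where
  one_mem := ev_mem 1
  mul_mem := by
    intro t t' a b ha hb
    have key := mem_par_cases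
      (P := fun t a => ∀ b, b ∈ par k p m n t' → a * b ∈ par k p m n (t + t')) ?_ ?_ t a ha
    · exact key b hb
    · intro b c hc
      refine mem_par_cases (P := fun t' c => ev k p m n b * c ∈ par k p m n (0 + t')) ?_ ?_ t' c hc
      · intro c
        rw [ev_mul_ev]
        exact ev_mem _
      · intro c
        rw [ev_mul_od]
        exact od_mem _
    · intro b c hc
      refine mem_par_cases (P := fun t' c => od k p m n b * c ∈ par k p m n (1 + t')) ?_ ?_ t' c hc
      · intro c
        rw [od_mul_ev]
        exact od_mem _
      · intro c
        rw [od_mul_od]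
        exact ev_mem _

variable (k p m n) in
/-- The decomposition of `b + b' σ` into its even part `b` and its odd part `b' σ`. -/
def decomp : GroupAlg k p m n →ₗ[k] ⨁ t, par k p m n t :=
  DirectSum.lof k (ZMod 2) (fun t => par k p m n t) 0 ∘ₗ
      (ev k p m n).codRestrict (par k p m n 0) ev_mem ∘ₗ re k p m n +
    DirectSum.lof k (ZMod 2) (fun t => par k p m n t) 1 ∘ₗ
      (od k p m n).codRestrict (par k p m n 1) od_mem ∘ₗ im k p m n

instance : DirectSum.Decomposition (par k p m n) :=
  DirectSum.Decomposition.ofLinearMap (par k p m n) (decomp k p m n)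
    (by
      ext a : 1
      simp only [decomp, LinearMap.comp_apply, LinearMap.add_apply, map_add,
        DirectSum.coeLinearMap_lof, LinearMap.codRestrict_apply, LinearMap.id_apply]
      exact (eq_add a).symm)
    (by
      ext t ⟨a, ha⟩ : 2
      have key := mem_par_cases (P := fun t a => ∀ ha : a ∈ par k p m n t,
        decomp k p m n a = DirectSum.lof k (ZMod 2) (fun t => par k p m n t) t ⟨a, ha⟩) ?_ ?_ t a ha
      · simpa using key ha
      · intro b hb
        simp only [decomp, LinearMap.add_apply, LinearMap.comp_apply, re_ev, im_ev, map_zero,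
          add_zero]
        rfl
      · intro b hb
        simp only [decomp, LinearMap.add_apply, LinearMap.comp_apply, re_od, im_od, map_zero,
          zero_add]
        rfl)

instance : GradedAlgebra (par k p m n) where

variable [Fact p.Prime] [CharP k p]

variable (k p m n) in
/-- The comultiplication: `Δ(b) = Δ(b)` and `Δ(b σ) = Δ(b) (σ ⊗ 1 + 1 ⊗ σ)` for `b` in the even
part. -/
def comul : GroupAlg k p m n →ₗ[k] GroupAlg k p m n ⊗[k] GroupAlg k p m n :=
  TensorProduct.map (ev k p m n) (ev k p m n) ∘ₗ Coalgebra.comul ∘ₗ re k p m n +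
  (TensorProduct.map (od k p m n) (ev k p m n) + TensorProduct.map (ev k p m n) (od k p m n)) ∘ₗ
    Coalgebra.comul ∘ₗ im k p m n

variable (k p m n) in
/-- The counit, which kills `σ`. -/
def counit : GroupAlg k p m n →ₗ[k] k := Coalgebra.counit ∘ₗ re k p m n

variable (k p m n) in
/-- The antipode, `S(b + b' σ) = S(b) - S(b') σ`. -/
def antipode : GroupAlg k p m n →ₗ[k] GroupAlg k p m n :=
  ev k p m n ∘ₗ HopfAlgebra.antipode k ∘ₗ re k p m n -
    od k p m n ∘ₗ HopfAlgebra.antipode k ∘ₗ im k p m n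

theorem comul_ev (b : EvenAlg k p m n) : comul k p m n (ev k p m n b) =
    TensorProduct.map (ev k p m n) (ev k p m n) (Coalgebra.comul b) := by
  simp [comul]

theorem comul_od (b : EvenAlg k p m n) : comul k p m n (od k p m n b) =
    TensorProduct.map (od k p m n) (ev k p m n) (Coalgebra.comul b) +
      TensorProduct.map (ev k p m n) (od k p m n) (Coalgebra.comul b) := by
  simp [comul]

theorem comul_comp_ev : comul k p m n ∘ₗ ev k p m n =
    TensorProduct.map (ev k p m n) (ev k p m n) ∘ₗ Coalgebra.comul :=
  LinearMap.ext comul_ev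

theorem comul_comp_od : comul k p m n ∘ₗ od k p m n =
    (TensorProduct.map (od k p m n) (ev k p m n) +
      TensorProduct.map (ev k p m n) (od k p m n)) ∘ₗ Coalgebra.comul :=
  LinearMap.ext comul_od

theorem hom_ext {M : Type*} [AddCommMonoid M] [Module k M] {f g : GroupAlg k p m n →ₗ[k] M}
    (h0 : f ∘ₗ ev k p m n = g ∘ₗ ev k p m n) (h1 : f ∘ₗ od k p m n = g ∘ₗ od k p m n) : f = g := by
  ext a
  rw [eq_add a, map_add, map_add]
  exact congr_arg₂ _ (DFunLike.congr_fun h0 _) (DFunLike.congr_fun h1 _)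

/-- Iterated comultiplications on the even part, followed by maps into the group algebra. -/
theorem coassoc_aux (f g h : EvenAlg k p m n →ₗ[k] GroupAlg k p m n) (b : EvenAlg k p m n) :
    TensorProduct.assoc k _ _ _ (TensorProduct.map (TensorProduct.map f g ∘ₗ Coalgebra.comul) h
      (Coalgebra.comul b)) =
    TensorProduct.map f (TensorProduct.map g h ∘ₗ Coalgebra.comul) (Coalgebra.comul b) := by
  have h1 : TensorProduct.map (TensorProduct.map f g ∘ₗ Coalgebra.comul) h =
      TensorProduct.map (TensorProduct.map f g) h ∘ₗ
        (Coalgebra.comul : EvenAlg k p m n →ₗ[k] _).rTensor (EvenAlg k p m n) := by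
    rw [LinearMap.rTensor, ← TensorProduct.map_comp, LinearMap.comp_id]
  have h2 : TensorProduct.map f (TensorProduct.map g h ∘ₗ Coalgebra.comul) =
      TensorProduct.map f (TensorProduct.map g h) ∘ₗ
        (Coalgebra.comul : EvenAlg k p m n →ₗ[k] _).lTensor (EvenAlg k p m n) := by
    rw [LinearMap.lTensor, ← TensorProduct.map_comp, LinearMap.comp_id]
  rw [h1, h2, LinearMap.comp_apply, LinearMap.comp_apply, ← Coalgebra.coassoc_apply]
  generalize (Coalgebra.comul : EvenAlg k p m n →ₗ[k] _).rTensor (EvenAlg k p m n)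
    (Coalgebra.comul b) = x
  have : (TensorProduct.assoc k _ _ _).toLinearMap ∘ₗ TensorProduct.map (TensorProduct.map f g) h =
      TensorProduct.map f (TensorProduct.map g h) ∘ₗ (TensorProduct.assoc k _ _ _).toLinearMap := by
    ext
    rfl
  exact DFunLike.congr_fun this x

instance : Coalgebra k (GroupAlg k p m n) where
  comul := comul k p m n
  counit := counit k p m n
  coassoc := by
    apply hom_ext
    · ext b
      simp only [LinearMap.comp_apply, comul_ev, LinearMap.rTensor, LinearMap.lTensor,
        LinearEquiv.coe_coe]
      rw [← LinearMap.comp_apply (TensorProduct.map (comul k p m n) LinearMap.id),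
        ← LinearMap.comp_apply (TensorProduct.map LinearMap.id (comul k p m n)),
        ← TensorProduct.map_comp, ← TensorProduct.map_comp, comul_comp_ev, LinearMap.id_comp,
        coassoc_aux]
    · ext b
      simp only [LinearMap.comp_apply, comul_od, LinearMap.rTensor, LinearMap.lTensor,
        LinearEquiv.coe_coe, map_add]
      simp only [← LinearMap.comp_apply (TensorProduct.map (comul k p m n) LinearMap.id),
        ← LinearMap.comp_apply (TensorProduct.map LinearMap.id (comul k p m n)),
        ← TensorProduct.map_comp, comul_comp_ev, comul_comp_od, LinearMap.id_comp,
        LinearMap.add_comp, TensorProduct.map_add_left, TensorProduct.map_add_right,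
        LinearMap.add_apply, map_add, coassoc_aux]
      abel
  rTensor_counit_comp_comul := by
    have h0 : counit k p m n ∘ₗ ev k p m n = Coalgebra.counit := rfl
    have h1 : counit k p m n ∘ₗ od k p m n = 0 := by
      ext b
      simp [counit]
    apply hom_ext
    · ext b
      simp only [LinearMap.comp_apply, comul_ev, LinearMap.rTensor]
      rw [← LinearMap.comp_apply, ← TensorProduct.map_comp, h0, LinearMap.id_comp]
      have := congr_arg (LinearMap.lTensor k (ev k p m n))
        (Coalgebra.rTensor_counit_comul (R := k) b)
      rw [LinearMap.rTensor, LinearMap.lTensor, ← LinearMap.comp_apply, ← TensorProduct.map_comp,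
        LinearMap.id_comp, LinearMap.comp_id] at this
      simpa using this
    · ext b
      simp only [LinearMap.comp_apply, comul_od, LinearMap.rTensor, map_add]
      simp only [← LinearMap.comp_apply (TensorProduct.map (counit k p m n) LinearMap.id),
        ← TensorProduct.map_comp, h0, h1, LinearMap.id_comp]
      have := congr_arg (LinearMap.lTensor k (od k p m n))
        (Coalgebra.rTensor_counit_comul (R := k) b)
      rw [LinearMap.rTensor, LinearMap.lTensor, ← LinearMap.comp_apply, ← TensorProduct.map_comp,
        LinearMap.id_comp, LinearMap.comp_id] at this
      simpa using this
  lTensor_counit_comp_comul := by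
    have h0 : counit k p m n ∘ₗ ev k p m n = Coalgebra.counit := rfl
    have h1 : counit k p m n ∘ₗ od k p m n = 0 := by
      ext b
      simp [counit]
    apply hom_ext
    · ext b
      simp only [LinearMap.comp_apply, comul_ev, LinearMap.lTensor]
      rw [← LinearMap.comp_apply, ← TensorProduct.map_comp, h0, LinearMap.id_comp]
      have := congr_arg (LinearMap.rTensor k (ev k p m n))
        (Coalgebra.lTensor_counit_comul (R := k) b)
      rw [LinearMap.rTensor, LinearMap.lTensor, ← LinearMap.comp_apply, ← TensorProduct.map_comp,
        LinearMap.id_comp, LinearMap.comp_id] at this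
      simpa using this
    · ext b
      simp only [LinearMap.comp_apply, comul_od, LinearMap.lTensor, map_add]
      simp only [← LinearMap.comp_apply (TensorProduct.map LinearMap.id (counit k p m n)),
        ← TensorProduct.map_comp, h0, h1, LinearMap.id_comp]
      have := congr_arg (LinearMap.rTensor k (od k p m n))
        (Coalgebra.lTensor_counit_comul (R := k) b)
      rw [LinearMap.rTensor, LinearMap.lTensor, ← LinearMap.comp_apply, ← TensorProduct.map_comp,
        LinearMap.id_comp, LinearMap.comp_id] at this
      simpa using this

/-- The inclusion of the ordinary tensor product into the `ℤ/2`-graded one. -/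
abbrev gr : GroupAlg k p m n ⊗[k] GroupAlg k p m n →ₗ[k]
    GradedTensorProduct k (par k p m n) (par k p m n) :=
  (GradedTensorProduct.of k (par k p m n) (par k p m n)).toLinearMap

theorem gr_mul {t t' : ZMod 2} (a₁ b₁ a₂ b₂ : GroupAlg k p m n) (hb : b₁ ∈ par k p m n t)
    (ha : a₂ ∈ par k p m n t') :
    gr (a₁ ⊗ₜ b₁) * gr (a₂ ⊗ₜ b₂) = (-1 : ℤˣ) ^ (t * t') • gr ((a₁ * a₂) ⊗ₜ[k] (b₁ * b₂)) :=
  GradedTensorProduct.tmul_coe_mul_coe_tmul (R := k) (par k p m n) (par k p m n) a₁ ⟨b₁, hb⟩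
    ⟨a₂, ha⟩ b₂

theorem neg_one_uzpow_zero : ((-1 : ℤˣ) ^ (0 : ZMod 2)) = 1 := uzpow_zero _

/-- To compare two products in the graded tensor square it suffices to look at pure tensors. -/
theorem gr_bilin {f₁ f₂ g₁ g₂ e₁ e₂ : EvenAlg k p m n →ₗ[k] GroupAlg k p m n} {t t' : ZMod 2}
    (hf : ∀ b, f₂ b ∈ par k p m n t) (hg : ∀ b, g₁ b ∈ par k p m n t')
    (c : EvenAlg k p m n ⊗[k] EvenAlg k p m n) (u : ℤˣ) (hu : (-1 : ℤˣ) ^ (t * t') = u)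
    (h : ∀ b₁ b₂ c₁ c₂, (f₁ b₁ * g₁ c₁) ⊗ₜ[k] (f₂ b₂ * g₂ c₂) =
      TensorProduct.map e₁ e₂ (c * ((b₁ * c₁) ⊗ₜ (b₂ * c₂))))
    (x y : EvenAlg k p m n ⊗[k] EvenAlg k p m n) :
    gr (TensorProduct.map f₁ f₂ x) * gr (TensorProduct.map g₁ g₂ y) =
      u • gr (TensorProduct.map e₁ e₂ (c * (x * y))) := by
  induction x with
  | zero => simp
  | add x x' hx hx' => simp only [map_add, add_mul, mul_add, hx, hx', smul_add]
  | tmul b₁ b₂ =>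
    induction y with
    | zero => simp
    | add y y' hy hy' => simp only [map_add, mul_add, hy, hy', smul_add]
    | tmul c₁ c₂ =>
      rw [TensorProduct.map_tmul, TensorProduct.map_tmul, gr_mul _ _ _ _ (hf b₂) (hg c₁), hu, h,
        Algebra.TensorProduct.tmul_mul_tmul]

theorem comul_mul (a b : GroupAlg k p m n) :
    gr (comul k p m n (a * b)) = gr (comul k p m n a) * gr (comul k p m n b) := by
  have key : ∀ a b : EvenAlg k p m n, 
      Coalgebra.comul (R := k) (a * b) = Coalgebra.comul a * Coalgebra.comul b :=
    Bialgebra.comul_mul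
  have h00 : ∀ x y, gr (comul k p m n (ev k p m n x * ev k p m n y)) =
      gr (comul k p m n (ev k p m n x)) * gr (comul k p m n (ev k p m n y)) := by
    intro x y
    rw [ev_mul_ev, comul_ev, comul_ev, comul_ev, key,
      gr_bilin (e₁ := ev k p m n) (e₂ := ev k p m n) ev_mem ev_mem 1 1 (by simp)
        (by intros; simp [ev_mul_ev]), one_mul, one_smul]
  have h01 : ∀ x y, gr (comul k p m n (ev k p m n x * od k p m n y)) =
      gr (comul k p m n (ev k p m n x)) * gr (comul k p m n (od k p m n y)) := by
    intro x y
    rw [ev_mul_od, comul_ev, comul_od, comul_od, key, map_add, map_add, mul_add,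
      gr_bilin (e₁ := od k p m n) (e₂ := ev k p m n) ev_mem od_mem 1 1 (by simp)
        (by intros; simp [ev_mul_ev, ev_mul_od]), one_mul, one_smul,
      gr_bilin (e₁ := ev k p m n) (e₂ := od k p m n) ev_mem ev_mem 1 1 (by simp)
        (by intros; simp [ev_mul_ev, ev_mul_od]), one_mul, one_smul]
  have h10 : ∀ x y, gr (comul k p m n (od k p m n x * ev k p m n y)) =
      gr (comul k p m n (od k p m n x)) * gr (comul k p m n (ev k p m n y)) := by
    intro x y
    rw [od_mul_ev, comul_ev, comul_od, comul_od, key, map_add, map_add, add_mul,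
      gr_bilin (e₁ := od k p m n) (e₂ := ev k p m n) ev_mem ev_mem 1 1 (by simp)
        (by intros; simp [ev_mul_ev, od_mul_ev]), one_mul, one_smul,
      gr_bilin (e₁ := ev k p m n) (e₂ := od k p m n) od_mem ev_mem 1 1 (by simp)
        (by intros; simp [ev_mul_ev, od_mul_ev]), one_mul, one_smul]
  have h11 : ∀ x y, gr (comul k p m n (od k p m n x * od k p m n y)) =
      gr (comul k p m n (od k p m n x)) * gr (comul k p m n (od k p m n y)) := by
    intro x y
    rw [od_mul_od, comul_ev, comul_od, comul_od, key, key, EvenAlg.comul_top_pow]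
    simp only [map_add, add_mul, mul_add]
    rw [gr_bilin (e₁ := ev k p m n) (e₂ := ev k p m n) ev_mem od_mem
        ((EvenAlg.s k p m n (top n) ^ p) ⊗ₜ 1) 1 (by simp)
        (by intros; simp [ev_mul_ev, od_mul_od]),
      gr_bilin (e₁ := od k p m n) (e₂ := od k p m n) ev_mem ev_mem 1 1 (by simp)
        (by intros; simp [ev_mul_od, od_mul_ev]),
      gr_bilin (e₁ := od k p m n) (e₂ := od k p m n) od_mem od_mem 1 (-1) (by simp)
        (by intros; simp [ev_mul_od, od_mul_ev]),
      gr_bilin (e₁ := ev k p m n) (e₂ := ev k p m n) od_mem ev_mem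
        (1 ⊗ₜ (EvenAlg.s k p m n (top n) ^ p)) 1 (by simp)
        (by intros; simp [ev_mul_ev, od_mul_od])]
    simp only [one_smul, Units.neg_smul, one_mul]
    abel
  rw [eq_add a, eq_add b]
  simp only [add_mul, mul_add, map_add, h00, h01, h10, h11]

theorem comm_gr {t t' : ZMod 2} {f g : EvenAlg k p m n →ₗ[k] GroupAlg k p m n}
    (hf : ∀ b, f b ∈ par k p m n t) (hg : ∀ b, g b ∈ par k p m n t') (h : t' * t = 0)
    (x : EvenAlg k p m n ⊗[k] EvenAlg k p m n) :
    GradedTensorProduct.comm (par k p m n) (par k p m n) (gr (TensorProduct.map f g x)) =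
      gr (TensorProduct.map g f (TensorProduct.comm k _ _ x)) := by
  induction x with
  | zero => simp
  | add x y hx hy => simp only [map_add, hx, hy]
  | tmul b c =>
    have := GradedTensorProduct.comm_coe_tmul_coe (R := k) (par k p m n) (par k p m n)
      ⟨f b, hf b⟩ ⟨g c, hg c⟩
    rw [h, uzpow_zero, one_smul] at this
    exact this

theorem map_mem {t t' : ZMod 2} {f g : EvenAlg k p m n →ₗ[k] GroupAlg k p m n}
    (hf : ∀ b, f b ∈ par k p m n t) (hg : ∀ b, g b ∈ par k p m n t')
    (x : EvenAlg k p m n ⊗[k] EvenAlg k p m n) :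
    TensorProduct.map f g x ∈ LinearMap.range
      (TensorProduct.map (par k p m n t).subtype (par k p m n t').subtype) := by
  refine ⟨TensorProduct.map (f.codRestrict _ hf) (g.codRestrict _ hg) x, ?_⟩
  rw [← LinearMap.comp_apply, ← TensorProduct.map_comp]
  rfl

theorem mul'_map {f g e : EvenAlg k p m n →ₗ[k] GroupAlg k p m n}
    {S T : EvenAlg k p m n →ₗ[k] EvenAlg k p m n} (h : ∀ b c, f b * g c = e (S b * T c))
    (x : EvenAlg k p m n ⊗[k] EvenAlg k p m n) :
    LinearMap.mul' k (GroupAlg k p m n) (TensorProduct.map f g x) =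
      e (LinearMap.mul' k (EvenAlg k p m n) (TensorProduct.map S T x)) := by
  induction x with
  | zero => simp
  | add x y hx hy => simp only [map_add, hx, hy]
  | tmul b c => simp [h]

/-- The Hopf superalgebra `kE^-_{m,n}`. -/
instance : SupergroupAlgebra k (GroupAlg k p m n) where
  par := par k p m n
  finite := by
    have h : Function.Surjective (LinearMap.coprod (ev k p m n) (od k p m n)) := fun a =>
      ⟨(re k p m n a, im k p m n a), (eq_add a).symm⟩
    exact Module.Finite.of_surjective _ h
  counit_one := Bialgebra.counit_one (R := k) (A := EvenAlg k p m n)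
  counit_mul a b := by
    change Coalgebra.counit (R := k) (re k p m n (a * b)) = _
    have h0 : Coalgebra.counit (R := k) (EvenAlg.s k p m n (top n)) = 0 :=
      EvenAlg.counit_s k p m n (top n)
    rw [re_mul, map_add, Bialgebra.counit_mul, Bialgebra.counit_mul, Bialgebra.counit_mul,
      Bialgebra.counit_pow, h0, zero_pow (Fact.out : p.Prime).ne_zero, zero_mul, zero_mul, add_zero]
    rfl
  counit_odd a ha := by
    change Coalgebra.counit (R := k) (re k p m n a) = 0
    rw [mem_par_one.mp ha, map_zero]
  comul_one := by
    change gr (comul k p m n (ev k p m n 1)) = 1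
    rw [comul_ev, Bialgebra.comul_one, Algebra.TensorProduct.one_def, TensorProduct.map_tmul]
    rfl
  comul_mul := comul_mul
  comul_mem t a ha := by
    refine mem_par_cases (P := fun t a => comul k p m n a ∈
      ⨆ i : ZMod 2, LinearMap.range (TensorProduct.map (par k p m n i).subtype
        (par k p m n (t - i)).subtype)) ?_ ?_ t a ha
    · intro b
      rw [comul_ev]
      exact Submodule.mem_iSup_of_mem 0 (map_mem ev_mem ev_mem _)
    · intro b
      rw [comul_od]
      exact add_mem (Submodule.mem_iSup_of_mem 1 (map_mem od_mem ev_mem _))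
        (Submodule.mem_iSup_of_mem 0 (map_mem ev_mem od_mem _))
  comul_comm a := by
    change GradedTensorProduct.comm (par k p m n) (par k p m n) (gr (comul k p m n a)) =
      gr (comul k p m n a)
    rw [eq_add a, map_add, comul_ev, comul_od]
    simp only [map_add]
    rw [comm_gr ev_mem ev_mem (by simp), comm_gr od_mem ev_mem (by simp),
      comm_gr ev_mem od_mem (by simp), EvenAlg.comul_comm, EvenAlg.comul_comm]
    abel
  antipode := antipode k p m n
  antipode_mem t a ha := by
    refine mem_par_cases (P := fun t a => antipode k p m n a ∈ par k p m n t) ?_ ?_ t a ha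
    · intro b
      simp [antipode, ev_mem]
    · intro b
      simp [antipode, od_mem]
  antipode_left a := by
    change LinearMap.mul' k _ (TensorProduct.map (antipode k p m n) LinearMap.id
      (comul k p m n a)) = algebraMap k _ (Coalgebra.counit (R := k) (re k p m n a))
    have h0 : antipode k p m n ∘ₗ ev k p m n = ev k p m n ∘ₗ HopfAlgebra.antipode k := by
      refine LinearMap.ext fun b => ?_
      simp [antipode]
    have h1 : antipode k p m n ∘ₗ od k p m n = -(od k p m n ∘ₗ HopfAlgebra.antipode k) := by
      refine LinearMap.ext fun b => ?_
      simp [antipode]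
    rw [eq_add a, map_add, comul_ev, comul_od]
    simp only [map_add, ← LinearMap.comp_apply (TensorProduct.map (antipode k p m n) LinearMap.id),
      ← TensorProduct.map_comp, h0, h1, LinearMap.id_comp, re_ev, re_od, add_zero]
    rw [mul'_map (e := ev k p m n) (S := HopfAlgebra.antipode k) (T := LinearMap.id)
        (by intros; simp [ev_mul_ev]),
      mul'_map (e := -od k p m n) (S := HopfAlgebra.antipode k) (T := LinearMap.id)
        (by intros; simp [od_mul_ev]),
      mul'_map (e := od k p m n) (S := HopfAlgebra.antipode k) (T := LinearMap.id)
        (by intros; simp [ev_mul_od])]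
    have h := HopfAlgebra.mul_antipode_rTensor_comul_apply (R := k) (re k p m n a)
    rw [LinearMap.rTensor] at h
    rw [h, algebraMap_eq]
    simp
  antipode_right a := by
    change LinearMap.mul' k _ (TensorProduct.map LinearMap.id (antipode k p m n)
      (comul k p m n a)) = algebraMap k _ (Coalgebra.counit (R := k) (re k p m n a))
    have h0 : antipode k p m n ∘ₗ ev k p m n = ev k p m n ∘ₗ HopfAlgebra.antipode k := by
      refine LinearMap.ext fun b => ?_
      simp [antipode]
    have h1 : antipode k p m n ∘ₗ od k p m n = -(od k p m n ∘ₗ HopfAlgebra.antipode k) := by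
      refine LinearMap.ext fun b => ?_
      simp [antipode]
    rw [eq_add a, map_add, comul_ev, comul_od]
    simp only [map_add, ← LinearMap.comp_apply (TensorProduct.map LinearMap.id (antipode k p m n)),
      ← TensorProduct.map_comp, h0, h1, LinearMap.id_comp, re_ev, re_od, add_zero]
    rw [mul'_map (e := ev k p m n) (S := LinearMap.id) (T := HopfAlgebra.antipode k)
        (by intros; simp [ev_mul_ev]),
      mul'_map (e := od k p m n) (S := LinearMap.id) (T := HopfAlgebra.antipode k)
        (by intros; simp [od_mul_ev]),
      mul'_map (e := -od k p m n) (S := LinearMap.id) (T := HopfAlgebra.antipode k)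
        (by intros; simp [ev_mul_od])]
    have h := HopfAlgebra.mul_antipode_lTensor_comul_apply (R := k) (re k p m n a)
    rw [LinearMap.lTensor] at h
    rw [h, algebraMap_eq]
    simp

end GroupAlg

section Projection

variable [Fact p.Prime]

/-- The projection `s_i ↦ s_i` between the even parts. -/
def EvenAlg.proj : EvenAlg k p (m + 1) n →ₐ[k] EvenAlg k p m n :=
  EvenAlg.lift k p (m + 1) n (EvenAlg.s k p m n) fun i => by
    have h := EvenAlg.s_pow k p m n i
    unfold trunc at h ⊢
    split_ifs with hi
    · rw [if_pos hi] at h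
      rw [PNat.add_coe, pow_add, pow_mul, h, zero_pow]
      simp [(Fact.out : p.Prime).ne_zero]
    · rwa [if_neg hi] at h

theorem EvenAlg.proj_s (i : Fin n) :
    EvenAlg.proj k p m n (EvenAlg.s k p (m + 1) n i) = EvenAlg.s k p m n i := by
  simp [EvenAlg.proj]

theorem EvenAlg.comul_proj [CharP k p] (b : EvenAlg k p (m + 1) n) :
    Coalgebra.comul (R := k) (EvenAlg.proj k p m n b) =
      TensorProduct.map (EvenAlg.proj k p m n).toLinearMap (EvenAlg.proj k p m n).toLinearMap
        (Coalgebra.comul (R := k) b) := by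
  have h : (EvenAlg.comul k p m n).comp (EvenAlg.proj k p m n) =
      (Algebra.TensorProduct.map (EvenAlg.proj k p m n) (EvenAlg.proj k p m n)).comp
        (EvenAlg.comul k p (m + 1) n) := by
    refine EvenAlg.hom_ext fun i => ?_
    refine Eq.trans ?_ (EvenAlg.map_comul_s k p (m + 1) n
      (Algebra.TensorProduct.map (EvenAlg.proj k p m n) (EvenAlg.proj k p m n)) i).symm
    simp [EvenAlg.proj_s, EvenAlg.comul_s]
  exact DFunLike.congr_fun h b

/-- The projection `kE^-_{m+1,n} → kE^-_{m,n}` of algebras, `s_i ↦ s_i` and `σ ↦ σ`. -/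
def projAlg : GroupAlg k p (m + 1) n →ₐ[k] GroupAlg k p m n :=
  AlgHom.ofLinearMap
    (GroupAlg.ev k p m n ∘ₗ (EvenAlg.proj k p m n).toLinearMap ∘ₗ GroupAlg.re k p (m + 1) n +
      GroupAlg.od k p m n ∘ₗ (EvenAlg.proj k p m n).toLinearMap ∘ₗ GroupAlg.im k p (m + 1) n)
    (by
      refine GroupAlg.ext ?_ ?_
      · change EvenAlg.proj k p m n 1 + 0 = 1
        simp
      · change 0 + EvenAlg.proj k p m n 0 = 0
        simp)
    (fun a b => by
      refine GroupAlg.ext ?_ ?_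
      · simp [GroupAlg.re_mul, EvenAlg.proj_s]
      · simp [GroupAlg.im_mul])

theorem projAlg_s (i : Fin n) :
    projAlg k p m n (GroupAlg.s k p (m + 1) n i) = GroupAlg.s k p m n i := by
  refine GroupAlg.ext ?_ ?_ <;> simp [projAlg, GroupAlg.s, EvenAlg.proj_s]

theorem projAlg_σ : projAlg k p m n (GroupAlg.σ k p (m + 1) n) = GroupAlg.σ k p m n := by
  refine GroupAlg.ext ?_ ?_ <;> simp [projAlg, GroupAlg.σ]

theorem projAlg_surjective : Function.Surjective (projAlg k p m n) := by
  have h : Function.Surjective (EvenAlg.proj k p m n) := by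
    intro b
    obtain ⟨f, rfl⟩ := Ideal.Quotient.mk_surjective b
    refine ⟨Ideal.Quotient.mk _ f, ?_⟩
    have : (EvenAlg.proj k p m n).comp (Ideal.Quotient.mkₐ k _) = (Ideal.Quotient.mkₐ k _ :
        MvPolynomial (Fin n) k →ₐ[k] EvenAlg k p m n) :=
      MvPolynomial.algHom_ext fun i => EvenAlg.proj_s k p m n i
    exact DFunLike.congr_fun this f
  intro a
  obtain ⟨b, hb⟩ := h (GroupAlg.re k p m n a)
  obtain ⟨c, hc⟩ := h (GroupAlg.im k p m n a)
  refine ⟨GroupAlg.ev k p (m + 1) n b + GroupAlg.od k p (m + 1) n c, ?_⟩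
  refine GroupAlg.ext ?_ ?_ <;> simp [projAlg, hb, hc]

variable [CharP k p]

/-- The surjective homomorphism `E^-_{m+1,n} → E^-_{m,n}` of finite supergroup schemes, given on
group algebras by `s_i ↦ s_i` and `σ ↦ σ`. -/
def proj : Hom k (GroupAlg k p (m + 1) n) (GroupAlg k p m n) where
  toAlgHom := projAlg k p m n
  map_par t a ha := by
    refine GroupAlg.mem_par_cases
      (P := fun t a => projAlg k p m n a ∈ GroupAlg.par k p m n t) ?_ ?_ t a ha
    · intro b
      exact GroupAlg.mem_par_zero.mpr (by simp [projAlg])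
    · intro b
      exact GroupAlg.mem_par_one.mpr (by simp [projAlg])
  map_counit a := by
    have h : (EvenAlg.counit k p m n).comp (EvenAlg.proj k p m n) =
        EvenAlg.counit k p (m + 1) n :=
      EvenAlg.hom_ext fun i => by simp [EvenAlg.proj_s]
    have h' := DFunLike.congr_fun h (GroupAlg.re k p (m + 1) n a)
    have hr : GroupAlg.re k p m n (projAlg k p m n a) =
        EvenAlg.proj k p m n (GroupAlg.re k p (m + 1) n a) := by simp [projAlg]
    change EvenAlg.counit k p m n (GroupAlg.re k p m n (projAlg k p m n a)) =
      EvenAlg.counit k p (m + 1) n (GroupAlg.re k p (m + 1) n a)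
    rw [hr]
    exact h'
  map_comul a := by
    change GroupAlg.comul k p m n (projAlg k p m n a) =
      TensorProduct.map (projAlg k p m n).toLinearMap (projAlg k p m n).toLinearMap
        (GroupAlg.comul k p (m + 1) n a)
    have h0 : (projAlg k p m n).toLinearMap ∘ₗ GroupAlg.ev k p (m + 1) n =
        GroupAlg.ev k p m n ∘ₗ (EvenAlg.proj k p m n).toLinearMap := by
      refine LinearMap.ext fun b => ?_
      simp [projAlg]
    have h1 : (projAlg k p m n).toLinearMap ∘ₗ GroupAlg.od k p (m + 1) n =
        GroupAlg.od k p m n ∘ₗ (EvenAlg.proj k p m n).toLinearMap := by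
      refine LinearMap.ext fun b => ?_
      simp [projAlg]
    have h0' : ∀ b, projAlg k p m n (GroupAlg.ev k p (m + 1) n b) =
        GroupAlg.ev k p m n (EvenAlg.proj k p m n b) := DFunLike.congr_fun h0
    have h1' : ∀ b, projAlg k p m n (GroupAlg.od k p (m + 1) n b) =
        GroupAlg.od k p m n (EvenAlg.proj k p m n b) := DFunLike.congr_fun h1
    rw [GroupAlg.eq_add a]
    simp only [map_add, h0', h1', GroupAlg.comul_ev, GroupAlg.comul_od]
    simp only [← LinearMap.comp_apply (TensorProduct.map (projAlg k p m n).toLinearMap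
      (projAlg k p m n).toLinearMap), ← TensorProduct.map_comp, h0, h1]
    simp only [TensorProduct.map_comp, LinearMap.comp_apply, EvenAlg.comul_proj]

end Projection

/-! ### The standard generators for `m = 1` -/

section Standard

variable [Fact p.Prime] [CharP k p]

/-- The monomials `s_1^{α_1} ⋯ s_n^{α_n} σ^e`. Those with `α_i < p` and `e < 2` form a basis of
`kE^-_{1,n}`, where `E^-_{1,n} = 𝔾_{a(n)} × 𝔾_a^-`. -/
def mono (α : Fin n → ℕ) (e : ℕ) : GroupAlg k p 1 n :=
  (∏ i, GroupAlg.s k p 1 n i ^ α i) * GroupAlg.σ k p 1 n ^ e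

variable {k n}

/-- The class `λ_i` of `H^{1,0}(𝔾_{a(n)} × 𝔾_a^-, k)`: it is represented by the 1-cocycle which has
the value `1` on `s_i` and `0` on all other basis monomials. -/
def IsStdLam (i : Fin n) (h : Cohomology k (GroupAlg k p 1 n)) : Prop :=
  ∃ f : Cochain k (GroupAlg k p 1 n) 1,
    (∀ (α : Fin n → Fin p) (e : Fin 2), f ![mono k p n (fun j => α j) e] =
      if (fun j => (α j : ℕ)) = Pi.single i 1 ∧ e = 0 then 1 else 0) ∧
    Represents (aug k (GroupAlg k p 1 n)) f.toCochains h

/-- The class `ζ` of `H^{1,1}(𝔾_{a(n)} × 𝔾_a^-, k)`: it is represented by the 1-cocycle which has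
the value `1` on `σ` and `0` on all other basis monomials. -/
def IsStdZeta (h : Cohomology k (GroupAlg k p 1 n)) : Prop :=
  ∃ f : Cochain k (GroupAlg k p 1 n) 1,
    (∀ (α : Fin n → Fin p) (e : Fin 2), f ![mono k p n (fun j => α j) e] =
      if (∀ j, (α j : ℕ) = 0) ∧ e = 1 then 1 else 0) ∧
    Represents (aug k (GroupAlg k p 1 n)) f.toCochains h

open Classical in
/-- The class `x_i` of `H^{2,0}(𝔾_{a(n)} × 𝔾_a^-, k)`: it is represented by the 2-cocycle which has
the value `-1` on the pairs `(s_i^a, s_i^b)` with `a + b = p` and `a, b < p`, and `0` on all other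
pairs of basis monomials. -/
def IsStdX (i : Fin n) (h : Cohomology k (GroupAlg k p 1 n)) : Prop :=
  ∃ f : Cochain k (GroupAlg k p 1 n) 2,
    (∀ (α β : Fin n → Fin p) (e e' : Fin 2),
      f ![mono k p n (fun j => α j) e, mono k p n (fun j => β j) e'] =
        if (∃ a b : ℕ, a + b = p ∧ (fun j => (α j : ℕ)) = Pi.single i a ∧
          (fun j => (β j : ℕ)) = Pi.single i b) ∧ e = 0 ∧ e' = 0 then -1 else 0) ∧
    Represents (aug k (GroupAlg k p 1 n)) f.toCochains h

end Standard

/-! ### The algebra `k[x_1, …, x_n, ζ] ⊗ Λ(λ_1, …, λ_n)` -/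

section Target

variable (k : Type u) [Field k] (n : ℕ+)

/-- The grading of `k[x_1, …, x_n, ζ]` by cohomological degree: `x_i` has degree `2` and `ζ` has
degree `1`. -/
def polyGrading : ℕ → Submodule k (MvPolynomial (Fin n ⊕ Unit) k) :=
  MvPolynomial.weightedHomogeneousSubmodule k (Sum.elim (fun _ => 2) (fun _ => 1))

instance : GradedAlgebra (polyGrading k n) := MvPolynomial.weightedGradedAlgebra k _

/-- The grading of the exterior algebra `Λ(λ_1, …, λ_n)` by cohomological degree. -/
abbrev extGrading : ℕ → Submodule k (ExteriorAlgebra k (Fin n → k)) :=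
  fun i => ⋀[k]^i (Fin n → k)

/-- The bigraded algebra `k[x_1, …, x_n, ζ] ⊗ Λ(λ_1, …, λ_n)`. The tensor product is the graded one:
elements of cohomological degrees `i` and `j` in the two factors commute up to the sign `(-1)^{ij}`.
The internal degrees contribute no sign here, since they vanish on the second factor. -/
abbrev PolyExt : Type _ := GradedTensorProduct k (polyGrading k n) (extGrading k n)

namespace PolyExt

variable {n}

/-- The polynomial generators `x_i`. -/
def x (i : Fin n) : PolyExt k n := GradedTensorProduct.tmul k (MvPolynomial.X (Sum.inl i)) 1

variable (n) in
/-- The polynomial generator `ζ`. -/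
def ζ : PolyExt k n := GradedTensorProduct.tmul k (MvPolynomial.X (Sum.inr ())) 1

/-- The exterior generators `λ_i`. -/
def lam (i : Fin n) : PolyExt k n :=
  GradedTensorProduct.tmul k 1 (ExteriorAlgebra.ι k (Pi.single i 1))

end PolyExt

end Target

end WittElementary

end SupergroupAlgebra

end

open SupergroupAlgebra SupergroupAlgebra.WittElementary

/-! Write `A` for the group algebra, `ε` for its augmentation and `R` for its ring of bar cochains.
For an ideal `I` of `A`, the linear maps `A → R` that vanish on `I`, with the differential `twD`,
form the bar complex that computes Ext_A(A/I, k). For I = 0 its cohomology is `k` in degree 0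
(`exists_twD_eq`, `isModel_bot`); for I = ker ε it is `R` itself (`twD_cst`). The computation climbs
the chain 0 ⊂ (s_n) ⊂ (s_{n-1}, s_n) ⊂ ⋯ ⊂ (s_1, …, s_n) ⊂ (s_1, …, s_n, σ) = ker ε.

One step passes from I to J = I + (t), where t^d ∈ I and, in A/I, multiplication by t and by t^{d-1}
have each other's images as kernels. The periodic sequence 0 → A/J → A/I → A/I → A/J → 0, with maps
t^{d-1}, t and the projection, suggests that Ext(A/J, k) has the basis x^a l^e M_γ with e ∈ {0, 1},
where the M_γ form a basis for A/I, l has degree 1 and x has degree 2. `StepData.span_step` and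
`StepData.indep_step` prove this by a chase with explicit cochains: a cocycle is integrated,
multiplied by t, integrated again, multiplied by t^{d-1}, and recursion takes over two degrees
lower. The basis consists of actual products of cocycles, so additive and multiplicative information
arrive together. For t = σ one takes l = ζ and x = ζ², and the products (ζ²)^a ζ^e run through all
powers of ζ (`isModel_basisCocycle`).

The exterior generators are derivations over ε dual to the s_i. The polynomial generators are x_i =
c ζ² - ε ∘ χ_i, where χ_i is the Hochschild 2-cocycle that records how products overflow the
relation s_i^{d_i} = 0. A Hochschild cocycle gives a homotopy between left and right multiplication
by ε ∘ χ_i, so this class is central (`d_bilinInner`, `chiCls_comm`). Derivations anticommute up to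
the coefficient of ηθ of a homomorphism to k[η, θ]/(η², θ²), which exists because p ≥ 3
(`exists_der_anticomm`). These relations define a map from the model algebra, and it carries
spanning monomials to a basis (`GenRel.exists_algEquiv`).

For inflation from level m to level m + 1, the derivations and the χ_i with i < n pull back to
themselves. The pullback of ε ∘ χ_n is the coboundary of minus the coefficient of s_n^{p^m}, a
monomial that no longer vanishes (`chiAug_projAlg_top`). At m = 1 the formal exponent of σ² is that
of s_n^p, so ε ∘ χ_n has the value 1 on (σ, σ), and the standard x_n is ζ² - ε ∘ χ_n. Hence x_n
inflates to ζ² from m = 1, and to 0 from m ≥ 2, where c = 0 is chosen. The kernel in degree (2, 0)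
is spanned by ζ² - x_n, the class of ε ∘ χ_n, because the other basis monomials of degree at most 2
go to basis monomials (`ker_inflation`). -/

noncomputable section

namespace SupergroupAlgebra

/-! ### Generation of the cochain ring by linear forms. -/

section Generation

variable {k : Type u} {A : Type v} [Field k] [CommRing A] [Algebra k A]

/-- A linear form as an element of the ring of cochains. -/
def form : (A →ₗ[k] k) →ₗ[k] Cochains k A where
  toFun f := (Cochain.ofMultilinear (MultilinearMap.ofSubsingleton k A k (0 : Fin 1) f)).toCochains
  map_add' f g := by
    rw [← map_add]
    rfl
  map_smul' c f := by
    rw [RingHom.id_apply, ← map_smul]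
    rfl

theorem form_eq (f : A →ₗ[k] k) : form f =
    (Cochain.ofMultilinear (MultilinearMap.ofSubsingleton k A k (0 : Fin 1) f)).toCochains := rfl

theorem augCochain_eq_form (ε : A →ₐ[k] k) : (augCochain ε).toCochains = form ε.toLinearMap := rfl

/-- A bilinear form as a 2-cochain. -/
def bilinCochain (B : A →ₗ[k] A →ₗ[k] k) : Cochain k A 2 :=
  .ofMultilinear (LinearMap.uncurryLeft
    ((MultilinearMap.ofSubsingletonₗ k k A k (0 : Fin 1)).toLinearMap ∘ₗ B))

theorem bilinCochain_apply (B : A →ₗ[k] A →ₗ[k] k) (a : Fin 2 → A) :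
    bilinCochain B a = B (a 0) (a 1) := rfl

/-- A bilinear form as an element of the ring of cochains. -/
def biform : (A →ₗ[k] A →ₗ[k] k) →ₗ[k] Cochains k A where
  toFun B := (bilinCochain B).toCochains
  map_add' B B' := by
    rw [← map_add]
    rfl
  map_smul' c B := by
    rw [RingHom.id_apply, ← map_smul]
    rfl

theorem biform_eq (B : A →ₗ[k] A →ₗ[k] k) : biform B = (bilinCochain B).toCochains := rfl

theorem form_mul_form (f g : A →ₗ[k] k) :
    form f * form g = biform (LinearMap.lsmul k k ∘ₗ f |>.compl₂ g) := by
  rw [form_eq, form_eq, toCochains_mul, biform_eq]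
  congr 1

/-- Insertion of an element as the first argument of a cochain. -/
def insert : Cochains k A →ₗ[k] A →ₗ[k] Cochains k A :=
  DirectSum.toModule k ℕ _ fun q => match q with
    | 0 => 0
    | q + 1 => LinearMap.compRight k
        (DirectSum.lof k ℕ (fun q => Cochain k A q) q) ∘ₗ
        (multilinearCurryLeftEquiv k (fun _ : Fin (q + 1) => A) k).toLinearMap

theorem insert_zero (f : Cochain k A 0) (a : A) : insert f.toCochains a = 0 := by
  simp [insert, Cochain.toCochains]

/-- A cochain with a fixed first argument. -/
def fixFirst {q : ℕ} (f : Cochain k A (q + 1)) (a : A) : Cochain k A q :=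
  .ofMultilinear (f.toMultilinear.curryLeft a)

theorem fixFirst_apply {q : ℕ} (f : Cochain k A (q + 1)) (a : A) (v : Fin q → A) :
    fixFirst f a v = f (Fin.cons a v) := rfl

theorem insert_succ {q : ℕ} (f : Cochain k A (q + 1)) (a : A) :
    insert f.toCochains a = (fixFirst f a).toCochains := by
  simp only [insert, Cochain.toCochains, DirectSum.toModule_lof]
  rfl

theorem insert_form_mul (f : A →ₗ[k] k) (w : Cochains k A) (a : A) :
    insert (form f * w) a = f a • w := by
  induction w using cochains_induction with
  | h0 => simp
  | h2 x y hx hy => simp only [mul_add, map_add, LinearMap.add_apply, hx, hy, smul_add]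
  | h1 q g =>
    let F : Cochain k A (q + 1) := .ofMultilinear (LinearMap.uncurryLeft
      (LinearMap.toSpanSingleton k _ g.toMultilinear ∘ₗ f))
    have hF : ∀ v, F v = f (v 0) * g (Fin.tail v) := fun v => rfl
    have h : form f * g.toCochains = F.toCochains := by
      rw [form_eq, toCochains_mul]
      refine toCochains_congr (Nat.add_comm q 1) _ _ fun v => ?_
      rw [cup_apply, hF]
      congr 1
      congr 1
      funext i
      simp only [Fin.tail]
      congr 1
      ext
      simp [Nat.add_comm]
    rw [h, insert_succ, ← map_smul]
    congr 1

/-- Evaluation of cochains. -/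
def evalCochain {q : ℕ} (v : Fin q → A) : Cochain k A q →ₗ[k] k where
  toFun f := f v
  map_add' _ _ := rfl
  map_smul' _ _ := rfl

variable [Module.Finite k A]

variable (k A) in
/-- A basis of `A`. -/
abbrev stdBasis : Module.Basis (Fin (Module.finrank k A)) k A := Module.finBasis k A

/-- The linear map `A → R` with values `g` corresponds to the cochain
`(a_0, …, a_q) ↦ g(a_0)(a_1, …, a_q)`. -/
def prep : (A →ₗ[k] Cochains k A) →ₗ[k] Cochains k A where
  toFun g := ∑ i, form ((stdBasis k A).coord i) * g (stdBasis k A i)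
  map_add' f g := by simp [mul_add, Finset.sum_add_distrib]
  map_smul' c f := by simp [Finset.smul_sum]

theorem prep_apply (g : A →ₗ[k] Cochains k A) :
    prep g = ∑ i, form ((stdBasis k A).coord i) * g (stdBasis k A i) := rfl

theorem sum_coord_smul (g : A →ₗ[k] k) :
    ∑ i, g (stdBasis k A i) • (stdBasis k A).coord i = g := by
  ext a
  conv_rhs => rw [← (stdBasis k A).sum_repr a]
  simp

theorem insert_prep (g : A →ₗ[k] Cochains k A) : insert (prep g) = g := by
  ext1 a
  rw [prep_apply, map_sum, LinearMap.sum_apply]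
  simp only [insert_form_mul]
  conv_rhs => rw [← (stdBasis k A).sum_repr a, map_sum]
  simp

theorem prep_injective : Function.Injective (prep : (A →ₗ[k] Cochains k A) →ₗ[k] _) :=
  Function.LeftInverse.injective insert_prep

/-- This is the decomposition R = k ⊕ Hom(A, R): a cochain of positive degree is recovered from its
values with the first argument fixed. It makes induction over products of linear forms possible and
supplies the contracting homotopy of the bar resolution. -/
theorem exists_eq_algebraMap_add_prep (u : Cochains k A) :
    ∃ c : k, u = algebraMap k (Cochains k A) c + prep (insert u) := by
  induction u using cochains_induction with
  | h0 => exact ⟨0, by simp⟩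
  | h2 x y hx hy =>
    obtain ⟨c, hc⟩ := hx
    obtain ⟨c', hc'⟩ := hy
    refine ⟨c + c', ?_⟩
    rw [map_add, map_add, map_add]
    nth_rw 1 [hc, hc']
    abel
  | h1 q f =>
    rcases q with _ | q
    · refine ⟨f ![], ?_⟩
      have : insert f.toCochains = 0 := LinearMap.ext fun a => insert_zero f a
      rw [this, LinearMap.map_zero, add_zero]
      change f.toCochains = (constCochain (f ![])).toCochains
      congr 1
      ext a
      rw [constCochain_apply]
      congr 1
      exact Subsingleton.elim _ _
    · refine ⟨0, ?_⟩
      rw [map_zero, zero_add, prep_apply]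
      let F : Fin (Module.finrank k A) → Cochain k A (q + 1) := fun i =>
        .ofMultilinear (LinearMap.uncurryLeft (LinearMap.toSpanSingleton k _
          (f.toMultilinear.curryLeft (stdBasis k A i)) ∘ₗ (stdBasis k A).coord i))
      have hF : ∀ i v, F i v = (stdBasis k A).coord i (v 0) *
        f (Fin.cons (stdBasis k A i) (Fin.tail v)) := fun i v => rfl
      have h : ∀ i, form ((stdBasis k A).coord i) * insert f.toCochains (stdBasis k A i) =
          (F i).toCochains := by
        intro i
        rw [insert_succ, form_eq, toCochains_mul]
        refine toCochains_congr (Nat.add_comm q 1) _ _ fun v => ?_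
        rw [cup_apply, hF, fixFirst_apply]
        refine congr_arg₂ _ rfl (congr_arg (fun w => f (Fin.cons (stdBasis k A i) w)) ?_)
        funext i
        simp only [Fin.tail]
        congr 1
        ext
        simp [Nat.add_comm]
      simp only [h]
      rw [← map_sum]
      congr 1
      ext v
      have hs := map_sum (evalCochain v) F Finset.univ
      refine Eq.trans ?_ hs.symm
      change _ = ∑ i, F i v
      simp only [hF]
      -- The remaining identity is linear in the first argument, so it is the expansion of this
      -- linear form in the dual basis.
      let T : A →ₗ[k] k := (evalCochain (Fin.tail v)) ∘ₗ f.toMultilinear.curryLeft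
      have hT : ∀ a, T a = f (Fin.cons a (Fin.tail v)) := fun a => rfl
      have h2 := DFunLike.congr_fun (sum_coord_smul T) (v 0)
      rw [hT, Fin.cons_self_tail] at h2
      rw [← h2]
      simp [hT, mul_comm]

/-- Every cochain is a combination of products of 1-cochains. -/
theorem form_induction {P : Cochains k A → Prop} (z : Cochains k A)
    (h0 : ∀ c, P (algebraMap k _ c)) (h1 : ∀ f w, P w → P (form f * w))
    (h2 : ∀ x y, P x → P y → P (x + y)) : P z := by
  have h00 : P 0 := by simpa using h0 0
  have key : ∀ (q : ℕ) (f : Cochain k A q), P f.toCochains := by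
    intro q
    induction q with
    | zero =>
      intro f
      obtain ⟨c, hc⟩ := exists_eq_algebraMap_add_prep f.toCochains
      have : insert f.toCochains = 0 := LinearMap.ext fun a => insert_zero f a
      rw [hc, this, map_zero, add_zero]
      exact h0 c
    | succ q ih =>
      intro f
      obtain ⟨c, hc⟩ := exists_eq_algebraMap_add_prep f.toCochains
      rw [hc, prep_apply]
      refine h2 _ _ (h0 _) ?_
      refine Finset.sum_induction _ P h2 h00 fun i _ => ?_
      rw [insert_succ]
      exact h1 _ _ (ih _)
  exact cochains_induction z h00 key h2

end Generation

end SupergroupAlgebra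

end

noncomputable section

namespace SupergroupAlgebra

/-! ### Inner faces for a bilinear operation; Hochschild 2-cocycles. -/

section BilinearFaces

variable {k : Type u} {A : Type v} [Field k] [CommRing A] [Algebra k A]

/-- Merging two neighbouring arguments by a bilinear operation is linear in each argument. -/
theorem contractNth_bilin_update (β : A →ₗ[k] A →ₗ[k] A) {q : ℕ} (j : Fin q) [DecidableEq (Fin (q + 1))] (a : Fin (q + 1) → A)
    (i : Fin (q + 1)) : ∃ (i' : Fin q) (T : A →ₗ[k] A),
      ∀ x, Fin.contractNth j.castSucc (fun x y => β x y) (Function.update a i x) =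
        Function.update (Fin.contractNth j.castSucc (fun x y => β x y) a) i' (T x) := by
  have key : ∀ (i' : Fin q) (T : A → A),
      (∀ x (l : Fin q), Fin.contractNth j.castSucc (fun x y => β x y) (Function.update a i x) l =
        if l = i' then T x else Fin.contractNth j.castSucc (fun x y => β x y) a l) →
      ∀ x, Fin.contractNth j.castSucc (fun x y => β x y) (Function.update a i x) =
        Function.update (Fin.contractNth j.castSucc (fun x y => β x y) a) i' (T x) := by
    intro i' T h x
    funext l
    rw [h, Function.update_apply]
  have hi := i.isLt
  have hj := j.isLt
  rcases lt_trichotomy (i : ℕ) (j : ℕ) with h | h | h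
  · refine ⟨⟨i, by omega⟩, LinearMap.id, key _ _ fun x l => ?_⟩
    simp only [Fin.contractNth, Function.update_apply, Fin.ext_iff, Fin.val_castSucc, Fin.val_succ,
      LinearMap.id_apply]
    split_ifs <;> first | rfl | omega
  · refine ⟨j, β.flip (a j.succ), key _ _ fun x l => ?_⟩
    by_cases hl : l = j
    · subst hl
      simp [Fin.contractNth, Function.update_apply, Fin.ext_iff, h]
    · have hl' : (l : ℕ) ≠ j := fun h' => hl (Fin.ext h')
      simp only [Fin.contractNth, Function.update_apply, Fin.ext_iff, Fin.val_castSucc,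
        Fin.val_succ]
      split_ifs <;> first | rfl | omega
  · by_cases h1 : (i : ℕ) = j + 1
    · refine ⟨j, β (a j.castSucc), key _ _ fun x l => ?_⟩
      by_cases hl : l = j
      · subst hl
        simp [Fin.contractNth, Function.update_apply, Fin.ext_iff, h1]
      · have hl' : (l : ℕ) ≠ j := fun h' => hl (Fin.ext h')
        simp only [Fin.contractNth, Function.update_apply, Fin.ext_iff, Fin.val_castSucc,
          Fin.val_succ]
        split_ifs <;> first | rfl | omega
    · refine ⟨⟨i - 1, by omega⟩, LinearMap.id, key _ _ fun x l => ?_⟩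
      simp only [Fin.contractNth, Function.update_apply, Fin.ext_iff, Fin.val_castSucc,
        Fin.val_succ, LinearMap.id_apply]
      split_ifs <;> first | rfl | omega

/-- The face `a ↦ f(a_0, …, β(a_j, a_{j+1}), …, a_q)` of a cochain. -/
def bilinFace (β : A →ₗ[k] A →ₗ[k] A) {q : ℕ} (j : Fin q) : Cochain k A q →ₗ[k] Cochain k A (q + 1) where
  toFun f := .ofMultilinear
    { toFun a := f.toMultilinear (Fin.contractNth j.castSucc (fun x y => β x y) a)
      map_update_add' a i x y := by
        obtain ⟨i', T, h⟩ := contractNth_bilin_update β j a i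
        simp [h]
      map_update_smul' a i c x := by
        obtain ⟨i', T, h⟩ := contractNth_bilin_update β j a i
        simp [h] }
  map_add' _ _ := rfl
  map_smul' _ _ := rfl

theorem bilinFace_apply (β : A →ₗ[k] A →ₗ[k] A) {q : ℕ} (j : Fin q) (f : Cochain k A q) (a : Fin (q + 1) → A) :
    bilinFace β j f a = f (Fin.contractNth j.castSucc (fun x y => β x y) a) := rfl

/-- The sum `∑_j (-1)^{j+1} f(a_0, …, β(a_j, a_{j+1}), …, a_q)` of the inner faces. -/
def bilinInner (β : A →ₗ[k] A →ₗ[k] A) : Cochains k A →ₗ[k] Cochains k A :=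
  DirectSum.toModule k ℕ _ fun q => DirectSum.lof k ℕ (fun q => Cochain k A q) (q + 1) ∘ₗ
    ∑ j : Fin q, (-1 : k) ^ ((j : ℕ) + 1) • bilinFace β j

theorem bilinInner_lof (β : A →ₗ[k] A →ₗ[k] A) {q : ℕ} (f : Cochain k A q) :
    bilinInner β f.toCochains = ∑ j : Fin q, (-1 : k) ^ ((j : ℕ) + 1) • (bilinFace β j f).toCochains := by
  simp [bilinInner, Cochain.toCochains]

theorem signMap_bilinInner (β : A →ₗ[k] A →ₗ[k] A) (z : Cochains k A) : signMap (bilinInner β z) = - bilinInner β (signMap z) := by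
  induction z using cochains_induction with
  | h0 => simp
  | h2 x y hx hy => simp only [map_add, hx, hy, neg_add]
  | h1 q f =>
    simp only [signMap_lof, bilinInner_lof, map_sum, map_smul, pow_succ, Finset.smul_sum]
    rw [← Finset.sum_neg_distrib]
    refine Finset.sum_congr rfl fun j _ => ?_
    simp [smul_smul, mul_comm]

theorem bilinInner_mul (β : A →ₗ[k] A →ₗ[k] A) (z w : Cochains k A) :
    bilinInner β (z * w) = bilinInner β z * w + signMap z * bilinInner β w := by
  induction z using cochains_induction with
  | h0 => simp
  | h2 x y hx hy => simp only [add_mul, map_add, hx, hy]; abel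
  | h1 q f =>
    induction w using cochains_induction with
    | h0 => simp
    | h2 x y hx hy => simp only [mul_add, map_add, hx, hy]; abel
    | h1 r g =>
      rw [toCochains_mul, bilinInner_lof, bilinInner_lof, bilinInner_lof, signMap_lof, Fin.sum_univ_add,
        Finset.sum_mul, Finset.mul_sum]
      congr 1
      · refine Finset.sum_congr rfl fun j _ => ?_
        rw [smul_mul_assoc, toCochains_mul]
        congr 1
        refine toCochains_congr (by omega) _ _ fun a => ?_
        rw [bilinFace_apply, cup_apply, cup_apply, bilinFace_apply]
        congr 2
        · ext i
          simp only [Fin.contractNth]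
          have := j.isLt
          simp only [Fin.val_natAdd, Fin.val_castSucc, Fin.val_castAdd]
          rw [if_neg (by omega), if_neg (by omega)]
          congr 1
          ext
          simp
          omega
      · refine Finset.sum_congr rfl fun j _ => ?_
        rw [smul_mul_smul_comm, toCochains_mul]
        congr 1
        · simp [pow_add]
        refine toCochains_congr (by omega) _ _ fun a => ?_
        rw [bilinFace_apply, cup_apply, cup_apply, bilinFace_apply]
        congr 2
        · ext i
          have := i.isLt
          simp only [Fin.contractNth, Fin.val_natAdd, Fin.val_castSucc, Fin.val_castAdd]
          rw [if_pos (by omega)]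
          rfl
        · ext i
          simp only [Fin.contractNth, Fin.val_natAdd, Fin.val_castSucc, add_lt_add_iff_left,
            add_right_inj]
          rfl


theorem innerD_eq_bilinInner (z : Cochains k A) : innerD z = bilinInner (LinearMap.mul k A) z := by
  induction z using cochains_induction with
  | h0 => simp
  | h2 x y hx hy => simp only [map_add, hx, hy]
  | h1 q f =>
    rw [innerD_lof, bilinInner_lof]
    rfl

theorem signMap_form (f : A →ₗ[k] k) : signMap (form f) = -form f := by
  rw [form_eq, signMap_lof, pow_one, neg_one_smul]

theorem signMap_biform (B : A →ₗ[k] A →ₗ[k] k) : signMap (biform B) = biform B := by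
  rw [biform_eq, signMap_lof]
  simp

theorem bilinInner_algebraMap (β : A →ₗ[k] A →ₗ[k] A) (c : k) :
    bilinInner β (algebraMap k (Cochains k A) c) = 0 := by
  have h : algebraMap k (Cochains k A) c = (constCochain c : Cochain k A 0).toCochains := rfl
  rw [h, bilinInner_lof]
  simp

theorem bilinInner_form (β : A →ₗ[k] A →ₗ[k] A) (f : A →ₗ[k] k) :
    bilinInner β (form f) = -biform (β.compr₂ f) := by
  rw [form_eq, bilinInner_lof]
  simp only [Finset.univ_unique, Fin.default_eq_zero, Finset.sum_singleton]
  rw [Fin.val_zero, zero_add, pow_one, neg_one_smul]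
  rfl

/-- The value on forms of degree 2 is needed pointwise, because the Hochschild identity and
associativity are identities in three arguments. -/
theorem bilinInner_biform (β : A →ₗ[k] A →ₗ[k] A) (B : A →ₗ[k] A →ₗ[k] k) :
    ∃ F : Cochain k A 3, bilinInner β (biform B) = F.toCochains ∧
      ∀ a, F a = B (a 0) (β (a 1) (a 2)) - B (β (a 0) (a 1)) (a 2) := by
  refine ⟨bilinFace β 1 (bilinCochain B) - bilinFace β 0 (bilinCochain B), ?_, fun a => ?_⟩
  · rw [biform_eq, bilinInner_lof, Fin.sum_univ_two]
    simp only [Fin.val_zero, Fin.val_one, map_sub]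
    simp only [zero_add, pow_one, neg_one_smul, one_add_one_eq_two, even_two, Even.neg_pow,
      one_pow, one_smul]
    rw [neg_add_eq_sub]
  · rfl

/-- A Hochschild cocycle gives a derivation that anticommutes with the sum of the inner faces. -/
theorem innerD_bilinInner [Module.Finite k A] (β : A →ₗ[k] A →ₗ[k] A)
    (hβ : ∀ a b c, a * β b c - β (a * b) c + β a (b * c) - β a b * c = 0) (z : Cochains k A) :
    innerD (bilinInner β z) + bilinInner β (innerD z) = 0 := by
  simp only [innerD_eq_bilinInner]
  induction z using form_induction with
  | h0 c => simp [bilinInner_algebraMap]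
  | h2 x y hx hy =>
    simp only [map_add]
    rw [add_add_add_comm, hx, hy, add_zero]
  | h1 f w hw =>
    -- Both operators are odd derivations of the cochain ring, so their anticommutator is a
    -- derivation and it suffices to treat linear forms. There the claim is the Hochschild identity
    -- with `f` applied to it.
    have h1 : bilinInner (LinearMap.mul k A) (bilinInner β (form f)) +
        bilinInner β (bilinInner (LinearMap.mul k A) (form f)) = 0 := by
      obtain ⟨F, hF, hF'⟩ := bilinInner_biform (LinearMap.mul k A) (β.compr₂ f)
      obtain ⟨G, hG, hG'⟩ := bilinInner_biform β ((LinearMap.mul k A).compr₂ f)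
      rw [bilinInner_form, bilinInner_form, map_neg, map_neg, hF, hG, ← neg_add, ← map_add,
        neg_eq_zero]
      have : F + G = 0 := by
        ext a
        rw [Cochain.add_apply, hF', hG', Cochain.zero_apply]
        have h := congr_arg f (hβ (a 0) (a 1) (a 2))
        simp only [map_add, map_sub, map_zero] at h
        simp only [LinearMap.compr₂_apply, LinearMap.mul_apply']
        linear_combination h
      rw [this, map_zero]
    simp only [bilinInner_mul, map_add, signMap_form, signMap_bilinInner, neg_mul, map_neg]
    have e1 := congr_arg (· * w) h1
    have e2 := congr_arg (form f * ·) hw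
    simp only [add_mul, zero_mul, mul_add, mul_zero] at e1 e2
    rw [← sub_eq_zero] at e1 e2 ⊢
    rw [← add_zero (0 : Cochains k A)]
    nth_rw 2 [← e1]
    nth_rw 3 [← e2]
    abel

end BilinearFaces

/-! ### The bar differential on products of forms. -/

section Differential

variable {k : Type u} {A : Type v} [Field k] [CommRing A] [Algebra k A] (ε : A →ₐ[k] k)

theorem biform_aug : biform ((LinearMap.mul k A).compr₂ ε.toLinearMap) =
    form ε.toLinearMap * form ε.toLinearMap := by
  rw [form_mul_form]
  congr 1
  ext a b
  simp

theorem d_form (f : A →ₗ[k] k) : d ε (form f) = -biform ((LinearMap.mul k A).compr₂ f) +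
    form ε.toLinearMap * form f + form f * form ε.toLinearMap := by
  rw [d_apply, innerD_eq_bilinInner, bilinInner_form, signMap_form, augCochain_eq_form, neg_mul,
    sub_neg_eq_add]

theorem d_aug : d ε (form ε.toLinearMap) = form ε.toLinearMap * form ε.toLinearMap := by
  rw [d_form, biform_aug]
  abel

/-- The two inner faces are f(a(bc)) and f((ab)c), which cancel by associativity. Only the outer
faces remain. -/
theorem d_biform_mul (f : A →ₗ[k] k) : d ε (biform ((LinearMap.mul k A).compr₂ f)) =
    form ε.toLinearMap * biform ((LinearMap.mul k A).compr₂ f) -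
      biform ((LinearMap.mul k A).compr₂ f) * form ε.toLinearMap := by
  rw [d_apply, signMap_biform, augCochain_eq_form, innerD_eq_bilinInner]
  obtain ⟨F, hF, hF'⟩ := bilinInner_biform (LinearMap.mul k A) ((LinearMap.mul k A).compr₂ f)
  have : F = 0 := by
    ext a
    rw [hF']
    simp [mul_assoc]
  rw [hF, this, show (0 : Cochain k A 3).toCochains = 0 from LinearMap.map_zero _, zero_add]

theorem d_form_mul (f : A →ₗ[k] k) (w : Cochains k A) :
    d ε (form f * w) = d ε (form f) * w - form f * d ε w := by
  rw [d_mul, signMap_form, neg_mul, sub_eq_add_neg]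

variable [Module.Finite k A]

/-- The square of an odd derivation is a derivation. It therefore vanishes once it vanishes on
linear forms, which generate the ring. -/
theorem d_d (z : Cochains k A) : d ε (d ε z) = 0 := by
  induction z using form_induction with
  | h0 c => simp [d_algebraMap]
  | h2 x y hx hy => simp [hx, hy]
  | h1 f w hw =>
    have h1 : d ε (d ε (form f)) = 0 := by
      rw [d_form]
      simp only [map_add, map_neg, d_biform_mul, d_form_mul, d_form, biform_aug]
      noncomm_ring
    rw [d_form_mul, map_sub, d_mul, d_mul, h1, hw, signMap_d, signMap_form]
    simp

/-- The class of `-ε ∘ β` for a Hochschild 2-cocycle `β` is central. -/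
theorem d_bilinInner (β : A →ₗ[k] A →ₗ[k] A)
    (hβ : ∀ a b c, a * β b c - β (a * b) c + β a (b * c) - β a b * c = 0) (z : Cochains k A) :
    d ε (bilinInner β z) + bilinInner β (d ε z) =
      z * biform (β.compr₂ ε.toLinearMap) - biform (β.compr₂ ε.toLinearMap) * z := by
  have h := innerD_bilinInner β hβ z
  simp only [d_apply, map_add, map_sub, bilinInner_mul, augCochain_eq_form, bilinInner_form,
    signMap_form, signMap_bilinInner, signMap_signMap, mul_neg, neg_mul]
  rw [← sub_eq_zero] at h ⊢
  rw [← h]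
  abel

end Differential

end SupergroupAlgebra

end

noncomputable section

namespace SupergroupAlgebra

/-! ### Filtration of the cochain ring by degree. -/

section Degree

variable {k : Type u} {A : Type v} [Field k] [CommRing A] [Algebra k A]

variable (k A) in
/-- The sums of cochains of degree less than `q`. -/
def degLT (q : ℕ) : Submodule k (Cochains k A) :=
  Submodule.span k {z | ∃ i < q, ∃ f : Cochain k A i, z = f.toCochains}

theorem toCochains_mem_degLT {i q : ℕ} (h : i < q) (f : Cochain k A i) :
    f.toCochains ∈ degLT k A q := Submodule.subset_span ⟨i, h, f, rfl⟩

theorem degLT_zero : degLT k A 0 = ⊥ := by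
  rw [degLT, Submodule.span_eq_bot]
  rintro _ ⟨i, h, -⟩
  exact absurd h (Nat.not_lt_zero i)

theorem degLT_mono {q r : ℕ} (h : q ≤ r) : degLT k A q ≤ degLT k A r :=
  Submodule.span_mono fun _ ⟨i, hi, f, hf⟩ => ⟨i, hi.trans_le h, f, hf⟩

theorem map_mem_degLT {q r : ℕ} (T : Cochains k A →ₗ[k] Cochains k A)
    (h : ∀ i < q, ∀ f : Cochain k A i, T f.toCochains ∈ degLT k A r) {z : Cochains k A}
    (hz : z ∈ degLT k A q) : T z ∈ degLT k A r := by
  have : degLT k A q ≤ (degLT k A r).comap T := by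
    refine Submodule.span_le.mpr ?_
    rintro _ ⟨i, hi, f, rfl⟩
    exact h i hi f
  exact this hz

theorem form_mul_mem_degLT (f : A →ₗ[k] k) {q : ℕ} {w : Cochains k A} (hw : w ∈ degLT k A q) :
    form f * w ∈ degLT k A (q + 1) := by
  refine map_mem_degLT (LinearMap.mulLeft k (form f)) (fun i hi g => ?_) hw
  rw [LinearMap.mulLeft_apply, form_eq, toCochains_mul]
  exact toCochains_mem_degLT (by omega) _

theorem mul_form_mem_degLT (f : A →ₗ[k] k) {q : ℕ} {w : Cochains k A} (hw : w ∈ degLT k A q) :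
    w * form f ∈ degLT k A (q + 1) := by
  refine map_mem_degLT (LinearMap.mulRight k (form f)) (fun i hi g => ?_) hw
  rw [LinearMap.mulRight_apply, form_eq, toCochains_mul]
  exact toCochains_mem_degLT (by omega) _

theorem d_mem_degLT (ε : A →ₐ[k] k) {q : ℕ} {w : Cochains k A} (hw : w ∈ degLT k A q) :
    d ε w ∈ degLT k A (q + 1) := by
  refine map_mem_degLT _ (fun i hi g => ?_) hw
  rw [d_apply, innerD_lof, signMap_lof, smul_mul_assoc, augCochain_eq_form]
  refine sub_mem (add_mem (sum_mem fun j _ => ?_) ?_) ?_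
  · exact Submodule.smul_mem _ _ (toCochains_mem_degLT (by omega) _)
  · exact form_mul_mem_degLT _ (toCochains_mem_degLT hi g)
  · exact Submodule.smul_mem _ _ (mul_form_mem_degLT _ (toCochains_mem_degLT hi g))

theorem insert_mem_degLT (a : A) {q : ℕ} {w : Cochains k A} (hw : w ∈ degLT k A q) :
    insert w a ∈ degLT k A (q - 1) := by
  refine map_mem_degLT (insert.flip a) (fun i hi g => ?_) hw
  rw [LinearMap.flip_apply]
  rcases i with _ | i
  · rw [insert_zero]
    exact zero_mem _
  · rw [insert_succ]
    exact toCochains_mem_degLT (by omega) _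

theorem prep_mem_degLT [Module.Finite k A] {g : A →ₗ[k] Cochains k A} {q : ℕ}
    (hg : ∀ a, g a ∈ degLT k A q) : prep g ∈ degLT k A (q + 1) := by
  rw [prep_apply]
  exact sum_mem fun _ _ => form_mul_mem_degLT _ (hg _)

end Degree

/-! ### The complex of linear maps from `A` to cochains. -/

section Twisted

variable {k : Type u} {A : Type v} [Field k] [CommRing A] [Algebra k A]

/-- The action of `A` on linear maps `A → R`. -/
def act (t : A) : (A →ₗ[k] Cochains k A) →ₗ[k] A →ₗ[k] Cochains k A :=
  LinearMap.lcomp k _ (LinearMap.mulLeft k t)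

@[simp]
theorem act_apply (t : A) (f : A →ₗ[k] Cochains k A) (a : A) : act t f a = f (t * a) := rfl

/-- Right multiplication of linear maps `A → R` by elements of `R`. -/
def rmul (w : Cochains k A) : (A →ₗ[k] Cochains k A) →ₗ[k] A →ₗ[k] Cochains k A :=
  LinearMap.compRight k (LinearMap.mulRight k w)

@[simp]
theorem rmul_apply (w : Cochains k A) (f : A →ₗ[k] Cochains k A) (a : A) :
    rmul w f a = f a * w := rfl

variable (ε : A →ₐ[k] k)

/-- The linear map `a ↦ ε(a) w`. -/
def cst : Cochains k A →ₗ[k] A →ₗ[k] Cochains k A where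
  toFun w := LinearMap.toSpanSingleton k _ w ∘ₗ ε.toLinearMap
  map_add' x y := by ext1 a; simp
  map_smul' c x := by ext1 a; exact smul_comm (ε a) c x

@[simp]
theorem cst_apply (w : Cochains k A) (a : A) : cst ε w a = ε a • w := rfl

theorem cst_injective : Function.Injective (cst ε) := fun x y h => by
  simpa using DFunLike.congr_fun h 1

theorem rmul_cst (w z : Cochains k A) : rmul w (cst ε z) = cst ε (z * w) := by
  ext1 a
  simp

theorem act_cst {t : A} (ht : ε t = 0) (w : Cochains k A) : act t (cst ε w) = 0 := by
  ext1 a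
  simp [ht]

/-- A linear form as a linear map `A → R`. -/
def scal (g : A →ₗ[k] k) : A →ₗ[k] Cochains k A := Algebra.linearMap k (Cochains k A) ∘ₗ g

@[simp]
theorem scal_apply (g : A →ₗ[k] k) (a : A) : scal g a = algebraMap k (Cochains k A) (g a) := rfl

variable [Module.Finite k A]

theorem prep_cst (w : Cochains k A) : prep (cst ε w) = form ε.toLinearMap * w := by
  rw [prep_apply]
  simp only [cst_apply, mul_smul_comm]
  conv_rhs => rw [← sum_coord_smul ε.toLinearMap]
  simp [Finset.sum_mul]

theorem prep_scal (g : A →ₗ[k] k) : prep (scal g) = form g := by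
  rw [prep_apply]
  have h := congr_arg form (sum_coord_smul g)
  rw [map_sum] at h
  rw [← h]
  refine Finset.sum_congr rfl fun i _ => ?_
  rw [map_smul, scal_apply, Algebra.algebraMap_eq_smul_one, mul_smul_comm, mul_one]

/-- The differential of the complex `Hom(A, R)` of cochains with coefficients in the dual of `A`:
`(Df)(m)(a_1, …) = f(m a_1)(a_2, …) - f(m)(a_1 a_2, …) + ⋯`. -/
def twD : (A →ₗ[k] Cochains k A) →ₗ[k] A →ₗ[k] Cochains k A where
  toFun f := d ε ∘ₗ f + prep ∘ₗ (LinearMap.mul k A).compr₂ f -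
    LinearMap.mulLeft k (form ε.toLinearMap) ∘ₗ f
  map_add' f g := by
    have : ∀ m, (LinearMap.mul k A).compr₂ (f + g) m =
      (LinearMap.mul k A).compr₂ f m + (LinearMap.mul k A).compr₂ g m := fun m => rfl
    ext1 m
    simp only [LinearMap.add_apply, LinearMap.sub_apply, LinearMap.comp_apply, this, map_add]
    abel
  map_smul' c f := by
    have : ∀ m, (LinearMap.mul k A).compr₂ (c • f) m = c • (LinearMap.mul k A).compr₂ f m :=
      fun m => rfl
    ext1 m
    simp only [LinearMap.add_apply, LinearMap.sub_apply, LinearMap.comp_apply, this, map_smul,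
      LinearMap.smul_apply, smul_add, smul_sub, RingHom.id_apply]

theorem twD_apply (f : A →ₗ[k] Cochains k A) (m : A) :
    twD ε f m = d ε (f m) + prep (act m f) - form ε.toLinearMap * f m := rfl

/-- Up to sign and the first outer face, `twD` is the bar differential read through the
identification of linear maps A → R with cochains of positive degree. Facts about `twD` are pulled
back from facts about `d` along this formula and `prep_injective`. -/
theorem d_prep (g : A →ₗ[k] Cochains k A) :
    d ε (prep g) = form ε.toLinearMap * prep g - prep (twD ε g) := by
  -- Expanding a in the basis e_i gives f(ab) = ∑ e_i^*(a) f(e_i b).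
  have hb : ∀ f : A →ₗ[k] k, biform ((LinearMap.mul k A).compr₂ f) =
      ∑ i, form ((stdBasis k A).coord i) * form (f ∘ₗ LinearMap.mulLeft k (stdBasis k A i)) := by
    intro f
    simp only [form_mul_form]
    rw [← map_sum]
    congr 1
    refine (stdBasis k A).ext fun i => ?_
    ext b
    rw [LinearMap.sum_apply, Finset.sum_eq_single i]
    · simp
    · intro j _ hj
      ext c
      simp [hj.symm]
    · simp
  -- Both sides are the cochain (a_0, a_1, …) ↦ g(a_0 a_1)(…).
  have h2 : ∑ i, biform ((LinearMap.mul k A).compr₂ ((stdBasis k A).coord i)) *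
      g (stdBasis k A i) = ∑ i, form ((stdBasis k A).coord i) * prep (act (stdBasis k A i) g) := by
    simp only [hb, Finset.sum_mul]
    rw [Finset.sum_comm]
    refine Finset.sum_congr rfl fun i _ => ?_
    simp only [mul_assoc, ← Finset.mul_sum]
    congr 1
    have h3 : ∀ j, form ((stdBasis k A).coord j ∘ₗ LinearMap.mulLeft k (stdBasis k A i)) =
        ∑ l, (stdBasis k A).coord j (stdBasis k A i * stdBasis k A l) •
          form ((stdBasis k A).coord l) := by
      intro j
      have h := congr_arg form (sum_coord_smul ((stdBasis k A).coord j ∘ₗ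
        LinearMap.mulLeft k (stdBasis k A i)))
      rw [map_sum] at h
      rw [← h]
      exact Finset.sum_congr rfl fun l _ => map_smul _ _ _
    simp only [h3, Finset.sum_mul]
    rw [Finset.sum_comm, prep_apply]
    refine Finset.sum_congr rfl fun l _ => ?_
    simp only [smul_mul_assoc, ← mul_smul_comm]
    rw [← Finset.mul_sum, act_apply]
    congr 1
    conv_rhs => rw [← (stdBasis k A).sum_repr (stdBasis k A i * stdBasis k A l), map_sum]
    simp
  rw [prep_apply, map_sum, Finset.mul_sum, prep_apply]
  simp only [d_form_mul, d_form, add_mul, neg_mul, Finset.sum_sub_distrib, Finset.sum_add_distrib,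
    twD_apply, mul_add, mul_sub, mul_assoc]
  rw [Finset.sum_neg_distrib, h2]
  abel

theorem twD_twD (f : A →ₗ[k] Cochains k A) : twD ε (twD ε f) = 0 := by
  apply prep_injective
  have h1 := d_prep ε (twD ε f)
  have h2 : prep (twD ε f) = form ε.toLinearMap * prep f - d ε (prep f) := by
    rw [d_prep]
    abel
  rw [h2, map_sub, d_d, d_form_mul, d_aug] at h1
  rw [map_zero, ← sub_eq_zero.mpr h1]
  noncomm_ring

/-- The differential uses only products on the other side of the module variable, so it is linear
over `A`. Multiplication by t thus acts on the whole complex. -/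
theorem twD_act (t : A) (f : A →ₗ[k] Cochains k A) : twD ε (act t f) = act t (twD ε f) := by
  ext1 m
  have h : act m (act t f) = act (t * m) f := by
    ext1 a
    simp [mul_assoc]
  rw [act_apply, twD_apply, twD_apply, h, act_apply]

/-- The cohomology of the complex is a right module over the algebra of cocycles. This is how
products with earlier basis cocycles enter the primitives. -/
theorem twD_rmul {w : Cochains k A} (hw : d ε w = 0) (f : A →ₗ[k] Cochains k A) :
    twD ε (rmul w f) = rmul w (twD ε f) := by
  ext1 m
  simp only [rmul_apply, twD_apply, d_mul, hw, mul_zero, add_zero, add_mul, sub_mul, prep_apply,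
    act_apply, Finset.sum_mul, mul_assoc]

/-- Maps that factor through `ε` form a copy of the bar complex itself, which is the case A/I = k.
-/
theorem twD_cst (w : Cochains k A) : twD ε (cst ε w) = cst ε (d ε w) := by
  apply prep_injective
  have h := d_prep ε (cst ε w)
  rw [prep_cst, d_form_mul, d_aug] at h
  rw [prep_cst, ← sub_eq_zero, ← sub_eq_zero.mpr h]
  noncomm_ring

/-- A cocycle of positive degree becomes a coboundary in the complex of `A`. -/
theorem twD_of_d_prep {g : A →ₗ[k] Cochains k A} (h : d ε (prep g) = 0) :
    twD ε g = cst ε (prep g) := by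
  apply prep_injective
  have h' := d_prep ε g
  rw [h] at h'
  rw [prep_cst, ← sub_eq_zero.mp h'.symm]

/-- Since `I` is an ideal, the maps that vanish on it form a subcomplex, namely the complex for A/I.
-/
theorem twD_vanish {I : Ideal A} {f : A →ₗ[k] Cochains k A} (hf : ∀ a ∈ I, f a = 0) :
    ∀ a ∈ I, twD ε f a = 0 := by
  intro a ha
  have : act a f = 0 := by
    ext1 b
    exact hf _ (I.mul_mem_right b ha)
  rw [twD_apply, this, hf a ha]
  simp

theorem twD_mem_degLT {f : A →ₗ[k] Cochains k A} {q : ℕ} (hf : ∀ a, f a ∈ degLT k A (q - 1))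
    (a : A) : twD ε f a ∈ degLT k A q := by
  rcases q with _ | q
  -- For `q = 0` the bound `q - 1` is again 0, so the hypothesis forces `f = 0`.
  · have : f = 0 := by
      ext1 b
      simpa [degLT_zero] using hf b
    simp [this]
  · rw [twD_apply]
    exact sub_mem (add_mem (d_mem_degLT ε (hf a)) (prep_mem_degLT fun b => hf _))
      (form_mul_mem_degLT _ (hf a))

/-- The complex `Hom(A, R)` is a resolution of `k`. -/
theorem exists_twD_eq {f : A →ₗ[k] Cochains k A} (hf : twD ε f = 0) {q : ℕ}
    (hq : ∀ a, f a ∈ degLT k A q) : ∃ (c : k) (g : A →ₗ[k] Cochains k A),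
      (∀ a, g a ∈ degLT k A (q - 1)) ∧ f = cst ε (algebraMap k _ c) + twD ε g := by
  obtain ⟨c, hc⟩ := exists_eq_algebraMap_add_prep (f 1)
  -- The contraction evaluates at 1 and detaches the first argument. The cocycle condition at 1 then
  -- expresses f through f(1).
  refine ⟨c, insert (f 1), fun a => insert_mem_degLT a (hq 1), ?_⟩
  apply prep_injective
  have h1 : act 1 f = f := by
    ext1 a
    simp
  have h2 := DFunLike.congr_fun hf 1
  rw [twD_apply, h1, LinearMap.zero_apply] at h2
  have h3 := d_prep ε (insert (f 1))
  have h4 : prep (insert (f 1)) = f 1 - algebraMap k _ c := by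
    nth_rw 2 [hc]
    abel
  rw [h4, map_sub, d_algebraMap] at h3
  rw [map_add, prep_cst, ← sub_eq_zero]
  rw [← sub_eq_zero] at h2 h3
  rw [← add_zero (0 : Cochains k A)]
  nth_rw 1 [← h2]
  nth_rw 1 [← h3]
  noncomm_ring

end Twisted

end SupergroupAlgebra

end

noncomputable section

namespace SupergroupAlgebra

/-! ### The constant term of a cochain. -/

section ConstantTerm

variable {k : Type u} {A : Type v} [Field k] [CommRing A] [Algebra k A]

/-- The value of the component of degree `0`. -/
def constTerm : Cochains k A →ₗ[k] k :=
  evalCochain ![] ∘ₗ DirectSum.component k ℕ (fun q => Cochain k A q) 0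

theorem constTerm_one : constTerm (1 : Cochains k A) = 1 := by
  change constTerm (Cochain.toCochains (constCochain 1 : Cochain k A 0)) = 1
  rw [constTerm, LinearMap.comp_apply, DirectSum.component.lof_self]
  rfl

theorem constTerm_toCochains {q : ℕ} (hq : q ≠ 0) (f : Cochain k A q) :
    constTerm f.toCochains = 0 := by
  rw [constTerm, LinearMap.comp_apply, DirectSum.component.of, dif_neg hq, map_zero]

theorem constTerm_form_mul (f : A →ₗ[k] k) (w : Cochains k A) : constTerm (form f * w) = 0 := by
  induction w using cochains_induction with
  | h0 => simp
  | h2 x y hx hy => rw [mul_add, map_add, hx, hy, add_zero]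
  | h1 q g =>
    rw [form_eq, toCochains_mul]
    exact constTerm_toCochains (by omega) _

theorem constTerm_prep [Module.Finite k A] (g : A →ₗ[k] Cochains k A) :
    constTerm (prep g) = 0 := by
  rw [prep_apply, map_sum]
  exact Finset.sum_eq_zero fun i _ => constTerm_form_mul _ _

theorem constTerm_d (ε : A →ₐ[k] k) (w : Cochains k A) : constTerm (d ε w) = 0 := by
  induction w using cochains_induction with
  | h0 => simp
  | h2 x y hx hy => rw [map_add, map_add, hx, hy, add_zero]
  | h1 q g =>
    rw [d_apply, innerD_lof, signMap_lof, toCochains_mul, smul_mul_assoc, toCochains_mul]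
    simp only [map_add, map_sub, map_sum, map_smul]
    rw [Finset.sum_eq_zero fun j _ => by rw [constTerm_toCochains (by omega), smul_zero],
      constTerm_toCochains (by omega), constTerm_toCochains (by omega)]
    simp

end ConstantTerm

/-! ### Cocycle bases for the complexes of the quotients A/I. -/

section Model

variable {k : Type u} {A : Type v} [Field k] [CommRing A] [Algebra k A] [Module.Finite k A]

/-- The family of cocycles `M` of degrees `deg`, restricted to the subgroup with group algebra
`A/I`, gives a basis of the cohomology of the complex of linear maps `A/I → R`. -/
structure IsModel (ε : A →ₐ[k] k) (I : Ideal A) {Γ : Type*} (deg : Γ → ℕ) (M : Γ → Cochains k A) :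
    Prop where
  cocycle : ∀ γ, d ε (M γ) = 0
  span : ∀ (q : ℕ) (z : A →ₗ[k] Cochains k A), (∀ a ∈ I, z a = 0) → twD ε z = 0 →
    (∀ a, z a ∈ degLT k A q) → ∃ (c : Γ →₀ k) (f : A →ₗ[k] Cochains k A),
      (∀ γ ∈ c.support, deg γ < q) ∧ (∀ a ∈ I, f a = 0) ∧ (∀ a, f a ∈ degLT k A (q - 1)) ∧
      z = cst ε (Finsupp.linearCombination k M c) + twD ε f
  indep : ∀ (c : Γ →₀ k) (f : A →ₗ[k] Cochains k A), (∀ a ∈ I, f a = 0) →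
    cst ε (Finsupp.linearCombination k M c) = twD ε f → c = 0

variable {ε : A →ₐ[k] k}

theorem IsModel.cocycle_linearCombination {I : Ideal A} {Γ : Type*} {deg : Γ → ℕ}
    {M : Γ → Cochains k A} (h : IsModel ε I deg M) (c : Γ →₀ k) :
    d ε (Finsupp.linearCombination k M c) = 0 := by
  rw [Finsupp.linearCombination_apply, Finsupp.sum, map_sum]
  exact Finset.sum_eq_zero fun γ _ => by rw [map_smul, h.cocycle, smul_zero]

/-- The module `A` is free, so only the constants survive. They are not coboundaries because every
value of `twD` at 1 has zero constant term. -/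
theorem isModel_bot : IsModel ε (⊥ : Ideal A) (fun _ : Unit => 0) (fun _ => 1) where
  cocycle _ := by simpa using d_algebraMap ε (1 : k)
  span q z _ hz hq := by
    obtain ⟨c, g, hg, h⟩ := exists_twD_eq ε hz hq
    -- The degree bound is strict: for `q = 0` the cocycle is zero and the basis element of degree 0
    -- must not be used.
    rcases Nat.eq_zero_or_pos q with rfl | hq0
    · refine ⟨0, 0, by simp, by simp, fun a => zero_mem _, ?_⟩
      ext1 a
      simpa [degLT_zero] using hq a
    · refine ⟨Finsupp.single () c, g, fun _ _ => hq0, fun a ha => ?_, hg, ?_⟩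
      · rw [Submodule.mem_bot] at ha
        rw [ha, map_zero]
      · rw [h, Finsupp.linearCombination_single, Algebra.algebraMap_eq_smul_one]
  indep c f _ h := by
    have h1 := congr_arg constTerm (DFunLike.congr_fun h 1)
    rw [twD_apply, map_sub, map_add, constTerm_d, constTerm_prep, constTerm_form_mul, cst_apply,
      map_one, one_smul, Finsupp.linearCombination_apply, Finsupp.sum_fintype _ _ (by simp),
      Fintype.sum_unique, map_smul, constTerm_one] at h1
    ext
    simpa using h1

/-- Needed because each step of the induction produces a nested index type, while the final
statement uses exponent vectors. -/
theorem IsModel.reindex {I : Ideal A} {Γ Γ' : Type*} {deg : Γ → ℕ} {M : Γ → Cochains k A}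
    (h : IsModel ε I deg M) (e : Γ' ≃ Γ) {deg' : Γ' → ℕ} {M' : Γ' → Cochains k A}
    (hdeg : ∀ γ, deg' γ = deg (e γ)) (hM : ∀ γ, M' γ = M (e γ)) : IsModel ε I deg' M' := by
  have hM' : M' = M ∘ e := funext hM
  refine ⟨fun γ => by rw [hM, h.cocycle], fun q z h1 h2 h3 => ?_, fun c f h1 h2 => ?_⟩
  · obtain ⟨c, f, hc, hf⟩ := h.span q z h1 h2 h3
    refine ⟨Finsupp.equivMapDomain e.symm c, f, fun γ hγ => ?_, ?_⟩
    · rw [hdeg]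
      refine hc _ ?_
      simpa using hγ
    · rw [hM', Finsupp.equivMapDomain_eq_mapDomain, Finsupp.linearCombination_mapDomain]
      simpa [Function.comp_assoc] using hf
  · have := h.indep (Finsupp.equivMapDomain e c) f h1 (by
      rw [Finsupp.equivMapDomain_eq_mapDomain, Finsupp.linearCombination_mapDomain, ← hM', h2])
    ext γ
    simpa using DFunLike.congr_fun this (e γ)

theorem exists_mem_degLT (z : Cochains k A) : ∃ q, z ∈ degLT k A q := by
  induction z using cochains_induction with
  | h0 => exact ⟨0, zero_mem _⟩
  | h1 q f => exact ⟨q + 1, toCochains_mem_degLT (Nat.lt_succ_self q) f⟩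
  | h2 x y hx hy =>
    obtain ⟨q, hq⟩ := hx
    obtain ⟨r, hr⟩ := hy
    exact ⟨max q r, add_mem (degLT_mono (le_max_left _ _) hq) (degLT_mono (le_max_right _ _) hr)⟩

/-- By finite dimensionality one bound serves all values. The spanning property can then be applied
to cocycles given without any degree bound. -/
theorem exists_degLT (f : A →ₗ[k] Cochains k A) : ∃ q, ∀ a, f a ∈ degLT k A q := by
  choose Q hQ using fun i => exists_mem_degLT (f (stdBasis k A i))
  refine ⟨Finset.univ.sup Q, fun a => ?_⟩
  rw [← (stdBasis k A).sum_repr a, map_sum]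
  refine sum_mem fun i hi => ?_
  rw [map_smul]
  exact Submodule.smul_mem _ _ (degLT_mono (Finset.le_sup hi) (hQ i))

/-! ### Adjoining one generator to the ideal. -/

section Step

variable {Γ : Type*}

/-- The degrees of the products `x^a λ^e M_γ`. -/
def stepDeg (deg : Γ → ℕ) : ℕ × Fin 2 × Γ → ℕ := fun g => 2 * g.1 + g.2.1 + deg g.2.2

/-- The products `x^a λ^e M_γ`. -/
def stepFam (x l : Cochains k A) (M : Γ → Cochains k A) : ℕ × Fin 2 × Γ → Cochains k A :=
  fun g => x ^ g.1 * l ^ (g.2.1 : ℕ) * M g.2.2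

theorem embed_zero_injective (e : Fin 2) :
    Function.Injective (fun γ : Γ => ((0, e, γ) : ℕ × Fin 2 × Γ)) := fun a b h => by
  simpa using h

theorem embed_succ_injective :
    Function.Injective (fun g : ℕ × Fin 2 × Γ => ((g.1 + 1, g.2) : ℕ × Fin 2 × Γ)) :=
  fun a b h => by
    simp only [Prod.mk.injEq, add_left_inj] at h
    exact Prod.ext h.1 h.2

theorem stepFam_combination (x l : Cochains k A) (M : Γ → Cochains k A) (c₀ c₁ : Γ →₀ k)
    (c₂ : ℕ × Fin 2 × Γ →₀ k) :
    Finsupp.linearCombination k (stepFam x l M) (c₀.mapDomain (fun γ => (0, 0, γ)) +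
      c₁.mapDomain (fun γ => (0, 1, γ)) + c₂.mapDomain (fun g => (g.1 + 1, g.2))) =
    Finsupp.linearCombination k M c₀ + l * Finsupp.linearCombination k M c₁ +
      x * Finsupp.linearCombination k (stepFam x l M) c₂ := by
  rw [map_add, map_add, Finsupp.linearCombination_mapDomain, Finsupp.linearCombination_mapDomain,
    Finsupp.linearCombination_mapDomain]
  simp only [Finsupp.linearCombination_apply, Finsupp.sum, Finset.mul_sum, Function.comp_apply,
    stepFam, mul_smul_comm, pow_zero, one_mul, Fin.val_zero, Fin.val_one, pow_succ',
    mul_assoc]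

/-- Monomials without x, with or without λ, are separated from those divisible by x. The last part
is again a combination of the same family with the exponent of x lowered by one, which drives the
recursions. -/
theorem exists_stepFam_decomposition (c : ℕ × Fin 2 × Γ →₀ k) :
    ∃ (c₀ c₁ : Γ →₀ k) (c₂ : ℕ × Fin 2 × Γ →₀ k),
      c = c₀.mapDomain (fun γ => (0, 0, γ)) + c₁.mapDomain (fun γ => (0, 1, γ)) +
        c₂.mapDomain (fun g => (g.1 + 1, g.2)) ∧
      ∀ g, c₂ g = c (g.1 + 1, g.2) := by
  refine ⟨c.comapDomain _ (embed_zero_injective 0).injOn,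
    c.comapDomain _ (embed_zero_injective 1).injOn,
    c.comapDomain _ embed_succ_injective.injOn, ?_, fun g => rfl⟩
  ext ⟨a, e, γ⟩
  rw [Finsupp.add_apply, Finsupp.add_apply]
  rcases a with _ | a
  · rw [Finsupp.mapDomain_of_notMem_range _ ((0, e, γ) : ℕ × Fin 2 × Γ)
      (f := fun g : ℕ × Fin 2 × Γ => ((g.1 + 1, g.2) : ℕ × Fin 2 × Γ)) (by simp), add_zero]
    have he : e = 0 ∨ e = 1 := by omega
    rcases he with rfl | rfl
    · rw [Finsupp.mapDomain_of_notMem_range _ ((0, 0, γ) : ℕ × Fin 2 × Γ)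
        (f := fun γ : Γ => ((0, 1, γ) : ℕ × Fin 2 × Γ)) (by simp), add_zero]
      exact (Finsupp.mapDomain_apply (embed_zero_injective 0)
        (c.comapDomain _ (embed_zero_injective 0).injOn) γ).symm
    · rw [Finsupp.mapDomain_of_notMem_range _ ((0, 1, γ) : ℕ × Fin 2 × Γ)
        (f := fun γ : Γ => ((0, 0, γ) : ℕ × Fin 2 × Γ)) (by simp), zero_add]
      exact (Finsupp.mapDomain_apply (embed_zero_injective 1)
        (c.comapDomain _ (embed_zero_injective 1).injOn) γ).symm
  · rw [Finsupp.mapDomain_of_notMem_range _ ((a + 1, e, γ) : ℕ × Fin 2 × Γ)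
        (f := fun γ : Γ => ((0, 0, γ) : ℕ × Fin 2 × Γ)) (by simp),
      Finsupp.mapDomain_of_notMem_range _ ((a + 1, e, γ) : ℕ × Fin 2 × Γ)
        (f := fun γ : Γ => ((0, 1, γ) : ℕ × Fin 2 × Γ)) (by simp), zero_add, zero_add]
    exact (Finsupp.mapDomain_apply embed_succ_injective
      (c.comapDomain _ embed_succ_injective.injOn) ((a, e, γ) : ℕ × Fin 2 × Γ)).symm

/-- The hypotheses for adjoining a generator `t`, with `t^d = 0` modulo `I`, to the ideal `I`: a
linear form `l` and a bilinear form `X` whose classes are the new exterior and polynomial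
generators, and linear maps that divide by `t^(d-1)` and by `t`. -/
structure StepData (ε : A →ₐ[k] k) (I : Ideal A) (t : A) (d' : ℕ) (l : A →ₗ[k] k)
    (X : A →ₗ[k] Cochains k A) : Prop where
  two_le : 2 ≤ d'
  gen_pow_mem : t ^ d' ∈ I
  aug_eq_zero : ε t = 0
  l_cocycle : d ε (form l) = 0
  l_vanish : ∀ a ∈ I, l a = 0
  l_mul : ∀ a, l (t * a) = ε a
  X_cocycle : d ε (prep X) = 0
  X_vanish : ∀ a ∈ I, X a = 0
  X_deg : ∀ a, ∃ f : A →ₗ[k] k, X a = form f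
  X_mul : ∃ (G : A →ₗ[k] k) (c : k), c ≠ 0 ∧ (∀ a ∈ I, G a = 0) ∧
    (∀ a, G (t ^ (d' - 1) * a) = c * ε a) ∧ act t X = twD ε (scal G)
  div_pow : ∃ ψ : A →ₗ[k] A, (∀ a ∈ I, ψ a ∈ I ⊔ Ideal.span {t}) ∧
    ∀ a, ψ (t ^ (d' - 1) * a) - a ∈ I ⊔ Ideal.span {t}
  div : ∃ ψ : A →ₗ[k] A, (∀ a ∈ I, ψ a ∈ I) ∧
    ∀ a, ψ (t * a) - a ∈ I ⊔ Ideal.span {t ^ (d' - 1)}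

variable {I : Ideal A} {t : A} {d' : ℕ} {l : A →ₗ[k] k} {X : A →ₗ[k] Cochains k A}
  {deg : Γ → ℕ} {M : Γ → Cochains k A}

theorem mem_sup_span_singleton {I : Ideal A} {t a : A} (ha : a ∈ I ⊔ Ideal.span {t}) :
    ∃ i ∈ I, ∃ b, a = i + t * b := by
  obtain ⟨i, hi, y, hy, rfl⟩ := Submodule.mem_sup.mp ha
  obtain ⟨b, rfl⟩ := Ideal.mem_span_singleton'.mp hy
  exact ⟨i, hi, b, by rw [mul_comm]⟩

theorem vanish_sup {N : Type*} [AddCommGroup N] [Module k N] {f : A →ₗ[k] N}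
    (h : ∀ a ∈ I, f a = 0) (h' : ∀ a, f (t * a) = 0) : ∀ a ∈ I ⊔ Ideal.span {t}, f a = 0 := by
  intro a ha
  obtain ⟨i, hi, b, rfl⟩ := mem_sup_span_singleton ha
  rw [map_add, h i hi, h', add_zero]

theorem StepData.cocycle_stepFam (hs : StepData ε I t d' l X) (hM : IsModel ε I deg M)
    (g : ℕ × Fin 2 × Γ) : d ε (stepFam (prep X) (form l) M g) = 0 := by
  have h1 : prep X ∈ Cocycles ε := hs.X_cocycle
  have h2 : form l ∈ Cocycles ε := hs.l_cocycle
  exact mul_mem (mul_mem (pow_mem h1 _) (pow_mem h2 _))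
    (show M g.2.2 ∈ Cocycles ε from hM.cocycle _)

/-- The periodic resolution of A/J over A/I is unwound one period at a time. Each integration lowers
the degree by one, so after multiplication by t and then t^{d-1} one has a cocycle for A/J two
degrees lower, to which strong induction on the degree bound applies. The remaining work is to
correct the primitives by l, X and G until the last one vanishes on J. -/
theorem StepData.span_step (hs : StepData ε I t d' l X) (hM : IsModel ε I deg M) (q : ℕ) :
    ∀ z : A →ₗ[k] Cochains k A, (∀ a ∈ I ⊔ Ideal.span {t}, z a = 0) → twD ε z = 0 →
    (∀ a, z a ∈ degLT k A q) → ∃ (c : ℕ × Fin 2 × Γ →₀ k) (f : A →ₗ[k] Cochains k A),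
      (∀ γ ∈ c.support, stepDeg deg γ < q) ∧ (∀ a ∈ I ⊔ Ideal.span {t}, f a = 0) ∧
      (∀ a, f a ∈ degLT k A (q - 1)) ∧
      z = cst ε (Finsupp.linearCombination k (stepFam (prep X) (form l) M) c) + twD ε f := by
  induction q using Nat.strong_induction_on with
  | _ q ih =>
  intro z hz hzD hzq
  rcases Nat.eq_zero_or_pos q with rfl | hq0
  · refine ⟨0, 0, by simp, by simp, fun a => zero_mem _, ?_⟩
    ext1 a
    simpa [degLT_zero] using hzq a
  have hIJ : I ≤ I ⊔ Ideal.span {t} := le_sup_left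
  have htJ : t ∈ I ⊔ Ideal.span {t} :=
    (le_sup_right : Ideal.span {t} ≤ _) (Ideal.mem_span_singleton_self t)
  have hd := hs.two_le
  have htd : t ^ (d' - 1) * t = t ^ d' := by rw [← pow_succ, Nat.sub_add_cancel (by omega)]
  have htd' : t * t ^ (d' - 1) = t ^ d' := by rw [mul_comm, htd]
  -- First integration over A/I. Since `z` vanishes on J and constants are killed by t, the product
  -- of t with the primitive `f` is again a cocycle.
  obtain ⟨c₀, f, hc₀, hfI, hfq, hzf⟩ := hM.span q z (fun a ha => hz a (hIJ ha)) hzD hzq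
  have hf1 : twD ε (act t f) = 0 := by
    have : twD ε f = z - cst ε (Finsupp.linearCombination k M c₀) := by rw [hzf]; abel
    rw [twD_act, this, map_sub, act_cst ε hs.aug_eq_zero, sub_zero]
    ext1 a
    exact hz _ (Ideal.mul_mem_right a _ htJ)
  obtain ⟨c₁, g, hc₁, hgI, hgq, hg⟩ := hM.span (q - 1) (act t f)
    (fun a ha => hfI _ (I.mul_mem_left t ha)) hf1 (fun a => hfq _)
  have hw1 : ∀ a ∈ I ⊔ Ideal.span {t}, act (t ^ (d' - 1)) g a = 0 := by
    refine vanish_sup (fun a ha => hgI _ (I.mul_mem_left _ ha)) fun a => ?_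
    rw [act_apply, ← mul_assoc, htd]
    exact hgI _ (I.mul_mem_right _ hs.gen_pow_mem)
  have hε : ε (t ^ (d' - 1)) = 0 := by
    rw [map_pow, hs.aug_eq_zero, zero_pow (by omega)]
  have hw2 : twD ε (act (t ^ (d' - 1)) g) = 0 := by
    have : twD ε g = act t f - cst ε (Finsupp.linearCombination k M c₁) := by rw [hg]; abel
    rw [twD_act, this, map_sub, act_cst ε hε, sub_zero]
    ext1 a
    rw [act_apply, act_apply, ← mul_assoc, htd']
    exact hfI _ (I.mul_mem_right _ hs.gen_pow_mem)
  -- The product of t^{d-1} with the second primitive vanishes on J, because t^d lies in I. It is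
  -- therefore a cocycle for A/J itself, and the induction hypothesis applies.
  obtain ⟨c₂, h, hc₂, hhJ, hhq, hh⟩ := ih (q - 1 - 1) (by omega) _ hw1 hw2 (fun a => hgq _)
  obtain ⟨G, u, hu, hGI, hG, hGX⟩ := hs.X_mul
  obtain ⟨ψ₁, hψ₁I, hψ₁⟩ := hs.div_pow
  obtain ⟨ψ₂, hψ₂I, hψ₂⟩ := hs.div
  set μ₁ := Finsupp.linearCombination k M c₁ with hμ₁
  -- The factor u⁻¹ compensates the constant in G(t^{d-1} a) = u ε(a).
  set ν := u⁻¹ • Finsupp.linearCombination k (stepFam (prep X) (form l) M) c₂ with hν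
  have hμ₁D : d ε μ₁ = 0 := hM.cocycle_linearCombination c₁
  have hνD : d ε ν = 0 := by
    rw [hν, map_smul, Finsupp.linearCombination_apply, Finsupp.sum, map_sum,
      Finset.sum_eq_zero fun γ _ => by rw [map_smul, hs.cocycle_stepFam hM, smul_zero], smul_zero]
  have hμ₁q : μ₁ ∈ degLT k A (q - 1) := by
    have h1 : μ₁ = act t f 1 - twD ε g 1 := by rw [hg]; simp
    rw [h1]
    exact sub_mem (hfq _) (twD_mem_degLT ε hgq 1)
  have hνq : ν ∈ degLT k A (q - 1 - 1) := by
    refine Submodule.smul_mem _ _ ?_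
    have h1 : Finsupp.linearCombination k (stepFam (prep X) (form l) M) c₂ =
      act (t ^ (d' - 1)) g 1 - twD ε h 1 := by rw [hh]; simp
    rw [h1]
    exact sub_mem (hgq _) (twD_mem_degLT ε hhq 1)
  have hXνq : ∀ a, rmul ν X a ∈ degLT k A (q - 1) := by
    intro a
    obtain ⟨φ, hφ⟩ := hs.X_deg a
    rw [rmul_apply, hφ]
    -- With truncated subtraction, `q - 1 - 1 + 1 = q - 1` needs `q > 1`. In the remaining case `ν`
    -- has degree below 0 and is zero.
    rcases Nat.eq_zero_or_pos (q - 1) with h0 | h0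
    · have h1 : ν = 0 := by
        rw [h0, Nat.zero_sub, degLT_zero] at hνq
        exact (Submodule.mem_bot k).mp hνq
      rw [h1, mul_zero]
      exact zero_mem _
    · have := form_mul_mem_degLT φ hνq
      rwa [Nat.sub_add_cancel h0] at this
  -- the corrected primitives
  let g' := g - rmul ν (scal G)
  let f₁ := f - rmul μ₁ (scal l) - rmul ν X
  have hg'I : ∀ a ∈ I, g' a = 0 := fun a ha => by simp [g', hgI a ha, hGI a ha]
  have hg'q : ∀ a, g' a ∈ degLT k A (q - 1 - 1) := fun a => by
    refine sub_mem (hgq a) ?_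
    rw [rmul_apply, scal_apply, Algebra.algebraMap_eq_smul_one, smul_mul_assoc, one_mul]
    exact Submodule.smul_mem _ _ hνq
  have hg'h : act (t ^ (d' - 1)) g' = twD ε h := by
    have h1 : act (t ^ (d' - 1)) (rmul ν (scal G)) = cst ε (u • ν) := by
      ext1 a
      rw [act_apply, rmul_apply, scal_apply, hG, Algebra.algebraMap_eq_smul_one, smul_mul_assoc,
        one_mul, cst_apply, mul_comm u, mul_smul]
    rw [map_sub, hh, h1, hν, smul_inv_smul₀ hu]
    abel
  have hf₁I : ∀ a ∈ I, f₁ a = 0 := fun a ha => by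
    simp [f₁, hfI a ha, hs.l_vanish a ha, hs.X_vanish a ha]
  have hf₁q : ∀ a, f₁ a ∈ degLT k A (q - 1) := fun a => by
    refine sub_mem (sub_mem (hfq a) ?_) (hXνq a)
    rw [rmul_apply, scal_apply, Algebra.algebraMap_eq_smul_one, smul_mul_assoc, one_mul]
    exact Submodule.smul_mem _ _ hμ₁q
  have hf₁g' : act t f₁ = twD ε g' := by
    have h1 : act t (rmul μ₁ (scal l)) = cst ε μ₁ := by
      ext1 a
      rw [act_apply, rmul_apply, scal_apply, hs.l_mul, Algebra.algebraMap_eq_smul_one,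
        smul_mul_assoc, one_mul, cst_apply]
    have h2 : act t (rmul ν X) = twD ε (rmul ν (scal G)) := by
      rw [twD_rmul ε hνD, ← hGX]
      rfl
    rw [map_sub, map_sub, hg, h1, h2, map_sub]
    abel
  -- division
  let h' := h ∘ₗ ψ₁
  have hh'I : ∀ a ∈ I, h' a = 0 := fun a ha => hhJ _ (hψ₁I a ha)
  have hh'q : ∀ a, h' a ∈ degLT k A (q - 1 - 1 - 1) := fun a => hhq _
  have hh' : act (t ^ (d' - 1)) h' = h := by
    ext1 a
    have := hhJ _ (hψ₁ a)
    rw [map_sub, sub_eq_zero] at this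
    exact this
  let k₁ := g' - twD ε h'
  have hk₁I : ∀ a ∈ I, k₁ a = 0 := fun a ha => by
    simp [k₁, hg'I a ha, twD_vanish ε hh'I a ha]
  have hk₁q : ∀ a, k₁ a ∈ degLT k A (q - 1 - 1) := fun a =>
    sub_mem (hg'q a) (twD_mem_degLT ε hh'q a)
  have hk₁t : act (t ^ (d' - 1)) k₁ = 0 := by
    rw [map_sub, ← twD_act, hh', hg'h, sub_self]
  -- As `k₁` is killed by t^{d-1} and vanishes on I, it factors through division by t, so t h'' =
  -- k₁.
  let h'' := k₁ ∘ₗ ψ₂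
  have hh''I : ∀ a ∈ I, h'' a = 0 := fun a ha => hk₁I _ (hψ₂I a ha)
  have hh''q : ∀ a, h'' a ∈ degLT k A (q - 1 - 1) := fun a => hk₁q _
  have hh'' : act t h'' = k₁ := by
    ext1 a
    have h1 := vanish_sup hk₁I (DFunLike.congr_fun hk₁t) _ (hψ₂ a)
    rw [map_sub, sub_eq_zero] at h1
    exact h1
  -- Subtracting D h'' changes t f₁ = D g' by D k₁ = D g'. The result is killed by t, hence vanishes
  -- on J, and differs from `f₁` by a coboundary.
  let f₂ := f₁ - twD ε h''
  have hf₂I : ∀ a ∈ I, f₂ a = 0 := fun a ha => by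
    simp [f₂, hf₁I a ha, twD_vanish ε hh''I a ha]
  have hf₂t : act t f₂ = 0 := by
    have h1 : twD ε k₁ = twD ε g' := by rw [map_sub, twD_twD, sub_zero]
    rw [map_sub, ← twD_act, hh'', hf₁g', h1, sub_self]
  refine ⟨c₀.mapDomain (fun γ => (0, 0, γ)) + c₁.mapDomain (fun γ => (0, 1, γ)) +
    (u⁻¹ • c₂).mapDomain (fun g => (g.1 + 1, g.2)), f₂, ?_, ?_, ?_, ?_⟩
  · classical
    intro γ hγ
    rcases Finset.mem_union.mp (Finsupp.support_add hγ) with h1 | h1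
    · rcases Finset.mem_union.mp (Finsupp.support_add h1) with h2 | h2
      · obtain ⟨γ', h3, rfl⟩ := Finset.mem_image.mp (Finsupp.mapDomain_support h2)
        have := hc₀ _ h3
        simpa [stepDeg] using this
      · obtain ⟨γ', h3, rfl⟩ := Finset.mem_image.mp (Finsupp.mapDomain_support h2)
        have := hc₁ _ h3
        simp only [stepDeg, Fin.val_one]
        omega
    · obtain ⟨γ', h3, rfl⟩ := Finset.mem_image.mp (Finsupp.mapDomain_support h1)
      have := hc₂ _ (Finsupp.support_smul h3)
      simp only [stepDeg] at this ⊢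
      omega
  · exact vanish_sup hf₂I fun a => DFunLike.congr_fun hf₂t a
  · exact fun a => sub_mem (hf₁q a) (twD_mem_degLT ε hh''q a)
  · have h1 : twD ε (scal l) = cst ε (form l) := by
      have := twD_of_d_prep ε (g := scal l) (by rw [prep_scal, hs.l_cocycle])
      rwa [prep_scal] at this
    have h2 := twD_of_d_prep ε hs.X_cocycle
    rw [stepFam_combination, map_smul, ← hν, hzf, map_sub, map_sub, map_sub, twD_twD,
      twD_rmul ε hμ₁D, twD_rmul ε hνD, h1, h2, rmul_cst, rmul_cst, map_add, map_add]
    abel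

/-- The same periodicity is read as a test: a relation over A/J first forces the coefficients
without x and λ to vanish, then those of λ, and finally becomes a relation for the coefficients of
the multiples of x. The induction is on a bound for the exponent of x. -/
theorem StepData.indep_step (hs : StepData ε I t d' l X) (hM : IsModel ε I deg M) (N : ℕ) :
    ∀ (c : ℕ × Fin 2 × Γ →₀ k), (∀ g, N ≤ g.1 → c g = 0) → ∀ f : A →ₗ[k] Cochains k A,
      (∀ a ∈ I ⊔ Ideal.span {t}, f a = 0) →
    cst ε (Finsupp.linearCombination k (stepFam (prep X) (form l) M) c) = twD ε f → c = 0 := by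
  induction N with
  | zero => exact fun c hc _ _ _ => Finsupp.ext fun g => hc g (Nat.zero_le _)
  | succ N ih =>
  intro c hc f hf hcf
  have hIJ : I ≤ I ⊔ Ideal.span {t} := le_sup_left
  have htJ : t ∈ I ⊔ Ideal.span {t} :=
    (le_sup_right : Ideal.span {t} ≤ _) (Ideal.mem_span_singleton_self t)
  have hd := hs.two_le
  have htd : t ^ (d' - 1) * t = t ^ d' := by rw [← pow_succ, Nat.sub_add_cancel (by omega)]
  have htd' : t * t ^ (d' - 1) = t ^ d' := by rw [mul_comm, htd]
  have hε : ε (t ^ (d' - 1)) = 0 := by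
    rw [map_pow, hs.aug_eq_zero, zero_pow (by omega)]
  obtain ⟨G, u, hu, hGI, hG, hGX⟩ := hs.X_mul
  obtain ⟨c₀, c₁, c₂, hcc, hc₂⟩ := exists_stepFam_decomposition c
  rw [hcc, stepFam_combination, map_add, map_add] at hcf
  set μ₁ := Finsupp.linearCombination k M c₁ with hμ₁
  set ν := Finsupp.linearCombination k (stepFam (prep X) (form l) M) c₂ with hν
  have hμ₁D : d ε μ₁ = 0 := hM.cocycle_linearCombination c₁
  have hνD : d ε ν = 0 := by
    rw [hν, Finsupp.linearCombination_apply, Finsupp.sum, map_sum,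
      Finset.sum_eq_zero fun γ _ => by rw [map_smul, hs.cocycle_stepFam hM, smul_zero]]
  have h1 : twD ε (rmul μ₁ (scal l)) = cst ε (form l * μ₁) := by
    have := twD_of_d_prep ε (g := scal l) (by rw [prep_scal, hs.l_cocycle])
    rw [twD_rmul ε hμ₁D, this, prep_scal, rmul_cst]
  have h2 : twD ε (rmul ν X) = cst ε (prep X * ν) := by
    rw [twD_rmul ε hνD, twD_of_d_prep ε hs.X_cocycle, rmul_cst]
  -- Subtracting primitives of l μ₁ and x ν over A/I leaves a primitive of the part from A/I alone,
  -- where independence is known.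
  let F := f - rmul μ₁ (scal l) - rmul ν X
  have hFI : ∀ a ∈ I, F a = 0 := fun a ha => by
    simp [F, hf a (hIJ ha), hs.l_vanish a ha, hs.X_vanish a ha]
  have hc₀ : c₀ = 0 := by
    refine hM.indep c₀ F hFI ?_
    rw [map_sub, map_sub, h1, h2, ← hcf]
    abel
  have hFD : twD ε F = 0 := by
    rw [map_sub, map_sub, h1, h2, ← hcf, hc₀, map_zero, map_zero]
    abel
  obtain ⟨q, hq⟩ := exists_degLT F
  obtain ⟨cρ, g, -, hgI, -, hFg⟩ := hM.span q F hFI hFD hq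
  -- Multiplication by t kills `f`, turns l into `ε` and X into D G.
  have h3 : act t F = -(cst ε μ₁ + twD ε (rmul ν (scal G))) := by
    have h4 : act t f = 0 := by
      ext1 a
      exact hf _ (Ideal.mul_mem_right a _ htJ)
    have h5 : act t (rmul μ₁ (scal l)) = cst ε μ₁ := by
      ext1 a
      rw [act_apply, rmul_apply, scal_apply, hs.l_mul, Algebra.algebraMap_eq_smul_one,
        smul_mul_assoc, one_mul, cst_apply]
    have h6 : act t (rmul ν X) = twD ε (rmul ν (scal G)) := by
      rw [twD_rmul ε hνD, ← hGX]
      rfl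
    rw [map_sub, map_sub, h4, h5, h6]
    abel
  -- Comparing two expressions for t F shows that cst μ₁ = -D g₁, so the coefficients of λ vanish
  -- and g₁ is a cocycle.
  let g₁ := act t g + rmul ν (scal G)
  have hg₁I : ∀ a ∈ I, g₁ a = 0 := fun a ha => by
    simp [g₁, hGI a ha, hgI _ (I.mul_mem_left t ha)]
  have hg₁D : cst ε μ₁ = -twD ε g₁ := by
    rw [hFg, map_add, act_cst ε hs.aug_eq_zero, zero_add, ← twD_act] at h3
    rw [map_add, h3]
    abel
  have hc₁ : c₁ = 0 := by
    refine hM.indep c₁ (-g₁) (fun a ha => by simp [hg₁I a ha]) ?_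
    rw [map_neg, ← hg₁D]
  have hg₁D' : twD ε g₁ = 0 := by
    rw [hμ₁, hc₁, map_zero, map_zero] at hg₁D
    exact neg_eq_zero.mp hg₁D.symm
  obtain ⟨q', hq'⟩ := exists_degLT g₁
  obtain ⟨cσ, h, -, hhI, -, hgh⟩ := hM.span q' g₁ hg₁I hg₁D' hq'
  -- In t^{d-1} g₁ the summand t^d g vanishes, and G contributes u ε. Thus u ν bounds a map that
  -- vanishes on J.
  have h7 : cst ε (u • ν) = twD ε (act (t ^ (d' - 1)) h) := by
    have h8 : act (t ^ (d' - 1)) g₁ = cst ε (u • ν) := by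
      ext1 a
      have : g (t * (t ^ (d' - 1) * a)) = 0 := by
        rw [← mul_assoc, htd']
        exact hgI _ (I.mul_mem_right _ hs.gen_pow_mem)
      simp only [g₁, act_apply, LinearMap.add_apply, rmul_apply, scal_apply, hG, cst_apply]
      rw [this, zero_add, Algebra.algebraMap_eq_smul_one, smul_mul_assoc, one_mul, mul_comm u,
        mul_smul]
    rw [← h8, hgh, map_add, act_cst ε hε, zero_add, twD_act]
  have hc₂' : u • c₂ = 0 := by
    refine ih (u • c₂) (fun g hg => ?_) (act (t ^ (d' - 1)) h) ?_ ?_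
    · rw [Finsupp.smul_apply, hc₂, hc _ (Nat.succ_le_succ hg), smul_zero]
    · refine vanish_sup (fun a ha => hhI _ (I.mul_mem_left _ ha)) fun a => ?_
      rw [act_apply, ← mul_assoc, htd]
      exact hhI _ (I.mul_mem_right _ hs.gen_pow_mem)
    · rw [map_smul, ← hν, h7]
  have hc₂'' : c₂ = 0 := (smul_eq_zero_iff_right hu).mp hc₂'
  rw [hcc, hc₀, hc₁, hc₂'']
  simp

/-- Adjoining a generator to the ideal. -/
theorem IsModel.step (hM : IsModel ε I deg M) (hs : StepData ε I t d' l X) :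
    IsModel ε (I ⊔ Ideal.span {t}) (stepDeg deg) (stepFam (prep X) (form l) M) where
  cocycle := hs.cocycle_stepFam hM
  span q z := hs.span_step hM q z
  indep c f h h' := by
    refine hs.indep_step hM (c.support.sup Prod.fst + 1) c (fun g hg => ?_) f h h'
    by_contra hne
    have := Finset.le_sup (f := Prod.fst) (Finsupp.mem_support_iff.mpr hne)
    omega

end Step

end Model

end SupergroupAlgebra

end

noncomputable section

namespace SupergroupAlgebra

/-! ### Iteration over a chain of ideals and passage to cohomology classes. -/

section Tower

variable {k : Type u} {A : Type v} [Field k] [CommRing A] [Algebra k A] [Module.Finite k A]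
  {ε : A →ₐ[k] k}

theorem prep_form_comp (B : A →ₗ[k] A →ₗ[k] k) : prep (form ∘ₗ B) = biform B := by
  rw [prep_apply]
  simp only [LinearMap.comp_apply, form_mul_form]
  rw [← map_sum]
  congr 1
  refine (stdBasis k A).ext fun i => ?_
  ext b
  rw [LinearMap.sum_apply, Finset.sum_eq_single i]
  · simp
  · intro j _ hj
    ext c
    simp [hj.symm]
  · simp

/-- The ordered product of the `x_i^{a_i} λ_i^{e_i}`. -/
def orderedProd {R : Type*} [Monoid R] {r : ℕ} (x l : Fin r → R) (γ : Fin r → ℕ × Fin 2) : R :=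
  (List.ofFn fun i => x i ^ (γ i).1 * l i ^ ((γ i).2 : ℕ)).prod

theorem orderedProd_zero {R : Type*} [Monoid R] (x l : Fin 0 → R) (γ : Fin 0 → ℕ × Fin 2) :
    orderedProd x l γ = 1 := by
  simp [orderedProd]

theorem orderedProd_succ {R : Type*} [Monoid R] {r : ℕ} (x l : Fin (r + 1) → R)
    (γ : Fin (r + 1) → ℕ × Fin 2) : orderedProd x l γ =
      x 0 ^ (γ 0).1 * l 0 ^ ((γ 0).2 : ℕ) *
        orderedProd (Fin.tail x) (Fin.tail l) (Fin.tail γ) := by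
  simp [orderedProd, List.ofFn_succ, Fin.tail]

theorem map_orderedProd {R S F : Type*} [Monoid R] [Monoid S] [FunLike F R S]
    [MonoidHomClass F R S] (f : F) {r : ℕ} (x l : Fin r → R) (γ : Fin r → ℕ × Fin 2) :
    f (orderedProd x l γ) = orderedProd (f ∘ x) (f ∘ l) γ := by
  simp [orderedProd, map_list_prod, List.map_ofFn, Function.comp_def]

/-- Each step multiplies the previous basis on the left by x^a λ^e, so the generator adjoined last
stands first. The indices decrease along the chain from the zero ideal, which makes the products
ordered by index. -/
theorem isModel_orderedProd {r : ℕ} (I : Fin (r + 1) → Ideal A) (t : Fin r → A) (δ : Fin r → ℕ)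
    (l : Fin r → A →ₗ[k] k) (X : Fin r → A →ₗ[k] Cochains k A) (hI : I (Fin.last r) = ⊥)
    (hIt : ∀ i : Fin r, I i.castSucc = I i.succ ⊔ Ideal.span {t i})
    (h : ∀ i : Fin r, StepData ε (I i.succ) (t i) (δ i) (l i) (X i)) :
    IsModel ε (I 0) (fun γ : Fin r → ℕ × Fin 2 => ∑ i, (2 * (γ i).1 + ((γ i).2 : ℕ)))
      (orderedProd (fun i => prep (X i)) (fun i => form (l i))) := by
  induction r with
  | zero =>
    change I 0 = ⊥ at hI
    rw [hI]
    exact isModel_bot.reindex (Equiv.ofUnique _ _) (fun γ => by simp)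
      (fun γ => orderedProd_zero _ _ _)
  | succ r ih =>
    have h1 := ih (Fin.tail I) (Fin.tail t) (Fin.tail δ) (Fin.tail l) (Fin.tail X) hI
      (fun i => hIt i.succ) (fun i => h i.succ)
    have h2 := h1.step (h 0)
    have h3 := hIt 0
    rw [Fin.castSucc_zero] at h3
    rw [h3]
    refine h2.reindex (((Fin.consEquiv fun _ => ℕ × Fin 2).symm).trans
      (Equiv.prodAssoc _ _ _)) (fun γ => ?_) (fun γ => ?_)
    · rw [Fin.sum_univ_succ]
      rfl
    · rw [orderedProd_succ]
      rfl

/-- A cocycle of `Cochains k A` has a class. -/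
def classOf (z : Cochains k A) (hz : d ε z = 0) : ExtAlg ε := cls ε ⟨z, hz⟩

theorem classOf_eq_zero_iff {z : Cochains k A} (hz : d ε z = 0) :
    classOf z hz = 0 ↔ ∃ w, d ε w = z := by
  change Ideal.Quotient.mk (Coboundaries ε) _ = 0 ↔ _
  rw [Ideal.Quotient.eq_zero_iff_mem]
  rfl

theorem exists_classOf (h : ExtAlg ε) : ∃ z hz, h = classOf z hz := by
  obtain ⟨⟨z, hz⟩, rfl⟩ := Ideal.Quotient.mk_surjective h
  exact ⟨z, hz, rfl⟩

namespace IsModel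

variable {Γ : Type*} {deg : Γ → ℕ} {M : Γ → Cochains k A}

/-- Maps that vanish on ker ε are determined by their value at 1. A model for this ideal is
therefore a statement about the bar complex itself. -/
theorem exists_eq_add_d (hM : IsModel ε (RingHom.ker ε) deg M) {q : ℕ} {z : Cochains k A}
    (hz : d ε z = 0) (hq : z ∈ degLT k A q) : ∃ (c : Γ →₀ k) (w : Cochains k A),
      (∀ γ ∈ c.support, deg γ < q) ∧ z = Finsupp.linearCombination k M c + d ε w := by
  obtain ⟨c, f, hc, hf, -, h⟩ := hM.span q (cst ε z)
    (fun a ha => by rw [cst_apply, (RingHom.mem_ker).mp ha, zero_smul])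
    (by rw [twD_cst, hz, map_zero]) (fun a => Submodule.smul_mem _ _ hq)
  refine ⟨c, f 1, hc, cst_injective ε ?_⟩
  have hf' : f = cst ε (f 1) := by
    ext1 a
    have := hf (a - algebraMap k A (ε a)) (by simp [RingHom.mem_ker])
    rw [map_sub, sub_eq_zero] at this
    rw [this, cst_apply, Algebra.algebraMap_eq_smul_one, map_smul]
  rw [map_add, ← twD_cst, ← hf', ← h]

theorem eq_zero_of_eq_d (hM : IsModel ε (RingHom.ker ε) deg M) {c : Γ →₀ k} {w : Cochains k A}
    (h : Finsupp.linearCombination k M c = d ε w) : c = 0 :=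
  hM.indep c (cst ε w)
    (fun a ha => by rw [cst_apply, (RingHom.mem_ker).mp ha, zero_smul])
    (by rw [h, twD_cst])

theorem classOf_linearCombination (hM : IsModel ε (RingHom.ker ε) deg M) (c : Γ →₀ k) :
    classOf (Finsupp.linearCombination k M c) (hM.cocycle_linearCombination c) =
      Finsupp.linearCombination k (fun γ => classOf (M γ) (hM.cocycle γ)) c := by
  have h : (⟨Finsupp.linearCombination k M c, hM.cocycle_linearCombination c⟩ : Cocycles ε) =
      Finsupp.linearCombination k (fun γ => (⟨M γ, hM.cocycle γ⟩ : Cocycles ε)) c := by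
    apply Subtype.ext
    change Finsupp.linearCombination k M c = (Cocycles ε).val _
    rw [Finsupp.linearCombination_apply, Finsupp.linearCombination_apply, Finsupp.sum,
      Finsupp.sum, map_sum]
    rfl
  rw [classOf, h, Finsupp.linearCombination_apply, Finsupp.linearCombination_apply, Finsupp.sum,
    Finsupp.sum, map_sum]
  simp only [map_smul]
  rfl

/-- The degree bound on the coefficients is what later confines a class of degree 2 to finitely many
kinds of monomials. -/
theorem mem_span_of_degLT (hM : IsModel ε (RingHom.ker ε) deg M) {q : ℕ} {z : Cochains k A}
    (hz : d ε z = 0) (hq : z ∈ degLT k A q) : ∃ c : Γ →₀ k, (∀ γ ∈ c.support, deg γ < q) ∧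
      classOf z hz = Finsupp.linearCombination k (fun γ => classOf (M γ) (hM.cocycle γ)) c := by
  obtain ⟨c, w, hc, h⟩ := hM.exists_eq_add_d hz hq
  refine ⟨c, hc, ?_⟩
  rw [← hM.classOf_linearCombination, ← sub_eq_zero]
  change cls ε _ - cls ε _ = 0
  rw [← map_sub]
  exact (classOf_eq_zero_iff (by rw [map_sub, hz, hM.cocycle_linearCombination, sub_zero])).mpr
    ⟨w, eq_sub_of_add_eq' h.symm⟩

theorem linearIndependent (hM : IsModel ε (RingHom.ker ε) deg M) :
    LinearIndependent k (fun γ => classOf (M γ) (hM.cocycle γ)) := by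
  rw [linearIndependent_iff]
  intro c hc
  rw [← hM.classOf_linearCombination, classOf_eq_zero_iff] at hc
  obtain ⟨w, hw⟩ := hc
  exact hM.eq_zero_of_eq_d hw.symm

theorem exists_linearCombination (hM : IsModel ε (RingHom.ker ε) deg M) (h : ExtAlg ε) :
    ∃ c : Γ →₀ k, h =
      Finsupp.linearCombination k (fun γ => classOf (M γ) (hM.cocycle γ)) c := by
  obtain ⟨z, hz, rfl⟩ := exists_classOf h
  obtain ⟨q, hq⟩ := exists_mem_degLT z
  obtain ⟨c, -, hc⟩ := hM.mem_span_of_degLT hz hq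
  exact ⟨c, hc⟩

end IsModel

end Tower

end SupergroupAlgebra

end

noncomputable section

namespace SupergroupAlgebra

/-! ### Monomial bases of the even part and of the group algebra. -/

namespace WittElementary

namespace EvenAlg

variable (k : Type u) [Field k] (p : ℕ) (m n : ℕ+)

/-- The monomials `s^α`. -/
def mon (α : Fin n → ℕ) : EvenAlg k p m n := ∏ i, s k p m n i ^ α i

/-- The exponents of nonzero monomials. -/
def Reduced (α : Fin n → ℕ) : Prop := ∀ i, α i < trunc p m n i

instance (α : Fin n → ℕ) : Decidable (Reduced p m n α) := inferInstanceAs (Decidable (∀ _, _))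

variable {k p m n}

theorem mon_zero : mon k p m n 0 = 1 := by simp [mon]

theorem mon_add (α β : Fin n → ℕ) : mon k p m n (α + β) = mon k p m n α * mon k p m n β := by
  simp [mon, pow_add, Finset.prod_mul_distrib]

theorem mon_single (i : Fin n) (r : ℕ) : mon k p m n (Pi.single i r) = s k p m n i ^ r := by
  rw [mon, Finset.prod_eq_single i]
  · simp
  · intro j _ hj
    simp [Pi.single_eq_of_ne hj]
  · simp

theorem mon_eq_zero {α : Fin n → ℕ} (h : ¬ Reduced p m n α) : mon k p m n α = 0 := by
  simp only [Reduced, not_forall, not_lt] at h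
  obtain ⟨i, hi⟩ := h
  refine Finset.prod_eq_zero (Finset.mem_univ i) ?_
  rw [← Nat.sub_add_cancel hi, pow_add, s_pow, mul_zero]

theorem mk_monomial (α : Fin n →₀ ℕ) : (Ideal.Quotient.mk _ (MvPolynomial.monomial α 1) :
    EvenAlg k p m n) = mon k p m n α := by
  rw [MvPolynomial.monomial_eq, map_mul, MvPolynomial.C_1, map_one, one_mul,
    Finsupp.prod_fintype _ _ (by simp), map_prod]
  simp only [map_pow]
  rfl

variable {N : Type*} [AddCommGroup N] [Module k N]

theorem linearMap_ext {f g : EvenAlg k p m n →ₗ[k] N}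
    (h : ∀ α, Reduced p m n α → f (mon k p m n α) = g (mon k p m n α)) : f = g := by
  have h' : ∀ α, f (mon k p m n α) = g (mon k p m n α) := by
    intro α
    by_cases hα : Reduced p m n α
    · exact h α hα
    · rw [mon_eq_zero hα, map_zero, map_zero]
  let π : MvPolynomial (Fin n) k →ₗ[k] EvenAlg k p m n := (Ideal.Quotient.mkₐ k (Ideal.span
    (Set.range fun i : Fin n => (MvPolynomial.X i : MvPolynomial (Fin n) k) ^
      trunc p m n i))).toLinearMap
  have hπ : f ∘ₗ π = g ∘ₗ π := by
    refine (MvPolynomial.basisMonomials (Fin n) k).ext fun α => ?_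
    rw [MvPolynomial.coe_basisMonomials]
    have : π (MvPolynomial.monomial α 1) = mon k p m n α := mk_monomial α
    rw [LinearMap.comp_apply, LinearMap.comp_apply, this, h']
  ext x
  obtain ⟨y, rfl⟩ := Ideal.Quotient.mk_surjective x
  exact DFunLike.congr_fun hπ y

/-- With `linearMap_ext` this says that the reduced monomials form a basis. The prescription on
polynomials kills the ideal because a multiple of X_i^{d_i} contains only unreduced monomials. -/
theorem exists_linearMap (v : (Fin n → ℕ) → N) : ∃ f : EvenAlg k p m n →ₗ[k] N,
    ∀ α, f (mon k p m n α) = if Reduced p m n α then v α else 0 := by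
  let I : Ideal (MvPolynomial (Fin n) k) := Ideal.span
    (Set.range fun i : Fin n => (MvPolynomial.X i : MvPolynomial (Fin n) k) ^ trunc p m n i)
  let F : MvPolynomial (Fin n) k →ₗ[k] N := (MvPolynomial.basisMonomials (Fin n) k).constr k
    fun α => if Reduced p m n α then v α else 0
  have hF : ∀ α : Fin n →₀ ℕ, F (MvPolynomial.monomial α 1) =
      if Reduced p m n α then v α else 0 := by
    intro α
    have := (MvPolynomial.basisMonomials (Fin n) k).constr_basis k
      (fun α : Fin n →₀ ℕ => if Reduced p m n α then v α else 0) α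
    rwa [MvPolynomial.coe_basisMonomials] at this
  have hI : ∀ x ∈ I, ∀ g, F (g * x) = 0 := by
    intro x hx
    induction hx using Submodule.span_induction with
    | mem x hx =>
      obtain ⟨i, rfl⟩ := hx
      intro g
      have : F ∘ₗ LinearMap.mulRight k ((MvPolynomial.X i : MvPolynomial (Fin n) k) ^
          trunc p m n i) = 0 := by
        refine (MvPolynomial.basisMonomials (Fin n) k).ext fun α => ?_
        rw [MvPolynomial.coe_basisMonomials, LinearMap.comp_apply, LinearMap.mulRight_apply,
          MvPolynomial.X_pow_eq_monomial, MvPolynomial.monomial_mul, one_mul, hF, if_neg]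
        · rfl
        · intro h
          have := h i
          simp at this
      exact DFunLike.congr_fun this g
    | zero => simp
    | add x y _ _ hx hy => intro g; rw [mul_add, map_add, hx, hy, add_zero]
    | smul a x _ hx => intro g; rw [smul_eq_mul, ← mul_assoc, hx]
  let f : EvenAlg k p m n →ₗ[k] N := (Submodule.liftQ (I.restrictScalars k) F
    (fun x hx => by simpa using hI x hx 1)) ∘ₗ
      (Submodule.Quotient.restrictScalarsEquiv k I).symm.toLinearMap
  have hf : ∀ x, f (Ideal.Quotient.mk _ x) = F x := fun x => rfl
  refine ⟨f, fun α => ?_⟩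
  have h1 := mk_monomial (k := k) (p := p) (m := m) (Finsupp.equivFunOnFinite.symm α)
  rw [Finsupp.coe_equivFunOnFinite_symm] at h1
  rw [← h1, hf, hF, Finsupp.coe_equivFunOnFinite_symm]

end EvenAlg

namespace GroupAlg

open SupergroupAlgebra.WittElementary.EvenAlg (top Reduced)

variable (k : Type u) [Field k] (p : ℕ) (m n : ℕ+)

/-- The monomials `s^α σ^e`. -/
def mon (α : Fin n → ℕ) (e : Fin 2) : GroupAlg k p m n :=
  if e = 0 then ev k p m n (EvenAlg.mon k p m n α) else od k p m n (EvenAlg.mon k p m n α)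

/-- The exponents of the even generators that arise from `σ^e σ^f`. -/
def carry (e f : Fin 2) : Fin n → ℕ := if e = 1 ∧ f = 1 then Pi.single (top n) p else 0

variable {k p m n}

theorem mon_even (α : Fin n → ℕ) : mon k p m n α 0 = ev k p m n (EvenAlg.mon k p m n α) := rfl

theorem mon_odd (α : Fin n → ℕ) : mon k p m n α 1 = od k p m n (EvenAlg.mon k p m n α) := rfl

theorem mon_zero : mon k p m n 0 0 = 1 := by rw [mon_even, EvenAlg.mon_zero, ev_one]

theorem mon_eq_zero {α : Fin n → ℕ} (h : ¬ Reduced p m n α) (e : Fin 2) :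
    mon k p m n α e = 0 := by
  simp [mon, EvenAlg.mon_eq_zero h]

/-- Exponent vectors stay untruncated: the relation σ² = s_n^p appears as a carry, and unreduced
exponents give zero automatically. Products can thus be compared by comparing exponents. -/
theorem mon_mul_mon (α β : Fin n → ℕ) (e f : Fin 2) : mon k p m n α e * mon k p m n β f =
    mon k p m n (α + β + carry p n e f) (e + f) := by
  have he : e = 0 ∨ e = 1 := by omega
  have hf : f = 0 ∨ f = 1 := by omega
  rcases he with rfl | rfl <;> rcases hf with rfl | rfl
  · simp [carry, mon_even, ev_mul_ev, EvenAlg.mon_add]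
  · simp [carry, mon_even, mon_odd, ev_mul_od, EvenAlg.mon_add]
  · simp [carry, mon_even, mon_odd, od_mul_ev, EvenAlg.mon_add]
  · have : (1 + 1 : Fin 2) = 0 := rfl
    rw [this, mon_even, mon_odd, mon_odd, od_mul_od, carry, if_pos ⟨rfl, rfl⟩, EvenAlg.mon_add,
      EvenAlg.mon_add, EvenAlg.mon_single, mul_comm]

theorem s_pow_eq_mon (i : Fin n) (r : ℕ) : s k p m n i ^ r = mon k p m n (Pi.single i r) 0 := by
  rw [mon_even, EvenAlg.mon_single]
  induction r with
  | zero => simp [ev_one]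
  | succ r ih => rw [pow_succ, ih, s, ev_mul_ev, pow_succ]

theorem σ_eq_mon : σ k p m n = mon k p m n 0 1 := by
  rw [mon_odd, EvenAlg.mon_zero]
  rfl

theorem s_pow_mul_mon (i : Fin n) (r : ℕ) (α : Fin n → ℕ) (e : Fin 2) :
    s k p m n i ^ r * mon k p m n α e = mon k p m n (α + Pi.single i r) e := by
  rw [s_pow_eq_mon, mon_mul_mon, zero_add]
  simp [carry, add_comm]

theorem s_mul_mon (i : Fin n) (α : Fin n → ℕ) (e : Fin 2) :
    s k p m n i * mon k p m n α e = mon k p m n (α + Pi.single i 1) e := by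
  rw [← s_pow_mul_mon, pow_one]

theorem s_pow_trunc (i : Fin n) : s k p m n i ^ trunc p m n i = 0 := by
  rw [s_pow_eq_mon, mon_eq_zero]
  intro h
  simpa using h i

variable {N : Type*} [AddCommGroup N] [Module k N]

theorem linearMap_ext {f g : GroupAlg k p m n →ₗ[k] N}
    (h : ∀ α e, Reduced p m n α → f (mon k p m n α e) = g (mon k p m n α e)) : f = g := by
  have h0 : f ∘ₗ ev k p m n = g ∘ₗ ev k p m n := EvenAlg.linearMap_ext fun α hα => h α 0 hα
  have h1 : f ∘ₗ od k p m n = g ∘ₗ od k p m n := EvenAlg.linearMap_ext fun α hα => h α 1 hα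
  refine LinearMap.ext fun a => ?_
  rw [eq_add a, map_add, map_add]
  exact congr_arg₂ _ (DFunLike.congr_fun h0 _) (DFunLike.congr_fun h1 _)

theorem bilin_ext {f g : GroupAlg k p m n →ₗ[k] GroupAlg k p m n →ₗ[k] N}
    (h : ∀ α β e e', Reduced p m n α → Reduced p m n β →
      f (mon k p m n α e) (mon k p m n β e') = g (mon k p m n α e) (mon k p m n β e')) : f = g :=
  linearMap_ext fun α e hα => linearMap_ext fun β e' hβ => h α β e e' hα hβ

theorem mem_of_mon_mem {f : GroupAlg k p m n →ₗ[k] N} {P : Submodule k N}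
    (h : ∀ α e, Reduced p m n α → f (mon k p m n α e) ∈ P) (a : GroupAlg k p m n) : f a ∈ P := by
  have : P.mkQ ∘ₗ f = 0 := linearMap_ext fun α e hα => by
    simpa using h α e hα
  simpa using DFunLike.congr_fun this a

/-- The linear map with prescribed values on the nonzero monomials. -/
def ofMon (v : (Fin n → ℕ) → Fin 2 → N) : GroupAlg k p m n →ₗ[k] N :=
  (EvenAlg.exists_linearMap fun α => v α 0).choose ∘ₗ re k p m n +
    (EvenAlg.exists_linearMap fun α => v α 1).choose ∘ₗ im k p m n

theorem ofMon_mon (v : (Fin n → ℕ) → Fin 2 → N) (α : Fin n → ℕ) (e : Fin 2) :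
    ofMon v (mon k p m n α e) = if Reduced p m n α then v α e else 0 := by
  have he : e = 0 ∨ e = 1 := by omega
  rcases he with rfl | rfl
  · rw [mon_even, ofMon]
    simp [(EvenAlg.exists_linearMap fun α => v α 0).choose_spec]
  · rw [mon_odd, ofMon]
    simp [(EvenAlg.exists_linearMap fun α => v α 1).choose_spec]

/-- The algebra homomorphism with prescribed values on the generators. -/
def liftHom {R : Type*} [CommRing R] [Algebra k R] (v : Fin n → R)
    (hv : ∀ i, v i ^ trunc p m n i = 0) (τ : R) (hτ : τ * τ = v (top n) ^ p) :
    GroupAlg k p m n →ₐ[k] R :=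
  AlgHom.ofLinearMap ((EvenAlg.lift k p m n v hv).toLinearMap ∘ₗ re k p m n +
      LinearMap.mulRight k τ ∘ₗ (EvenAlg.lift k p m n v hv).toLinearMap ∘ₗ im k p m n)
    (by
      change EvenAlg.lift k p m n v hv 1 + EvenAlg.lift k p m n v hv 0 * τ = 1
      simp)
    (fun a b => by
      simp only [LinearMap.add_apply, LinearMap.comp_apply, re_mul, im_mul, map_add, map_mul,
        map_pow, AlgHom.toLinearMap_apply, LinearMap.mulRight_apply, zero_mul, add_zero,
        EvenAlg.lift_s, ← hτ]
      ring)

theorem liftHom_s {R : Type*} [CommRing R] [Algebra k R] (v : Fin n → R)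
    (hv : ∀ i, v i ^ trunc p m n i = 0) (τ : R) (hτ : τ * τ = v (top n) ^ p) (i : Fin n) :
    liftHom v hv τ hτ (s k p m n i) = v i := by
  simp [liftHom, s]

theorem liftHom_σ {R : Type*} [CommRing R] [Algebra k R] (v : Fin n → R)
    (hv : ∀ i, v i ^ trunc p m n i = 0) (τ : R) (hτ : τ * τ = v (top n) ^ p) :
    liftHom v hv τ hτ (σ k p m n) = τ := by
  simp [liftHom, σ]

theorem mon_eq_prod (α : Fin n → ℕ) (e : Fin 2) :
    mon k p m n α e = (∏ i, s k p m n i ^ α i) * σ k p m n ^ (e : ℕ) := by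
  let evHom : EvenAlg k p m n →* GroupAlg k p m n :=
    { toFun := ev k p m n
      map_one' := ev_one
      map_mul' := fun b c => (ev_mul_ev b c).symm }
  have h : ∏ i, s k p m n i ^ α i = ev k p m n (EvenAlg.mon k p m n α) := by
    change _ = evHom (EvenAlg.mon k p m n α)
    rw [EvenAlg.mon, map_prod]
    simp only [map_pow]
    rfl
  have he : e = 0 ∨ e = 1 := by omega
  rw [h]
  rcases he with rfl | rfl
  · simp [mon_even]
  · rw [mon_odd, Fin.val_one, pow_one, σ, ev_mul_od, mul_one]

theorem mono_eq_mon [Fact p.Prime] [CharP k p] (α : Fin n → ℕ) (e : Fin 2) :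
    mono k p n α e = mon k p 1 n α e := (mon_eq_prod α e).symm

theorem algHom_ext {R : Type*} [CommRing R] [Algebra k R] {f g : GroupAlg k p m n →ₐ[k] R}
    (h : ∀ i, f (s k p m n i) = g (s k p m n i)) (h' : f (σ k p m n) = g (σ k p m n)) : f = g := by
  have : f.toLinearMap = g.toLinearMap := linearMap_ext fun α e _ => by
    simp [mon_eq_prod, h, h']
  exact AlgHom.toLinearMap_injective this

end GroupAlg

end WittElementary

end SupergroupAlgebra

end

noncomputable section

namespace SupergroupAlgebra

/-! ### Criteria for cocycles of degree 1 and 2. -/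

section Cocycles

variable {k : Type u} {A : Type v} [Field k] [CommRing A] [Algebra k A] [Module.Finite k A]
  (ε : A →ₐ[k] k)

theorem d_form_eq (h : A →ₗ[k] k) (B : A →ₗ[k] A →ₗ[k] k)
    (hB : ∀ a b, B a b = ε a * h b + h a * ε b - h (a * b)) : d ε (form h) = biform B := by
  rw [d_form, form_mul_form, form_mul_form, ← map_neg, ← map_add, ← map_add]
  congr 1
  ext a b
  simp [hB]
  ring

theorem d_form_eq_zero {h : A →ₗ[k] k} (hh : ∀ a b, h (a * b) = ε a * h b + h a * ε b) :
    d ε (form h) = 0 := by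
  rw [d_form_eq ε h 0 (fun a b => by simp [hh]), map_zero]

/-- Apply the homotopy of `d_bilinInner` to the 1-cochain ε, whose differential is ε · ε. -/
theorem d_biform_hochschild (β : A →ₗ[k] A →ₗ[k] A)
    (hβ : ∀ a b c, a * β b c - β (a * b) c + β a (b * c) - β a b * c = 0) :
    d ε (biform (β.compr₂ ε.toLinearMap)) = 0 := by
  have h := d_bilinInner ε β hβ (form ε.toLinearMap)
  rw [d_aug, bilinInner_mul, bilinInner_form, signMap_form, map_neg] at h
  rw [← neg_eq_zero, ← sub_eq_zero.mpr h]
  noncomm_ring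

end Cocycles

namespace WittElementary

namespace GroupAlg

open SupergroupAlgebra.WittElementary.EvenAlg (top Reduced)

variable {k : Type u} [Field k] {p : ℕ} {m n : ℕ+}

theorem mon_induction {P : GroupAlg k p m n → Prop}
    (hmon : ∀ α e, Reduced p m n α → P (mon k p m n α e)) (h0 : P 0)
    (hadd : ∀ a b, P a → P b → P (a + b)) (hsmul : ∀ (c : k) a, P a → P (c • a))
    (a : GroupAlg k p m n) : P a := by
  have ha : a ∈ Submodule.span k {b | ∃ α e, Reduced p m n α ∧ mon k p m n α e = b} := by
    refine mem_of_mon_mem (f := LinearMap.id) (fun α e hα => ?_) a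
    exact Submodule.subset_span ⟨α, e, hα, rfl⟩
  induction ha using Submodule.span_induction with
  | mem x hx =>
    obtain ⟨α, e, hα, rfl⟩ := hx
    exact hmon α e hα
  | zero => exact h0
  | add x y _ _ hx hy => exact hadd x y hx hy
  | smul c x _ hx => exact hsmul c x hx

/-- Associativity of multiplication on formal exponents: carries may be collected in either order.
-/
theorem carry_assoc (e f g : Fin 2) :
    carry p n e f + carry p n (e + f) g = carry p n f g + carry p n e (f + g) := by
  have : ∀ e : Fin 2, e = 0 ∨ e = 1 := by omega
  have h2 : (1 + 1 : Fin 2) = 0 := rfl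
  rcases this e with rfl | rfl <;> rcases this f with rfl | rfl <;>
    rcases this g with rfl | rfl <;> simp [carry, h2]

/-! ### The Hochschild cocycles of the truncation relations. -/

section Chi

variable (k p m n) in
/-- The Hochschild 2-cocycle which describes how products of lifts of monomials differ from the
lift of the product, when the relation `s_i^{d_i} = 0` is dropped. -/
def chi (i : Fin n) : GroupAlg k p m n →ₗ[k] GroupAlg k p m n →ₗ[k] GroupAlg k p m n :=
  ofMon fun α e => ofMon fun β f =>
    if trunc p m n i ≤ (α + β + carry p n e f) i then
      mon k p m n (α + β + carry p n e f - Pi.single i (trunc p m n i)) (e + f) else 0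

theorem chi_mon (i : Fin n) {α β : Fin n → ℕ} (hα : Reduced p m n α) (hβ : Reduced p m n β)
    (e f : Fin 2) : chi k p m n i (mon k p m n α e) (mon k p m n β f) =
      if trunc p m n i ≤ (α + β + carry p n e f) i then
        mon k p m n (α + β + carry p n e f - Pi.single i (trunc p m n i)) (e + f) else 0 := by
  rw [chi, ofMon_mon, if_pos hα, ofMon_mon, if_pos hβ]

theorem mon_mul_ite (i : Fin n) (α γ : Fin n → ℕ) (e f : Fin 2) :
    (mon k p m n α e * if trunc p m n i ≤ γ i then
      mon k p m n (γ - Pi.single i (trunc p m n i)) f else 0) =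
    if trunc p m n i ≤ γ i then
      mon k p m n (α + γ + carry p n e f - Pi.single i (trunc p m n i)) (e + f) else 0 := by
  generalize trunc p m n i = d
  split_ifs with h
  · rw [mon_mul_mon]
    congr 1
    funext j
    have hj : (Pi.single i d : Fin n → ℕ) j ≤ γ j := by
      by_cases hj : j = i
      · subst hj; rw [Pi.single_eq_same]; exact h
      · simp [Pi.single_eq_of_ne hj]
    simp only [Pi.add_apply, Pi.sub_apply] at hj ⊢
    omega
  · rw [mul_zero]

theorem ite_mul_mon (i : Fin n) (α γ : Fin n → ℕ) (e f : Fin 2) :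
    (if trunc p m n i ≤ γ i then
      mon k p m n (γ - Pi.single i (trunc p m n i)) f else 0) * mon k p m n α e =
    if trunc p m n i ≤ γ i then
      mon k p m n (γ + α + carry p n f e - Pi.single i (trunc p m n i)) (f + e) else 0 := by
  generalize trunc p m n i = d
  split_ifs with h
  · rw [mon_mul_mon]
    congr 1
    funext j
    have hj : (Pi.single i d : Fin n → ℕ) j ≤ γ j := by
      by_cases hj : j = i
      · subst hj; rw [Pi.single_eq_same]; exact h
      · simp [Pi.single_eq_of_ne hj]
    simp only [Pi.add_apply, Pi.sub_apply] at hj ⊢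
    omega
  · rw [zero_mul]

/-- Every term is zero or ± the same monomial, with total exponent lowered by d_i at i. The outer
terms occur when an intermediate product overflows at i, and the inner ones when it is reduced;
below a surviving total exponent these conditions are complementary, so the signs cancel. -/
theorem chi_hochschild_mon (i : Fin n) {α β κ : Fin n → ℕ} (hα : Reduced p m n α)
    (hβ : Reduced p m n β) (hκ : Reduced p m n κ) (e f g : Fin 2) :
    mon k p m n α e * chi k p m n i (mon k p m n β f) (mon k p m n κ g) -
      chi k p m n i (mon k p m n α e * mon k p m n β f) (mon k p m n κ g) +
      chi k p m n i (mon k p m n α e) (mon k p m n β f * mon k p m n κ g) -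
      chi k p m n i (mon k p m n α e) (mon k p m n β f) * mon k p m n κ g = 0 := by
  rw [chi_mon i hβ hκ, chi_mon i hα hβ, mon_mul_ite, ite_mul_mon, mon_mul_mon, mon_mul_mon]
  obtain ⟨γ, hγ⟩ : ∃ γ, γ = α + β + carry p n e f := ⟨_, rfl⟩
  obtain ⟨γ', hγ'⟩ : ∃ γ', γ' = β + κ + carry p n f g := ⟨_, rfl⟩
  obtain ⟨T, hT⟩ : ∃ T, T = γ + κ + carry p n (e + f) g := ⟨_, rfl⟩
  have hT2 : α + γ' + carry p n e (f + g) = T := by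
    have h := carry_assoc (p := p) (n := n) e f g
    calc α + γ' + carry p n e (f + g) = α + β + κ + (carry p n f g + carry p n e (f + g)) := by
          rw [hγ']; abel
      _ = T := by rw [← h, hT, hγ]; abel
  have hγT : ∀ j, γ j ≤ T j := fun j => by rw [hT]; simp [add_assoc]
  have hγT' : ∀ j, γ' j ≤ T j := fun j => by
    rw [← hT2]
    simp only [Pi.add_apply]
    omega
  rw [← hγ, ← hγ', ← hT, hT2, ← add_assoc e f g]
  obtain ⟨Q, hQ⟩ : ∃ Q, Q = mon k p m n (T - Pi.single i (trunc p m n i)) (e + f + g) := ⟨_, rfl⟩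
  have e2 : chi k p m n i (mon k p m n γ (e + f)) (mon k p m n κ g) =
      if Reduced p m n γ then (if trunc p m n i ≤ T i then Q else 0) else 0 := by
    by_cases h : Reduced p m n γ
    · rw [if_pos h, chi_mon i h hκ, ← hT, hQ]
    · rw [if_neg h, mon_eq_zero h, map_zero, LinearMap.zero_apply]
  have e3 : chi k p m n i (mon k p m n α e) (mon k p m n γ' (f + g)) =
      if Reduced p m n γ' then (if trunc p m n i ≤ T i then Q else 0) else 0 := by
    by_cases h : Reduced p m n γ'
    · rw [if_pos h, chi_mon i hα h, hT2, ← add_assoc, hQ]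
    · rw [if_neg h, mon_eq_zero h, map_zero]
  rw [e2, e3, ← hQ]
  by_cases hTi : trunc p m n i ≤ T i
  · by_cases hred : Reduced p m n (T - Pi.single i (trunc p m n i))
    -- If the lowered total exponent is reduced, all coordinates other than i are small, so an
    -- intermediate product can only overflow at i.
    · have key : ∀ ρ : Fin n → ℕ, (∀ j, ρ j ≤ T j) →
          (Reduced p m n ρ ↔ ¬ trunc p m n i ≤ ρ i) := by
        intro ρ hρ
        constructor
        · intro h
          exact not_le.mpr (h i)
        · intro h j
          by_cases hj : j = i
          · subst hj
            exact not_le.mp h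
          · have := hred j
            rw [Pi.sub_apply, Pi.single_eq_of_ne hj, Nat.sub_zero] at this
            exact (hρ j).trans_lt this
      rw [if_pos hTi]
      have k1 := key γ hγT
      have k2 := key γ' hγT'
      by_cases h1 : trunc p m n i ≤ γ i <;> by_cases h2 : trunc p m n i ≤ γ' i <;>
        simp [k1, k2, h1, h2]
    · have : Q = 0 := hQ ▸ mon_eq_zero hred _
      simp [this]
  · have h1 : ¬ trunc p m n i ≤ γ i := fun h => hTi (h.trans (hγT i))
    have h2 : ¬ trunc p m n i ≤ γ' i := fun h => hTi (h.trans (hγT' i))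
    simp [hTi, h1, h2]

theorem chi_hochschild (i : Fin n) (a b c : GroupAlg k p m n) :
    a * chi k p m n i b c - chi k p m n i (a * b) c + chi k p m n i a (b * c) -
      chi k p m n i a b * c = 0 := by
  induction a using mon_induction with
  | h0 => simp
  | hadd x y hx hy =>
    simp only [add_mul, map_add, LinearMap.add_apply]
    linear_combination hx + hy
  | hsmul r x hx =>
    simp only [smul_mul_assoc, map_smul, LinearMap.smul_apply, ← smul_sub, ← smul_add, hx,
      smul_zero]
  | hmon α e hα =>
  induction b using mon_induction with
  | h0 => simp
  | hadd x y hx hy =>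
    simp only [add_mul, mul_add, map_add, LinearMap.add_apply]
    linear_combination hx + hy
  | hsmul r x hx =>
    simp only [smul_mul_assoc, mul_smul_comm, map_smul, LinearMap.smul_apply, ← smul_sub,
      ← smul_add, hx, smul_zero]
  | hmon β f hβ =>
  induction c using mon_induction with
  | h0 => simp
  | hadd x y hx hy =>
    simp only [mul_add, map_add]
    linear_combination hx + hy
  | hsmul r x hx =>
    simp only [mul_smul_comm, map_smul, ← smul_sub, ← smul_add, hx, smul_zero]
  | hmon κ g hκ => exact chi_hochschild_mon i hα hβ hκ e f g

end Chi

/-! ### Derivations over the augmentation and their anticommutation. -/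

section Derivations

variable [Fact p.Prime] [CharP k p]

instance : Module.Finite k (GroupAlg k p m n) := SupergroupAlgebra.finite

theorem aug_s (i : Fin n) : aug k (GroupAlg k p m n) (s k p m n i) = 0 :=
  EvenAlg.counit_s k p m n i

theorem aug_σ : aug k (GroupAlg k p m n) (σ k p m n) = 0 := by
  change Coalgebra.counit (R := k) (re k p m n (od k p m n 1)) = 0
  rw [re_od, map_zero]

theorem aug_mon (α : Fin n → ℕ) (e : Fin 2) :
    aug k (GroupAlg k p m n) (mon k p m n α e) = if α = 0 ∧ e = 0 then 1 else 0 := by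
  rw [mon_eq_prod, map_mul, map_prod, map_pow, aug_σ]
  simp only [map_pow, aug_s]
  split_ifs with h
  · simp [h.1, h.2]
  · rw [not_and_or] at h
    rcases h with h | h
    · obtain ⟨i, hi⟩ := Function.ne_iff.mp h
      rw [Finset.prod_eq_zero (Finset.mem_univ i) (zero_pow hi), zero_mul]
    · rw [zero_pow (fun h' => h (Fin.ext h')), mul_zero]

theorem two_le_trunc (i : Fin n) : 2 ≤ trunc p m n i := by
  obtain ⟨r, hr, h⟩ := EvenAlg.trunc_eq p m n i
  rw [h]
  calc 2 ≤ p := (Fact.out : p.Prime).two_le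
    _ = p ^ 1 := (pow_one p).symm
    _ ≤ p ^ r := Nat.pow_le_pow_right (Fact.out : p.Prime).pos hr

theorem le_trunc (i : Fin n) : p ≤ trunc p m n i := by
  obtain ⟨r, hr, h⟩ := EvenAlg.trunc_eq p m n i
  rw [h]
  calc p = p ^ 1 := (pow_one p).symm
    _ ≤ p ^ r := Nat.pow_le_pow_right (Fact.out : p.Prime).pos hr

/-- A derivation over the augmentation is determined by its values on the generators. -/
theorem derivation_ext {f g : GroupAlg k p m n →ₗ[k] k} (hf : ∀ a b, f (a * b) =
      aug k (GroupAlg k p m n) a * f b + f a * aug k (GroupAlg k p m n) b)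
    (hg : ∀ a b, g (a * b) =
      aug k (GroupAlg k p m n) a * g b + g a * aug k (GroupAlg k p m n) b)
    (h : ∀ i, f (s k p m n i) = g (s k p m n i)) (h' : f (σ k p m n) = g (σ k p m n)) :
    f = g := by
  -- Derivations over ε are the infinitesimal parts of homomorphisms to the dual numbers that lift
  -- ε, and homomorphisms are determined on generators.
  have key : ∀ f : GroupAlg k p m n →ₗ[k] k, (∀ a b, f (a * b) =
      aug k (GroupAlg k p m n) a * f b + f a * aug k (GroupAlg k p m n) b) →
      ∃ F : GroupAlg k p m n →ₐ[k] DualNumber k, ∀ a, F a =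
        TrivSqZeroExt.inl (aug k (GroupAlg k p m n) a) + TrivSqZeroExt.inr (f a) := by
    intro f hf
    have h1 : f 1 = 0 := by simpa using hf 1 1
    refine ⟨AlgHom.ofLinearMap
      { toFun := fun a => TrivSqZeroExt.inl (aug k (GroupAlg k p m n) a) +
          TrivSqZeroExt.inr (f a)
        map_add' := fun a b => ?_
        map_smul' := fun c a => ?_ } ?_ ?_, fun a => rfl⟩
    · ext <;> simp
    · ext <;> simp
    · ext <;> simp [h1]
    · intro a b
      ext <;> simp [hf, mul_comm]
  obtain ⟨F, hF⟩ := key f hf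
  obtain ⟨G, hG⟩ := key g hg
  have hFG : F = G := algHom_ext (fun i => by rw [hF, hG, h]) (by rw [hF, hG, h'])
  ext a
  have := congr_arg TrivSqZeroExt.snd (DFunLike.congr_fun hFG a)
  rw [hF, hG] at this
  simpa using this

theorem pow_eq_zero_of_sq {R : Type*} [MonoidWithZero R] {x : R} {r : ℕ} (hx : x * x = 0)
    (hr : 2 ≤ r) : x ^ r = 0 := by
  rw [← Nat.sub_add_cancel hr, pow_add, pow_two, hx, mul_zero]

theorem pow_eq_zero_of_cube {R : Type*} [MonoidWithZero R] {x : R} {r : ℕ} (hx : x * x * x = 0)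
    (hr : 3 ≤ r) : x ^ r = 0 := by
  rw [← Nat.sub_add_cancel hr, pow_add, pow_succ, pow_two, hx, mul_zero]

/-- The homomorphism to the dual numbers with prescribed infinitesimal values on the generators. -/
def derHom (c : Fin n → k) (c' : k) : GroupAlg k p m n →ₐ[k] DualNumber k :=
  liftHom (R := DualNumber k) (fun i => TrivSqZeroExt.inr (c i))
    (fun i => pow_eq_zero_of_sq (by simp) (two_le_trunc i)) (TrivSqZeroExt.inr c')
    (by rw [pow_eq_zero_of_sq (by simp) (Fact.out : p.Prime).two_le]; simp)

theorem derHom_fst (c : Fin n → k) (c' : k) (a : GroupAlg k p m n) :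
    (derHom c c' a).fst = aug k (GroupAlg k p m n) a := by
  have h : (TrivSqZeroExt.fstHom k k k).comp (derHom c c') = aug k (GroupAlg k p m n) :=
    algHom_ext (fun i => by simp [derHom, liftHom_s, aug_s]) (by simp [derHom, liftHom_σ, aug_σ])
  exact DFunLike.congr_fun h a

/-- The derivation over the augmentation with prescribed values on the generators. -/
def der (c : Fin n → k) (c' : k) : GroupAlg k p m n →ₗ[k] k :=
  TrivSqZeroExt.sndHom k k ∘ₗ (derHom c c').toLinearMap

theorem der_apply (c : Fin n → k) (c' : k) (a : GroupAlg k p m n) :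
    der c c' a = (derHom c c' a).snd := rfl

theorem der_s (c : Fin n → k) (c' : k) (i : Fin n) : der c c' (s k p m n i) = c i := by
  simp [der_apply, derHom, liftHom_s]

theorem der_σ (c : Fin n → k) (c' : k) : der c c' (σ k p m n) = c' := by
  simp [der_apply, derHom, liftHom_σ]

theorem der_mul (c : Fin n → k) (c' : k) (a b : GroupAlg k p m n) : der c c' (a * b) =
    aug k (GroupAlg k p m n) a * der c c' b + der c c' a * aug k (GroupAlg k p m n) b := by
  simp only [der_apply, ← derHom_fst c c', map_mul, TrivSqZeroExt.snd_mul, smul_eq_mul,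
    MulOpposite.smul_eq_mul_unop, MulOpposite.unop_op]

theorem der_one (c : Fin n → k) (c' : k) : der c c' (1 : GroupAlg k p m n) = 0 := by
  simpa using der_mul c c' (1 : GroupAlg k p m n) 1

set_option maxHeartbeats 400000 in
/-- Derivations anticommute up to a coboundary. -/
theorem exists_der_anticomm (hp : 3 ≤ p) (c b : Fin n → k) (c' b' : k) (h : c' * b' = 0) :
    ∃ f : GroupAlg k p m n →ₗ[k] k, ∀ x y, f (x * y) = aug k (GroupAlg k p m n) x * f y +
      f x * aug k (GroupAlg k p m n) y + der c c' x * der b b' y + der b b' x * der c c' y := by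
  have hcube : ∀ x y : k, (TrivSqZeroExt.inl (TrivSqZeroExt.inr x) +
      TrivSqZeroExt.inr (TrivSqZeroExt.inl y) : DualNumber (DualNumber k)) *
      (TrivSqZeroExt.inl (TrivSqZeroExt.inr x) + TrivSqZeroExt.inr (TrivSqZeroExt.inl y)) *
      (TrivSqZeroExt.inl (TrivSqZeroExt.inr x) + TrivSqZeroExt.inr (TrivSqZeroExt.inl y)) = 0 := by
    intro x y
    ext <;> simp
  -- With η the inner and θ the outer infinitesimal, s_i ↦ c_i η + b_i θ and likewise for σ. Cubes
  -- of such elements vanish, so p ≥ 3 makes the truncation relations hold; σ² goes to 2c'b'ηθ,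
  -- which is zero by hypothesis. The sought linear form is the coefficient of ηθ.
  let Θ : GroupAlg k p m n →ₐ[k] DualNumber (DualNumber k) := liftHom
    (R := DualNumber (DualNumber k))
    (fun i => TrivSqZeroExt.inl (TrivSqZeroExt.inr (c i)) +
      TrivSqZeroExt.inr (TrivSqZeroExt.inl (b i)))
    (fun i => pow_eq_zero_of_cube (hcube _ _) (hp.trans (le_trunc i)))
    (TrivSqZeroExt.inl (TrivSqZeroExt.inr c') + TrivSqZeroExt.inr (TrivSqZeroExt.inl b'))
    (by
      rw [pow_eq_zero_of_cube (hcube _ _) hp]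
      ext <;> simp [h])
  have hs : ∀ i, Θ (s k p m n i) = TrivSqZeroExt.inl (TrivSqZeroExt.inr (c i)) +
      TrivSqZeroExt.inr (TrivSqZeroExt.inl (b i)) := fun i => liftHom_s _ _ _ _ i
  have hσ : Θ (σ k p m n) = TrivSqZeroExt.inl (TrivSqZeroExt.inr c') +
      TrivSqZeroExt.inr (TrivSqZeroExt.inl b') := liftHom_σ _ _ _ _
  have h1 : ∀ a, (Θ a).fst = derHom c c' a := by
    have : ((TrivSqZeroExt.fstHom (DualNumber k) (DualNumber k) (DualNumber k)).restrictScalars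
        k).comp Θ = derHom c c' := by
      refine algHom_ext (fun i => ?_) ?_
      · rw [AlgHom.comp_apply, hs]
        simp [derHom, liftHom_s]
      · rw [AlgHom.comp_apply, hσ]
        simp [derHom, liftHom_σ]
    exact DFunLike.congr_fun this
  let T : GroupAlg k p m n →ₗ[k] DualNumber k :=
    { toFun := fun a => (Θ a).snd
      map_add' := fun x y => by simp
      map_smul' := fun r x => by simp }
  have hT : ∀ x y, T (x * y) = derHom c c' x * T y + derHom c c' y * T x := by
    intro x y
    rw [← h1, ← h1]
    change (Θ (x * y)).snd = _
    rw [map_mul, TrivSqZeroExt.snd_mul]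
    simp only [smul_eq_mul, MulOpposite.smul_eq_mul_unop, MulOpposite.unop_op]
    rw [mul_comm (Θ x).snd]
    rfl
  have h2 : ∀ x, (T x).fst = der b b' x := by
    have : (TrivSqZeroExt.fstHom k k k).toLinearMap ∘ₗ T = der b b' := by
      refine derivation_ext (fun x y => ?_) (der_mul _ _) (fun i => ?_) ?_
      · rw [LinearMap.comp_apply, hT]
        simp [derHom_fst, mul_comm]
      · rw [LinearMap.comp_apply, der_s]
        change (Θ (s k p m n i)).snd.fst = _
        rw [hs]
        simp
      · rw [LinearMap.comp_apply, der_σ]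
        change (Θ (σ k p m n)).snd.fst = _
        rw [hσ]
        simp
    exact DFunLike.congr_fun this
  refine ⟨TrivSqZeroExt.sndHom k k ∘ₗ T, fun x y => ?_⟩
  simp only [LinearMap.comp_apply, TrivSqZeroExt.sndHom_apply, hT, TrivSqZeroExt.snd_add,
    TrivSqZeroExt.snd_mul, derHom_fst, h2, ← der_apply, smul_eq_mul,
    MulOpposite.smul_eq_mul_unop, MulOpposite.unop_op]
  ring

end Derivations

end GroupAlg

end WittElementary

end SupergroupAlgebra

end

noncomputable section

namespace SupergroupAlgebra

section General

variable {k : Type u} {A : Type v} [Field k] [CommRing A] [Algebra k A]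

theorem map_span_mem {N : Type*} [AddCommGroup N] [Module k N] {P : Submodule k N} {S : Set A}
    {f : A →ₗ[k] N} (h : ∀ t ∈ S, ∀ a, f (t * a) ∈ P) : ∀ a ∈ Ideal.span S, f a ∈ P := by
  intro a ha
  suffices ∀ b, f (a * b) ∈ P by simpa using this 1
  induction ha using Submodule.span_induction with
  | mem x hx => exact h x hx
  | zero => simp
  | add x y _ _ hx hy =>
    intro b
    rw [add_mul, map_add]
    exact add_mem (hx b) (hy b)
  | smul r x _ hx =>
    intro b
    rw [smul_eq_mul, mul_comm r, mul_assoc]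
    exact hx _

theorem map_span_eq_zero {N : Type*} [AddCommGroup N] [Module k N] {S : Set A}
    {f : A →ₗ[k] N} (h : ∀ t ∈ S, ∀ a, f (t * a) = 0) : ∀ a ∈ Ideal.span S, f a = 0 :=
  fun a ha => (Submodule.mem_bot k).mp (map_span_mem (fun t ht a => by simp [h t ht a]) a ha)

variable [Module.Finite k A] (ε : A →ₐ[k] k)

/-- On a scalar-valued map the summand with `d` disappears, so `twD` gives b ↦ G(ab) - G(a) ε(b).
This reduces the relation t X = D G of a step to an identity between bilinear forms. -/
theorem act_form_comp {t : A} {B : A →ₗ[k] A →ₗ[k] k} {G : A →ₗ[k] k}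
    (h : ∀ a b, B (t * a) b = G (a * b) - G a * ε b) :
    act t (form ∘ₗ B) = twD ε (scal G) := by
  ext1 a
  have h1 : act a (scal G) = scal (G ∘ₗ LinearMap.mulLeft k a) := rfl
  have h2 : d ε (scal G a) = 0 := by
    rw [scal_apply, Algebra.algebraMap_eq_smul_one, map_smul]
    have : d ε (1 : Cochains k A) = 0 := (one_mem (Cocycles ε) : _)
    rw [this, smul_zero]
  rw [twD_apply, h1, prep_scal, h2, zero_add, scal_apply, ← Algebra.commutes, ← Algebra.smul_def,
    ← map_smul, ← map_sub, act_apply, LinearMap.comp_apply]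
  congr 1
  ext b
  simp [h]

end General

namespace WittElementary

namespace GroupAlg

open SupergroupAlgebra.WittElementary.EvenAlg (top Reduced)

variable {k : Type u} [Field k] {p : ℕ} {m n : ℕ+}

/-! ### Division of monomials by powers of a generator. -/

section Shift

/-- Division of monomials by `s_i^r`. -/
def shift (i : Fin n) (r : ℕ) : GroupAlg k p m n →ₗ[k] GroupAlg k p m n :=
  ofMon fun α e => if r ≤ α i then mon k p m n (α - Pi.single i r) e else 0

/-- Division in the i-th exponent leaves the other exponents alone. Hence it preserves the ideals
generated by the other s_j. -/
theorem shift_s_mul {i j : Fin n} (hij : j ≠ i) (r : ℕ) (a : GroupAlg k p m n) :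
    shift i r (s k p m n j * a) = s k p m n j * shift i r a := by
  suffices shift i r ∘ₗ LinearMap.mulLeft k (s k p m n j) =
      LinearMap.mulLeft k (s k p m n j) ∘ₗ shift i r from DFunLike.congr_fun this a
  refine linearMap_ext fun α e hα => ?_
  simp only [LinearMap.comp_apply, LinearMap.mulLeft_apply, s_mul_mon]
  rw [shift, ofMon_mon, ofMon_mon, if_pos hα]
  have h1 : (α + Pi.single j 1 : Fin n → ℕ) i = α i := by simp [Pi.single_eq_of_ne hij.symm]
  rw [h1]
  by_cases hr : r ≤ α i
  · rw [if_pos hr, if_pos hr, s_mul_mon]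
    have h2 : α + Pi.single j 1 - Pi.single i r = α - Pi.single i r + Pi.single j 1 := by
      funext l
      by_cases hl : l = i
      · subst hl; simp [Pi.single_eq_of_ne hij.symm]
      · simp [Pi.single_eq_of_ne hl]
    rw [h2]
    split_ifs with h
    · rfl
    · rw [mon_eq_zero]
      intro h'
      refine h fun l => ?_
      by_cases hl : l = i
      · subst hl; rw [h1]; exact hα _
      · have := h' l
        simpa [Pi.single_eq_of_ne hl] using this
  · simp [hr]

/-- Multiplying by s_i^r and dividing again loses only monomials killed by s_i^r, and these are
divisible by the complementary power. -/
theorem shift_s_pow_mul_sub_mem (i : Fin n) {r r' : ℕ} (hr : r + r' = trunc p m n i)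
    (a : GroupAlg k p m n) :
    shift i r (s k p m n i ^ r * a) - a ∈ Ideal.span {s k p m n i ^ r'} := by
  refine mem_of_mon_mem (f := shift i r ∘ₗ LinearMap.mulLeft k (s k p m n i ^ r) - LinearMap.id)
    (P := (Ideal.span {s k p m n i ^ r'}).restrictScalars k) (fun α e hα => ?_) a
  simp only [LinearMap.sub_apply, LinearMap.comp_apply, LinearMap.mulLeft_apply, s_pow_mul_mon,
    LinearMap.id_apply, Submodule.restrictScalars_mem]
  rw [shift, ofMon_mon]
  split_ifs with h h'
  · simp
  · simp at h'
  · have h1 : r' ≤ α i := by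
      by_contra h1
      refine h fun l => ?_
      by_cases hl : l = i
      · subst hl
        simp only [Pi.add_apply, Pi.single_eq_same]
        omega
      · simpa [Pi.single_eq_of_ne hl] using hα l
    have h2 : α = α - Pi.single i r' + Pi.single i r' := by
      funext l
      by_cases hl : l = i
      · subst hl; simp [h1]
      · simp [Pi.single_eq_of_ne hl]
    rw [zero_sub, neg_mem_iff, h2, ← s_pow_mul_mon]
    exact Ideal.mul_mem_right _ _ (Ideal.mem_span_singleton_self _)

end Shift

/-! ### The cocycles for λ_i, ζ and x_i. -/

section Cocycles

variable [Fact p.Prime] [CharP k p]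

theorem der_mon_of_ne_zero (c : Fin n → k) (c' : k) {α : Fin n → ℕ} {i : Fin n} (hα : α i ≠ 0)
    (e : Fin 2) : der c c' (mon k p m n α e) = if α = Pi.single i 1 ∧ e = 0 then c i else 0 := by
  have h : α = α - Pi.single i 1 + Pi.single i 1 := by
    funext l
    by_cases hl : l = i
    · subst hl; simp; omega
    · simp [Pi.single_eq_of_ne hl]
  have h0 : α - Pi.single i 1 = 0 ↔ α = Pi.single i 1 := by
    constructor
    · intro h'
      rw [h, h', zero_add]
    · intro h'
      rw [h', tsub_self]
  conv_lhs => rw [h, ← s_mul_mon, der_mul, aug_s, zero_mul, zero_add, der_s, aug_mon]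
  simp [h0]

theorem der_mon_zero (c : Fin n → k) (c' : k) (e : Fin 2) :
    der c c' (mon k p m n 0 e) = if e = 1 then c' else 0 := by
  have he : e = 0 ∨ e = 1 := by omega
  rcases he with rfl | rfl
  · rw [mon_zero, der_one]; simp
  · rw [← σ_eq_mon, der_σ]; simp

variable (k p m n) in
/-- The 1-cocycle `λ_i`. -/
def lam (i : Fin n) : GroupAlg k p m n →ₗ[k] k := der (Pi.single i 1) 0

variable (k p m n) in
/-- The 1-cocycle `ζ`. -/
def zet : GroupAlg k p m n →ₗ[k] k := der 0 1

theorem lam_mon (i : Fin n) (α : Fin n → ℕ) (e : Fin 2) :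
    lam k p m n i (mon k p m n α e) = if α = Pi.single i 1 ∧ e = 0 then 1 else 0 := by
  rw [lam]
  by_cases hα : α = 0
  · subst hα
    have : (0 : Fin n → ℕ) ≠ Pi.single i 1 := fun h => by simpa using congr_fun h i
    rw [der_mon_zero]
    simp [this]
  · obtain ⟨j, hj⟩ := Function.ne_iff.mp hα
    rw [der_mon_of_ne_zero _ _ hj]
    by_cases hij : j = i
    · subst hij; simp
    · rw [Pi.single_eq_of_ne hij]
      have : α ≠ Pi.single i 1 := fun h => by
        rw [h, Pi.single_eq_of_ne hij] at hj
        exact hj rfl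
      simp [this]

theorem zet_mon (α : Fin n → ℕ) (e : Fin 2) :
    zet k p m n (mon k p m n α e) = if α = 0 ∧ e = 1 then 1 else 0 := by
  rw [zet]
  by_cases hα : α = 0
  · subst hα
    rw [der_mon_zero]
    simp
  · obtain ⟨j, hj⟩ := Function.ne_iff.mp hα
    rw [der_mon_of_ne_zero _ _ hj]
    simp [hα]

theorem lam_s_mul (i j : Fin n) (a : GroupAlg k p m n) : lam k p m n i (s k p m n j * a) =
    if j = i then aug k (GroupAlg k p m n) a else 0 := by
  rw [lam, der_mul, aug_s, zero_mul, zero_add, der_s]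
  by_cases h : j = i
  · subst h; simp
  · simp [h]

theorem zet_s_mul (j : Fin n) (a : GroupAlg k p m n) : zet k p m n (s k p m n j * a) = 0 := by
  rw [zet, der_mul, aug_s, zero_mul, zero_add, der_s]
  simp

theorem zet_σ_mul (a : GroupAlg k p m n) :
    zet k p m n (σ k p m n * a) = aug k (GroupAlg k p m n) a := by
  rw [zet, der_mul, aug_σ, zero_mul, zero_add, der_σ, one_mul]

theorem zet_mul (a b : GroupAlg k p m n) : zet k p m n (a * b) =
    aug k (GroupAlg k p m n) a * zet k p m n b + zet k p m n a * aug k (GroupAlg k p m n) b :=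
  der_mul _ _ _ _

variable (k p m n) in
/-- The 2-cocycle `ζ²`. -/
def zetSq : GroupAlg k p m n →ₗ[k] GroupAlg k p m n →ₗ[k] k :=
  (LinearMap.lsmul k k ∘ₗ zet k p m n).compl₂ (zet k p m n)

theorem zetSq_apply (a b : GroupAlg k p m n) :
    zetSq k p m n a b = zet k p m n a * zet k p m n b := rfl

variable (k p m n) in
/-- The 2-cocycle `ε ∘ χ_i`. -/
def chiAug (i : Fin n) : GroupAlg k p m n →ₗ[k] GroupAlg k p m n →ₗ[k] k :=
  (chi k p m n i).compr₂ (aug k (GroupAlg k p m n)).toLinearMap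

theorem chiAug_mon (i : Fin n) {α β : Fin n → ℕ} (hα : Reduced p m n α) (hβ : Reduced p m n β)
    (e f : Fin 2) : chiAug k p m n i (mon k p m n α e) (mon k p m n β f) =
      if α + β + carry p n e f = Pi.single i (trunc p m n i) ∧ e + f = 0 then 1 else 0 := by
  change aug k (GroupAlg k p m n) (chi k p m n i _ _) = _
  rw [chi_mon i hα hβ]
  generalize α + β + carry p n e f = γ
  split_ifs with h h' h'
  · rw [h'.1, tsub_self, h'.2, aug_mon]
    simp
  · rw [aug_mon, if_neg]
    intro h''
    refine h' ⟨?_, h''.2⟩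
    funext l
    have := congr_fun h''.1 l
    by_cases hl : l = i
    · subst hl
      simp only [Pi.sub_apply, Pi.single_eq_same, Pi.zero_apply] at this ⊢
      omega
    · simpa [Pi.single_eq_of_ne hl] using this
  · rw [h'.1] at h
    simp at h
  · rw [map_zero]

theorem chiAug_s_mul_of_ne {i j : Fin n} (hij : j ≠ i) (a b : GroupAlg k p m n) :
    chiAug k p m n i (s k p m n j * a) b = 0 := by
  suffices chiAug k p m n i ∘ₗ LinearMap.mulLeft k (s k p m n j) = 0 from
    DFunLike.congr_fun (DFunLike.congr_fun this a) b
  refine bilin_ext fun α β e f hα hβ => ?_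
  simp only [LinearMap.comp_apply, LinearMap.mulLeft_apply, s_mul_mon, LinearMap.zero_apply]
  by_cases h : Reduced p m n (α + Pi.single j 1)
  · rw [chiAug_mon i h hβ, if_neg]
    intro h'
    have := congr_fun h'.1 j
    simp [Pi.single_eq_of_ne hij] at this
  · rw [mon_eq_zero h, map_zero, LinearMap.zero_apply]

variable (k p m n) in
/-- The coefficient of `s_i^{d_i - 1}`. -/
def topCoeff (i : Fin n) : GroupAlg k p m n →ₗ[k] k :=
  ofMon fun α e => if α = Pi.single i (trunc p m n i - 1) ∧ e = 0 then 1 else 0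

theorem reduced_single {i : Fin n} {r : ℕ} (h : r < trunc p m n i) :
    Reduced p m n (Pi.single i r) := by
  intro l
  by_cases hl : l = i
  · subst hl; simpa
  · rw [Pi.single_eq_of_ne hl]
    exact lt_of_lt_of_le two_pos (two_le_trunc l)

theorem topCoeff_mon (i : Fin n) (α : Fin n → ℕ) (e : Fin 2) :
    topCoeff k p m n i (mon k p m n α e) =
      if α = Pi.single i (trunc p m n i - 1) ∧ e = 0 then 1 else 0 := by
  rw [topCoeff, ofMon_mon]
  by_cases h : Reduced p m n α
  · rw [if_pos h]
  · rw [if_neg h, if_neg]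
    rintro ⟨rfl, -⟩
    exact h (reduced_single (by have := two_le_trunc (p := p) (m := m) i; omega))

theorem topCoeff_s_mul_of_ne {i j : Fin n} (hij : j ≠ i) (a : GroupAlg k p m n) :
    topCoeff k p m n i (s k p m n j * a) = 0 := by
  suffices topCoeff k p m n i ∘ₗ LinearMap.mulLeft k (s k p m n j) = 0 from
    DFunLike.congr_fun this a
  refine linearMap_ext fun α e hα => ?_
  simp only [LinearMap.comp_apply, LinearMap.mulLeft_apply, s_mul_mon, LinearMap.zero_apply]
  rw [topCoeff_mon, if_neg]
  intro h'
  have := congr_fun h'.1 j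
  simp [Pi.single_eq_of_ne hij] at this

theorem topCoeff_s_pow_mul (i : Fin n) (a : GroupAlg k p m n) :
    topCoeff k p m n i (s k p m n i ^ (trunc p m n i - 1) * a) = aug k (GroupAlg k p m n) a := by
  suffices topCoeff k p m n i ∘ₗ LinearMap.mulLeft k (s k p m n i ^ (trunc p m n i - 1)) =
    (aug k (GroupAlg k p m n)).toLinearMap from DFunLike.congr_fun this a
  refine linearMap_ext fun α e hα => ?_
  simp only [LinearMap.comp_apply, LinearMap.mulLeft_apply, s_pow_mul_mon,
    AlgHom.toLinearMap_apply]
  rw [topCoeff_mon, aug_mon]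
  simp

/-- A reduced product s_i a overflows against b to a unit exactly when ab is the monomial
s_i^{d_i-1}. If s_i a is zero, both terms on the right are equal. The identity has the form required
by `act_form_comp`, up to sign. -/
theorem chiAug_s_mul (i : Fin n) (a b : GroupAlg k p m n) :
    chiAug k p m n i (s k p m n i * a) b = topCoeff k p m n i (a * b) -
      topCoeff k p m n i a * aug k (GroupAlg k p m n) b := by
  suffices chiAug k p m n i ∘ₗ LinearMap.mulLeft k (s k p m n i) =
      (LinearMap.mul k (GroupAlg k p m n)).compr₂ (topCoeff k p m n i) -
        (LinearMap.lsmul k k ∘ₗ topCoeff k p m n i).compl₂ (aug k (GroupAlg k p m n)).toLinearMap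
    from DFunLike.congr_fun (DFunLike.congr_fun this a) b
  refine bilin_ext fun α β e f hα hβ => ?_
  have hd := two_le_trunc (p := p) (m := m) i
  simp only [LinearMap.comp_apply, LinearMap.mulLeft_apply, s_mul_mon, LinearMap.sub_apply,
    LinearMap.compr₂_apply, LinearMap.mul_apply', LinearMap.compl₂_apply, LinearMap.lsmul_apply,
    smul_eq_mul, AlgHom.toLinearMap_apply, mon_mul_mon, topCoeff_mon, aug_mon]
  have h1 : α + Pi.single i 1 + β + carry p n e f = Pi.single i (trunc p m n i) ↔
      α + β + carry p n e f = Pi.single i (trunc p m n i - 1) := by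
    have h2 : (Pi.single i (trunc p m n i) : Fin n → ℕ) =
        Pi.single i (trunc p m n i - 1) + Pi.single i 1 := by
      rw [← Pi.single_add, Nat.sub_add_cancel (by omega)]
    have h3 : α + Pi.single i 1 + β + carry p n e f =
        α + β + carry p n e f + Pi.single i 1 := by abel
    rw [h2, h3, add_left_inj]
  by_cases h : Reduced p m n (α + Pi.single i 1)
  · rw [chiAug_mon i h hβ]
    have h2 : α ≠ Pi.single i (trunc p m n i - 1) := by
      rintro rfl
      have := h i
      rw [← Pi.single_add, Pi.single_eq_same] at this
      omega
    simp only [h1]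
    simp [h2]
  · rw [mon_eq_zero h, map_zero, LinearMap.zero_apply]
    have h2 : trunc p m n i - 1 ≤ α i := by
      by_contra h2
      refine h fun l => ?_
      by_cases hl : l = i
      · subst hl
        simp only [Pi.add_apply, Pi.single_eq_same]
        omega
      · simpa [Pi.single_eq_of_ne hl] using hα l
    -- The exponent of `α` at `i` already reaches the target, so neither `β` nor a carry can
    -- contribute.
    have key : α + β + carry p n e f = Pi.single i (trunc p m n i - 1) ∧ e + f = 0 ↔
        (α = Pi.single i (trunc p m n i - 1) ∧ e = 0) ∧ (β = 0 ∧ f = 0) := by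
      constructor
      · rintro ⟨h3, h4⟩
        have h5 : ∀ l, (α + β + carry p n e f) l = α l := by
          intro l
          have h6 := congr_fun h3 l
          by_cases hl : l = i
          · subst hl
            rw [Pi.single_eq_same] at h6
            simp only [Pi.add_apply] at h6 ⊢
            omega
          · rw [Pi.single_eq_of_ne hl] at h6
            simp only [Pi.add_apply] at h6 ⊢
            omega
        have h6 : α = Pi.single i (trunc p m n i - 1) := by
          rw [← h3]; exact (funext h5).symm
        have h7 : β = 0 := by
          funext l
          have := h5 l
          simp only [Pi.add_apply, Pi.zero_apply] at this ⊢
          omega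
        have h8 : ¬ (e = 1 ∧ f = 1) := by
          intro h8
          have := h5 (top n)
          rw [carry, if_pos h8] at this
          simp only [Pi.add_apply, Pi.single_eq_same] at this
          have := (Fact.out : p.Prime).pos
          omega
        have he : e = 0 ∨ e = 1 := by omega
        have hf : f = 0 ∨ f = 1 := by omega
        rcases he with rfl | rfl <;> rcases hf with rfl | rfl <;> simp_all
      · rintro ⟨⟨rfl, rfl⟩, rfl, rfl⟩
        simp [carry]
    rw [if_congr key rfl rfl]
    by_cases h3 : α = Pi.single i (trunc p m n i - 1) ∧ e = 0 <;>
      by_cases h4 : β = 0 ∧ f = 0 <;> simp [h3, h4]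

/-- The cocycle `c ζ² - ε χ_i`. -/
def xbil (c : k) (i : Fin n) : GroupAlg k p m n →ₗ[k] GroupAlg k p m n →ₗ[k] k :=
  c • zetSq k p m n + (-1 : k) • chiAug k p m n i

theorem d_lam (i : Fin n) : d (aug k (GroupAlg k p m n)) (form (lam k p m n i)) = 0 :=
  d_form_eq_zero _ (der_mul _ _)

theorem d_zet : d (aug k (GroupAlg k p m n)) (form (zet k p m n)) = 0 :=
  d_form_eq_zero _ (der_mul _ _)

theorem biform_zetSq : biform (zetSq k p m n) = form (zet k p m n) * form (zet k p m n) :=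
  (form_mul_form _ _).symm

theorem d_zetSq : d (aug k (GroupAlg k p m n)) (biform (zetSq k p m n)) = 0 := by
  rw [biform_zetSq]
  have h : form (zet k p m n) ∈ Cocycles (aug k (GroupAlg k p m n)) := d_zet
  exact mul_mem h h

theorem d_chiAug (i : Fin n) : d (aug k (GroupAlg k p m n)) (biform (chiAug k p m n i)) = 0 :=
  d_biform_hochschild _ _ (chi_hochschild i)

theorem biform_xbil (c : k) (i : Fin n) : biform (xbil (p := p) (m := m) c i) =
    c • biform (zetSq k p m n) - biform (chiAug k p m n i) := by
  rw [xbil, map_add, map_smul, map_smul, neg_one_smul, ← sub_eq_add_neg]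

theorem d_xbil (c : k) (i : Fin n) :
    d (aug k (GroupAlg k p m n)) (biform (xbil (p := p) (m := m) c i)) = 0 := by
  rw [biform_xbil, map_sub, map_smul, d_zetSq, d_chiAug, smul_zero, sub_zero]

theorem xbil_s_mul_of_ne (c : k) {i j : Fin n} (hij : j ≠ i) (a : GroupAlg k p m n) :
    xbil c i (s k p m n j * a) = 0 := by
  ext b
  simp [xbil, zetSq_apply, zet_s_mul, chiAug_s_mul_of_ne hij]

end Cocycles

/-! ### The chain of ideals and the data of its steps. -/

section Model

variable [Fact p.Prime] [CharP k p]

variable (k p m n) in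
/-- The ideal generated by the `s_j` with `j ≥ r`. -/
def sIdeal (r : Fin ((n : ℕ) + 1)) : Ideal (GroupAlg k p m n) :=
  Ideal.span (s k p m n '' {j | r ≤ j.castSucc})

theorem sIdeal_last : sIdeal k p m n (Fin.last n) = ⊥ := by
  rw [sIdeal]
  convert Ideal.span_empty
  rw [Set.image_eq_empty]
  ext j
  simp [Fin.last_le_iff]

theorem sIdeal_castSucc (i : Fin n) :
    sIdeal k p m n i.castSucc = sIdeal k p m n i.succ ⊔ Ideal.span {s k p m n i} := by
  rw [sIdeal, sIdeal, ← Ideal.span_union, ← Set.image_singleton, ← Set.image_union]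
  congr 2
  ext j
  simp only [Set.mem_ofPred_eq, Set.mem_union, Set.mem_singleton_iff, Fin.le_def, Fin.ext_iff,
    Fin.val_castSucc, Fin.val_succ]
  omega

theorem s_mem_sIdeal {r : Fin ((n : ℕ) + 1)} {j : Fin n} (h : r ≤ j.castSucc) :
    s k p m n j ∈ sIdeal k p m n r := Ideal.subset_span ⟨j, h, rfl⟩

theorem sIdeal_mem {N : Type*} [AddCommGroup N] [Module k N] {P : Submodule k N} {i : Fin n}
    {f : GroupAlg k p m n →ₗ[k] N} (h : ∀ j, j ≠ i → s k p m n j ∈ sIdeal k p m n i.succ →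
      ∀ a, f (s k p m n j * a) ∈ P) : ∀ a ∈ sIdeal k p m n i.succ, f a ∈ P := by
  refine map_span_mem ?_
  rintro _ ⟨j, hj, rfl⟩
  refine h j ?_ (s_mem_sIdeal hj)
  rintro rfl
  simp [Fin.le_def] at hj

theorem sIdeal_eq_zero {N : Type*} [AddCommGroup N] [Module k N] {i : Fin n}
    {f : GroupAlg k p m n →ₗ[k] N} (h : ∀ j, j ≠ i → ∀ a, f (s k p m n j * a) = 0) :
    ∀ a ∈ sIdeal k p m n i.succ, f a = 0 :=
  fun a ha => (Submodule.mem_bot k).mp (sIdeal_mem (fun j hj _ a => by simp [h j hj a]) a ha)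

/-- The coefficient of ζ² is free because ζ kills all multiples of the s_j. The relation t X = D G
thus involves only χ_i, with G minus the coefficient of s_i^{d_i-1}. -/
theorem stepData_s (c : k) (i : Fin n) :
    StepData (aug k (GroupAlg k p m n)) (sIdeal k p m n i.succ) (s k p m n i) (trunc p m n i)
      (lam k p m n i) (form ∘ₗ xbil c i) where
  two_le := two_le_trunc i
  gen_pow_mem := by rw [s_pow_trunc]; exact zero_mem _
  aug_eq_zero := aug_s i
  l_cocycle := d_lam i
  l_vanish := sIdeal_eq_zero fun j hj a => by rw [lam_s_mul, if_neg hj]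
  l_mul a := by rw [lam_s_mul, if_pos rfl]
  X_cocycle := by rw [prep_form_comp, d_xbil]
  X_vanish := sIdeal_eq_zero fun j hj a => by
    rw [LinearMap.comp_apply, xbil_s_mul_of_ne c hj, map_zero]
  X_deg a := ⟨_, rfl⟩
  X_mul := by
    refine ⟨-topCoeff k p m n i, -1, by simp, sIdeal_eq_zero fun j hj a => ?_, fun a => ?_, ?_⟩
    · rw [LinearMap.neg_apply, topCoeff_s_mul_of_ne hj, neg_zero]
    · rw [LinearMap.neg_apply, topCoeff_s_pow_mul, neg_one_mul]
    · refine act_form_comp _ fun a b => ?_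
      simp [xbil, zetSq_apply, zet_s_mul, chiAug_s_mul]
      ring
  div_pow := by
    have h2 := two_le_trunc (p := p) (m := m) i
    refine ⟨shift i (trunc p m n i - 1), ?_, fun a => ?_⟩
    · refine sIdeal_mem (P := (sIdeal k p m n i.succ ⊔ Ideal.span {s k p m n i}).restrictScalars k)
        fun j hj hs a => ?_
      rw [shift_s_mul hj, Submodule.restrictScalars_mem]
      exact Ideal.mul_mem_right _ _ (Ideal.mem_sup_left hs)
    · have := shift_s_pow_mul_sub_mem (k := k) (m := m) i
        (r := trunc p m n i - 1) (r' := 1) (by omega) a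
      rw [pow_one] at this
      exact Ideal.mem_sup_right this
  div := by
    have h2 := two_le_trunc (p := p) (m := m) i
    refine ⟨shift i 1, ?_, fun a => ?_⟩
    · refine sIdeal_mem (P := (sIdeal k p m n i.succ).restrictScalars k) fun j hj hs a => ?_
      rw [shift_s_mul hj, Submodule.restrictScalars_mem]
      exact Ideal.mul_mem_right _ _ hs
    · have := shift_s_pow_mul_sub_mem (k := k) (m := m) i
        (r := 1) (r' := trunc p m n i - 1) (by omega) a
      rw [pow_one] at this
      exact Ideal.mem_sup_right this

theorem σ_mul_σ : σ k p m n * σ k p m n = s k p m n (top n) ^ p := by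
  rw [σ_eq_mon, mon_mul_mon, s_pow_eq_mon]
  have : (1 + 1 : Fin 2) = 0 := rfl
  simp [carry, this]

theorem ev_im_s_mul (j : Fin n) (a : GroupAlg k p m n) :
    ev k p m n (im k p m n (s k p m n j * a)) = s k p m n j * ev k p m n (im k p m n a) := by
  rw [im_mul, s, ev_mul_ev]
  simp

theorem ev_im_σ_mul_sub_mem (a : GroupAlg k p m n) :
    ev k p m n (im k p m n (σ k p m n * a)) - a ∈ Ideal.span {σ k p m n} := by
  have h : ev k p m n (im k p m n (σ k p m n * a)) - a =
      σ k p m n * -ev k p m n (im k p m n a) := by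
    conv_lhs => rw [eq_add a]
    refine GroupAlg.ext ?_ ?_ <;> simp [σ, im_mul, re_mul]
  rw [h]
  exact Ideal.mul_mem_right _ _ (Ideal.mem_span_singleton_self _)

/-- Modulo the s_j the element σ squares to zero, and X = ζ² satisfies σ X = D ζ. Both divisions are
b + b'σ ↦ b', whose defect on multiples of σ is a multiple of σ. -/
theorem stepData_σ : StepData (aug k (GroupAlg k p m n)) (sIdeal k p m n 0) (σ k p m n) 2
    (zet k p m n) (form ∘ₗ zetSq k p m n) where
  two_le := le_rfl
  gen_pow_mem := by
    rw [pow_two, σ_mul_σ]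
    exact Ideal.pow_mem_of_mem _ (s_mem_sIdeal (Fin.zero_le _)) _ (Fact.out : p.Prime).pos
  aug_eq_zero := aug_σ
  l_cocycle := d_zet
  l_vanish := map_span_eq_zero (by rintro _ ⟨j, -, rfl⟩ a; exact zet_s_mul j a)
  l_mul := zet_σ_mul
  X_cocycle := by rw [prep_form_comp, d_zetSq]
  X_vanish := map_span_eq_zero (by
    rintro _ ⟨j, -, rfl⟩ a
    have : zetSq k p m n (s k p m n j * a) = 0 := by
      ext b
      simp [zetSq_apply, zet_s_mul]
    rw [LinearMap.comp_apply, this, map_zero])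
  X_deg a := ⟨_, rfl⟩
  X_mul := by
    refine ⟨zet k p m n, 1, one_ne_zero, ?_, fun a => ?_, ?_⟩
    · exact map_span_eq_zero (by rintro _ ⟨j, -, rfl⟩ a; exact zet_s_mul j a)
    · rw [pow_one, zet_σ_mul, one_mul]
    · refine act_form_comp _ fun a b => ?_
      rw [zetSq_apply, zet_σ_mul, zet_mul]
      ring
  div_pow := by
    refine ⟨ev k p m n ∘ₗ im k p m n, ?_, fun a => ?_⟩
    · refine map_span_mem (P := (sIdeal k p m n 0 ⊔ Ideal.span {σ k p m n}).restrictScalars k) ?_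
      rintro _ ⟨j, -, rfl⟩ a
      rw [LinearMap.comp_apply, ev_im_s_mul, Submodule.restrictScalars_mem]
      exact Ideal.mul_mem_right _ _ (Ideal.mem_sup_left (s_mem_sIdeal (Fin.zero_le _)))
    · rw [pow_one]
      exact Ideal.mem_sup_right (ev_im_σ_mul_sub_mem a)
  div := by
    refine ⟨ev k p m n ∘ₗ im k p m n, ?_, fun a => ?_⟩
    · refine map_span_mem (P := (sIdeal k p m n 0).restrictScalars k) ?_
      rintro _ ⟨j, -, rfl⟩ a
      rw [LinearMap.comp_apply, ev_im_s_mul, Submodule.restrictScalars_mem]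
      exact Ideal.mul_mem_right _ _ (s_mem_sIdeal (Fin.zero_le _))
    · rw [pow_one]
      exact Ideal.mem_sup_right (ev_im_σ_mul_sub_mem a)

/-- A nonunit monomial is divisible by some s_j or is σ, so every element differs from its
augmentation by an element of the left-hand ideal. -/
theorem sIdeal_sup_span_σ : sIdeal k p m n 0 ⊔ Ideal.span {σ k p m n} =
    RingHom.ker (aug k (GroupAlg k p m n)) := by
  apply le_antisymm
  · rw [sup_le_iff, sIdeal, Ideal.span_le, Ideal.span_le]
    constructor
    · rintro _ ⟨j, -, rfl⟩
      exact aug_s j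
    · rintro _ rfl
      exact aug_σ
  · intro a ha
    have h : ∀ a, a - algebraMap k _ (aug k (GroupAlg k p m n) a) ∈
        sIdeal k p m n 0 ⊔ Ideal.span {σ k p m n} := by
      refine mem_of_mon_mem (f := LinearMap.id - Algebra.linearMap k (GroupAlg k p m n) ∘ₗ
        (aug k (GroupAlg k p m n)).toLinearMap) (P := (sIdeal k p m n 0 ⊔
          Ideal.span {σ k p m n}).restrictScalars k) fun α e hα => ?_
      simp only [LinearMap.sub_apply, LinearMap.id_apply, LinearMap.comp_apply,
        AlgHom.toLinearMap_apply, Algebra.linearMap_apply, Submodule.restrictScalars_mem]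
      by_cases hα : α = 0
      · subst hα
        have he : e = 0 ∨ e = 1 := by omega
        rcases he with rfl | rfl
        · simp [mon_zero]
        · rw [← σ_eq_mon, aug_σ, map_zero, sub_zero]
          exact Ideal.mem_sup_right (Ideal.mem_span_singleton_self _)
      · obtain ⟨j, hj⟩ := Function.ne_iff.mp hα
        have h : α = α - Pi.single j 1 + Pi.single j 1 := by
          funext l
          by_cases hl : l = j
          · subst hl
            simp only [Pi.zero_apply] at hj
            simp
            omega
          · simp [Pi.single_eq_of_ne hl]
        rw [h, ← s_mul_mon, map_mul, aug_s, zero_mul, map_zero, sub_zero]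
        exact Ideal.mul_mem_right _ _ (Ideal.mem_sup_left (s_mem_sIdeal (Fin.zero_le _)))
    have := h a
    rwa [(RingHom.mem_ker).mp ha, map_zero, sub_zero] at this

end Model

end GroupAlg

end WittElementary

end SupergroupAlgebra

end

noncomputable section

namespace SupergroupAlgebra

/-! ### Generators and relations of the model algebra. -/

namespace WittElementary

/-- The relations of `k[x_1, …, x_r, z] ⊗ Λ(l_1, …, l_r)`. -/
structure GenRel {H : Type*} [Ring H] {r : ℕ} (x : Fin r → H) (z : H) (l : Fin r → H) : Prop where
  x_comm : ∀ i j, x i * x j = x j * x i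
  x_z : ∀ i, x i * z = z * x i
  x_l : ∀ i j, x i * l j = l j * x i
  l_sq : ∀ i, l i * l i = 0
  l_anti : ∀ i j, l i * l j + l j * l i = 0
  z_l : ∀ i, z * l i + l i * z = 0

namespace GenRel

variable {k : Type u} [Field k] {H : Type v} [Ring H] [Algebra k H]

section OrderedProd

variable {r : ℕ} {x l : Fin r → H}

theorem x_mul_orderedProd (hx : ∀ i j, x i * x j = x j * x i)
    (hxl : ∀ i j, x i * l j = l j * x i) (i : Fin r) (γ : Fin r → ℕ × Fin 2) :
    ∃ γ', x i * orderedProd x l γ = orderedProd x l γ' := by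
  induction r with
  | zero => exact i.elim0
  | succ r ih =>
    rw [orderedProd_succ]
    cases i using Fin.cases with
    | zero =>
      refine ⟨Fin.cons ((γ 0).1 + 1, (γ 0).2) (Fin.tail γ), ?_⟩
      rw [orderedProd_succ, Fin.cons_zero, Fin.tail_cons, pow_succ', mul_assoc, mul_assoc,
        mul_assoc]
    | succ i =>
      obtain ⟨γ', hγ'⟩ := ih (x := Fin.tail x) (l := Fin.tail l) (fun i j => hx _ _)
        (fun i j => hxl _ _) i (Fin.tail γ)
      refine ⟨Fin.cons (γ 0) γ', ?_⟩
      have h1 : Commute (x i.succ) (x 0) := hx _ _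
      have h2 : Commute (x i.succ) (l 0) := hxl _ _
      rw [orderedProd_succ, Fin.cons_zero, Fin.tail_cons, ← hγ', ← mul_assoc,
        ((h1.pow_right _).mul_right (h2.pow_right _)).eq, mul_assoc]
      rfl

/-- Moving l_i to its place costs a sign for each other l_j passed, and a repeated l_i gives zero.
The scalar absorbs both effects. -/
theorem l_mul_orderedProd (hxl : ∀ i j, x i * l j = l j * x i) (hl : ∀ i, l i * l i = 0)
    (hll : ∀ i j, l i * l j + l j * l i = 0) (i : Fin r) (γ : Fin r → ℕ × Fin 2) :
    ∃ (c : k) (γ' : _), l i * orderedProd x l γ = c • orderedProd x l γ' := by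
  induction r with
  | zero => exact i.elim0
  | succ r ih =>
    rw [orderedProd_succ]
    have he : (γ 0).2 = 0 ∨ (γ 0).2 = 1 := by omega
    cases i using Fin.cases with
    | zero =>
      have h1 : Commute (l 0) (x 0 ^ (γ 0).1) := (Commute.pow_left (hxl 0 0) _).symm
      rcases he with he | he
      · refine ⟨1, Fin.cons ((γ 0).1, 1) (Fin.tail γ), ?_⟩
        rw [orderedProd_succ, Fin.cons_zero, Fin.tail_cons, he, one_smul, Fin.val_zero, pow_zero,
          Fin.val_one, pow_one, mul_one, ← mul_assoc, h1.eq]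
      · refine ⟨0, γ, ?_⟩
        rw [he, Fin.val_one, pow_one, zero_smul, ← mul_assoc, ← mul_assoc, h1.eq,
          mul_assoc (x 0 ^ _), hl, mul_zero, zero_mul]
    | succ i =>
      obtain ⟨c, γ', hγ'⟩ := ih (x := Fin.tail x) (l := Fin.tail l) (fun i j => hxl _ _)
        (fun i => hl _) (fun i j => hll _ _) i (Fin.tail γ)
      have h1 : Commute (l i.succ) (x 0 ^ (γ 0).1) := (Commute.pow_left (hxl 0 _) _).symm
      have hγ'' : l i.succ * orderedProd (Fin.tail x) (Fin.tail l) (Fin.tail γ) =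
        c • orderedProd (Fin.tail x) (Fin.tail l) γ' := hγ'
      rcases he with he | he
      · refine ⟨c, Fin.cons (γ 0) γ', ?_⟩
        rw [orderedProd_succ, Fin.cons_zero, Fin.tail_cons, he, Fin.val_zero, pow_zero, mul_one,
          ← mul_assoc, h1.eq, mul_assoc, hγ'', mul_smul_comm]
      · refine ⟨-c, Fin.cons (γ 0) γ', ?_⟩
        rw [orderedProd_succ, Fin.cons_zero, Fin.tail_cons, he, Fin.val_one, pow_one,
          ← mul_assoc, ← mul_assoc, h1.eq, mul_assoc (x 0 ^ _), eq_neg_of_add_eq_zero_left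
          (hll i.succ 0), mul_neg, neg_mul, ← mul_assoc, mul_assoc _ (l i.succ), hγ'',
          mul_smul_comm, neg_smul]

end OrderedProd

variable {n : ℕ} {x : Fin n → H} {z : H} {l : Fin n → H}

/-- The monomials in the generators. -/
def monomials (x : Fin n → H) (z : H) (l : Fin n → H) (g : ℕ × (Fin n → ℕ × Fin 2)) : H :=
  z ^ g.1 * orderedProd x l g.2

theorem l_mul_pow (h : GenRel x z l) (i : Fin n) (c : ℕ) :
    l i * z ^ c = (-1 : k) ^ c • (z ^ c * l i) := by
  induction c with
  | zero => simp
  | succ c ih =>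
    have := eq_neg_of_add_eq_zero_right (h.z_l i)
    rw [pow_succ, ← mul_assoc, ih, smul_mul_assoc, mul_assoc, this, mul_neg, pow_succ, mul_neg_one,
      neg_smul, smul_neg, mul_assoc]

/-- The span of the monomials contains 1 and is stable under left multiplication by each generator,
hence by the whole algebra. -/
theorem span_monomials_eq_top (h : GenRel x z l)
    (hgen : Algebra.adjoin k (Set.range x ∪ {z} ∪ Set.range l) = ⊤) :
    Submodule.span k (Set.range (monomials x z l)) = ⊤ := by
  rw [eq_top_iff]
  have hmem : ∀ g, monomials x z l g ∈ Submodule.span k (Set.range (monomials x z l)) :=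
    fun g => Submodule.subset_span ⟨g, rfl⟩
  have key : ∀ y ∈ Algebra.adjoin k (Set.range x ∪ {z} ∪ Set.range l),
      ∀ w ∈ Submodule.span k (Set.range (monomials x z l)),
        y * w ∈ Submodule.span k (Set.range (monomials x z l)) := by
    intro y hy
    induction hy using Algebra.adjoin_induction with
    | mem y hy =>
      intro w hw
      induction hw using Submodule.span_induction with
      | zero => simp
      | add a b _ _ ha hb => rw [mul_add]; exact add_mem ha hb
      | smul c a _ ha => rw [mul_smul_comm]; exact Submodule.smul_mem _ _ ha
      | mem w hw =>
        obtain ⟨⟨c, γ⟩, rfl⟩ := hw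
        rcases hy with (⟨i, rfl⟩ | rfl) | ⟨i, rfl⟩
        · obtain ⟨γ', hγ'⟩ := x_mul_orderedProd h.x_comm h.x_l i γ
          have : x i * monomials x z l (c, γ) = monomials x z l (c, γ') := by
            have hc : Commute (x i) (z ^ c) := Commute.pow_right (h.x_z i) c
            rw [monomials, ← mul_assoc, hc.eq, mul_assoc, hγ', monomials]
          rw [this]
          exact hmem _
        · have : y * monomials x y l (c, γ) = monomials x y l (c + 1, γ) := by
            rw [monomials, monomials, pow_succ', mul_assoc]
          rw [this]
          exact hmem _
        · obtain ⟨b, γ', hγ'⟩ := l_mul_orderedProd (k := k) h.x_l h.l_sq h.l_anti i γ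
          have : l i * monomials x z l (c, γ) =
              ((-1 : k) ^ c * b) • monomials x z l (c, γ') := by
            rw [monomials, ← mul_assoc, h.l_mul_pow (k := k), smul_mul_assoc, mul_assoc, hγ',
              mul_smul_comm, smul_smul, monomials]
          rw [this]
          exact Submodule.smul_mem _ _ (hmem _)
    | algebraMap c =>
      intro w hw
      rw [← Algebra.smul_def]
      exact Submodule.smul_mem _ _ hw
    | add a b _ _ ha hb =>
      intro w hw
      rw [add_mul]
      exact add_mem (ha w hw) (hb w hw)
    | mul a b _ _ ha hb =>
      intro w hw
      rw [mul_assoc]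
      exact ha _ (hb w hw)
  intro y _
  have h1 : (1 : H) ∈ Submodule.span k (Set.range (monomials x z l)) := by
    have := hmem (0, fun _ => (0, 0))
    simpa [monomials, orderedProd] using this
  simpa using key y (hgen ▸ Algebra.mem_top) 1 h1

/-- Square-zero is required for every vector, not just the basis vectors, by the universal property
of the exterior algebra. The cross terms cancel in pairs. -/
theorem sum_sq (h : GenRel x z l) (v : Fin n → k) (s : Finset (Fin n)) :
    (∑ i ∈ s, v i • l i) * (∑ i ∈ s, v i • l i) = 0 := by
  classical
  induction s using Finset.induction_on with
  | empty => simp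
  | insert i s hi ih =>
    rw [Finset.sum_insert hi, add_mul, mul_add, mul_add, ih, add_zero, smul_mul_smul_comm, h.l_sq,
      smul_zero, zero_add, Finset.mul_sum, Finset.sum_mul, ← Finset.sum_add_distrib]
    refine Finset.sum_eq_zero fun j _ => ?_
    rw [smul_mul_smul_comm, smul_mul_smul_comm, mul_comm (v j), ← smul_add, h.l_anti, smul_zero]

end GenRel

/-! ### The universal property and bases of the graded tensor product. -/

section Lift

variable {k : Type u} [Field k] {n : ℕ+} {H : Type v} [Ring H] [Algebra k H]
  {x : Fin n → H} {z : H} {l : Fin n → H}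

theorem units_smul (c : ℕ) (y : H) : ((-1 : ℤˣ) ^ c) • y = ((-1 : k) ^ c) • y := by
  rcases Nat.even_or_odd c with h | h
  · rw [h.neg_one_pow, h.neg_one_pow, one_smul, one_smul]
  · rw [h.neg_one_pow, h.neg_one_pow, Units.neg_smul, one_smul, neg_one_smul]

/-- Evaluation of polynomials in commuting elements. -/
theorem exists_aeval {τ : Type*} (g : τ → H) (hg : ∀ i j, g i * g j = g j * g i) :
    ∃ f : MvPolynomial τ k →ₐ[k] H, ∀ i, f (MvPolynomial.X i) = g i := by
  have hcomm := Algebra.isMulCommutative_adjoin (s := Set.range g) k (by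
    rintro _ ⟨i, rfl⟩ _ ⟨j, rfl⟩
    exact hg i j)
  open scoped IsMulCommutative in
  exact ⟨(Algebra.adjoin k (Set.range g)).val.comp (MvPolynomial.aeval fun i =>
    (⟨g i, Algebra.subset_adjoin ⟨i, rfl⟩⟩ : Algebra.adjoin k (Set.range g))),
    fun i => by simp⟩

/-- Maps from the two factors combine when homogeneous images commute up to the Koszul sign. This is
checked on monomials against λ-vectors, then on homogeneous polynomials, then by induction on the
exterior degree. -/
theorem GenRel.exists_lift (h : GenRel x z l) : ∃ Φ : PolyExt k n →ₐ[k] H,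
    (∀ i, Φ (PolyExt.x k i) = x i) ∧ Φ (PolyExt.ζ k n) = z ∧ ∀ i, Φ (PolyExt.lam k i) = l i := by
  obtain ⟨f, hf⟩ := exists_aeval (k := k) (Sum.elim x fun _ : Unit => z) (by
    rintro (i | i) (j | j)
    · exact h.x_comm i j
    · exact h.x_z i
    · exact (h.x_z j).symm
    · rfl)
  have hφ : ∀ v : Fin n → k, Fintype.linearCombination k l v = ∑ i, v i • l i := fun v => rfl
  let g : ExteriorAlgebra k (Fin n → k) →ₐ[k] H := ExteriorAlgebra.lift k
    ⟨Fintype.linearCombination k l, fun v => by rw [hφ, h.sum_sq]⟩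
  have hg : ∀ v, g (ExteriorAlgebra.ι k v) = ∑ i, v i • l i := fun v => by
    rw [ExteriorAlgebra.lift_ι_apply]
    rfl
  have h1 : ∀ (a : (Fin n ⊕ Unit) →₀ ℕ) (v : Fin n → k),
      f (MvPolynomial.monomial a 1) * g (ExteriorAlgebra.ι k v) =
        (-1 : k) ^ (Finsupp.weight (Sum.elim (fun _ => 2) (fun _ => 1) : Fin n ⊕ Unit → ℕ) a) •
          (g (ExteriorAlgebra.ι k v) * f (MvPolynomial.monomial a 1)) := by
    intro a v
    induction a using Finsupp.induction_linear with
    | zero =>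
      change f 1 * _ = _ • (_ * f 1)
      simp
    | add a b ha hb =>
      have : (MvPolynomial.monomial (a + b) (1 : k) : MvPolynomial (Fin n ⊕ Unit) k) =
        MvPolynomial.monomial a 1 * MvPolynomial.monomial b 1 := by
        rw [MvPolynomial.monomial_mul, one_mul]
      rw [this, map_mul, mul_assoc, hb, mul_smul_comm, ← mul_assoc, ha, smul_mul_assoc, smul_smul,
        map_add, pow_add, mul_comm, mul_assoc]
    | single i c =>
      rw [← MvPolynomial.X_pow_eq_monomial, map_pow, hf, Finsupp.weight_single, hg]
      -- A power of x_i has even weight and commutes with the λ's, while each factor ζ contributes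
      -- one sign.
      rcases i with i | i
      · have hc : Commute (x i ^ c) (∑ j, v j • l j) := by
          refine Commute.pow_left ?_ c
          refine Commute.sum_right _ _ _ fun j _ => ?_
          exact Commute.smul_right (h.x_l i j) (v j)
        rw [Sum.elim_inl, Sum.elim_inl, hc.eq, smul_eq_mul, mul_comm c 2, pow_mul]
        simp
      · rw [Sum.elim_inr, Sum.elim_inr, Finset.mul_sum, Finset.sum_mul, Finset.smul_sum]
        refine Finset.sum_congr rfl fun j _ => ?_
        rw [smul_mul_assoc, h.l_mul_pow (k := k), mul_smul_comm, smul_comm (v j), smul_smul,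
          smul_eq_mul, mul_one, ← mul_pow]
        simp
  have h2 : ∀ (i : ℕ) (a : MvPolynomial (Fin n ⊕ Unit) k), a ∈ polyGrading k n i →
      ∀ v, f a * g (ExteriorAlgebra.ι k v) =
        (-1 : k) ^ i • (g (ExteriorAlgebra.ι k v) * f a) := by
    intro i a ha v
    rw [a.as_sum, map_sum, Finset.sum_mul, Finset.mul_sum, Finset.smul_sum]
    refine Finset.sum_congr rfl fun d hd => ?_
    have hw : Finsupp.weight (Sum.elim (fun _ => 2) (fun _ => 1) : Fin n ⊕ Unit → ℕ) d = i :=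
      ha (MvPolynomial.mem_support_iff.mp hd)
    have : MvPolynomial.monomial d (a.coeff d) = a.coeff d • MvPolynomial.monomial d (1 : k) := by
      rw [MvPolynomial.smul_monomial, smul_eq_mul, mul_one]
    rw [this, map_smul, smul_mul_assoc, h1, hw, mul_smul_comm, smul_comm]
  have h3 : ∀ (i j : ℕ) (a : MvPolynomial (Fin n ⊕ Unit) k), a ∈ polyGrading k n i →
      ∀ b ∈ extGrading k n j, f a * g b = (-1 : k) ^ (j * i) • (g b * f a) := by
    intro i j a ha b hb
    induction hb using Submodule.pow_induction_on_left' with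
    | algebraMap c => simp [Algebra.commutes]
    | add b b' j _ _ hb hb' => rw [map_add, mul_add, add_mul, hb, hb', smul_add]
    | mem_mul m hm j b hb hb' =>
      obtain ⟨v, rfl⟩ := hm
      rw [map_mul, ← mul_assoc, h2 i a ha, smul_mul_assoc, mul_assoc, hb', mul_smul_comm,
        smul_smul, mul_assoc, ← pow_add]
      congr 2
      rw [Nat.succ_eq_add_one]
      ring
  refine ⟨GradedTensorProduct.lift _ _ f g fun i j a b => ?_, fun i => ?_, ?_, fun i => ?_⟩
  · rw [h3 i j a a.2 b b.2]
    exact (units_smul _ _).symm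
  · rw [PolyExt.x, GradedTensorProduct.lift_tmul, hf, map_one, mul_one, Sum.elim_inl]
  · rw [PolyExt.ζ, GradedTensorProduct.lift_tmul, hf, map_one, mul_one, Sum.elim_inr]
  · rw [PolyExt.lam, GradedTensorProduct.lift_tmul, hg, map_one, one_mul,
      Finset.sum_eq_single i]
    · simp
    · intro j _ hj
      simp [Pi.single_eq_of_ne hj]
    · simp

namespace PolyExt

variable (k n) in
theorem tmul_sign (i j : ℕ) {a : MvPolynomial (Fin n ⊕ Unit) k} (ha : a ∈ polyGrading k n i)
    {b : ExteriorAlgebra k (Fin n → k)} (hb : b ∈ extGrading k n j) :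
    (GradedTensorProduct.tmul k 1 b * GradedTensorProduct.tmul k a 1 : PolyExt k n) =
      (-1 : k) ^ (j * i) • (GradedTensorProduct.tmul k a 1 * GradedTensorProduct.tmul k 1 b) := by
  have h := GradedTensorProduct.tmul_coe_mul_coe_tmul (R := k) (polyGrading k n) (extGrading k n)
    1 ⟨b, hb⟩ ⟨a, ha⟩ 1
  rw [GradedTensorProduct.tmul_one_mul_one_tmul]
  refine h.trans ?_
  rw [mul_one, one_mul]
  exact units_smul _ _

theorem X_inl_mem (i : Fin n) : MvPolynomial.X (Sum.inl i) ∈ polyGrading k n 2 :=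
  MvPolynomial.isWeightedHomogeneous_X _ _ _

theorem X_inr_mem : MvPolynomial.X (Sum.inr ()) ∈ polyGrading k n 1 :=
  MvPolynomial.isWeightedHomogeneous_X _ _ _

theorem ι_mem (v : Fin n → k) : ExteriorAlgebra.ι k v ∈ extGrading k n 1 := by
  rw [extGrading, ExteriorAlgebra.exteriorPower, pow_one]
  exact ⟨v, rfl⟩

theorem tmul_one_mul (a b : MvPolynomial (Fin n ⊕ Unit) k) :
    (GradedTensorProduct.tmul k a 1 * GradedTensorProduct.tmul k b 1 : PolyExt k n) =
      GradedTensorProduct.tmul k (a * b) 1 :=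
  (map_mul (GradedTensorProduct.includeLeft (polyGrading k n) (extGrading k n)) a b).symm

theorem one_tmul_mul (a b : ExteriorAlgebra k (Fin n → k)) :
    (GradedTensorProduct.tmul k 1 a * GradedTensorProduct.tmul k 1 b : PolyExt k n) =
      GradedTensorProduct.tmul k 1 (a * b) :=
  (map_mul (GradedTensorProduct.includeRight (polyGrading k n) (extGrading k n)) a b).symm

variable (k n) in
theorem genRel : GenRel (PolyExt.x k (n := n)) (ζ k n) (PolyExt.lam k) where
  x_comm i j := by rw [PolyExt.x, PolyExt.x, tmul_one_mul, tmul_one_mul, mul_comm]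
  x_z i := by rw [PolyExt.x, ζ, tmul_one_mul, tmul_one_mul, mul_comm]
  x_l i j := by
    rw [PolyExt.x, lam, tmul_sign k n 2 1 (X_inl_mem i) (ι_mem _)]
    simp
  l_sq i := by
    rw [lam, one_tmul_mul, ExteriorAlgebra.ι_sq_zero]
    exact map_zero (GradedTensorProduct.includeRight (polyGrading k n) (extGrading k n))
  l_anti i j := by
    rw [lam, lam, one_tmul_mul, one_tmul_mul]
    refine (map_add (GradedTensorProduct.includeRight (polyGrading k n) (extGrading k n))
      _ _).symm.trans ?_
    rw [ExteriorAlgebra.ι_add_mul_swap, map_zero]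
  z_l i := by
    rw [ζ, lam, tmul_sign k n 1 1 X_inr_mem (ι_mem _)]
    simp

variable (k n) in
theorem adjoin_eq_top : Algebra.adjoin k (Set.range (PolyExt.x k (n := n)) ∪ {ζ k n} ∪
    Set.range (PolyExt.lam k (n := n))) = ⊤ := by
  set S := Algebra.adjoin k (Set.range (PolyExt.x k (n := n)) ∪ {ζ k n} ∪
    Set.range (PolyExt.lam k (n := n))) with hS
  have hl : ∀ a : MvPolynomial (Fin n ⊕ Unit) k,
      (GradedTensorProduct.tmul k a 1 : PolyExt k n) ∈ S := by
    have : S.comap (GradedTensorProduct.includeLeft (polyGrading k n) (extGrading k n)) = ⊤ := by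
      rw [eq_top_iff, ← MvPolynomial.adjoin_range_X, Algebra.adjoin_le_iff]
      rintro _ ⟨i | i, rfl⟩
      · exact Algebra.subset_adjoin (Or.inl (Or.inl ⟨i, rfl⟩))
      · exact Algebra.subset_adjoin (Or.inl (Or.inr rfl))
    intro a
    have ha : a ∈ S.comap (GradedTensorProduct.includeLeft (polyGrading k n) (extGrading k n)) :=
      this ▸ Algebra.mem_top
    exact ha
  have hr : ∀ b : ExteriorAlgebra k (Fin n → k),
      (GradedTensorProduct.tmul k 1 b : PolyExt k n) ∈ S := by
    intro b
    change GradedTensorProduct.includeRight (polyGrading k n) (extGrading k n) b ∈ S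
    induction b using ExteriorAlgebra.induction with
    | algebraMap r => rw [AlgHom.commutes]; exact S.algebraMap_mem r
    | ι v =>
      have : v = ∑ i, v i • (Pi.single i 1 : Fin n → k) := by
        funext j
        simp [Finset.sum_apply, Pi.single_apply]
      rw [this, map_sum, map_sum]
      refine sum_mem fun i _ => ?_
      rw [map_smul, map_smul]
      exact S.smul_mem (Algebra.subset_adjoin (Or.inr ⟨i, rfl⟩)) _
    | mul a b ha hb => rw [map_mul]; exact mul_mem ha hb
    | add a b ha hb => rw [map_add]; exact add_mem ha hb
  rw [eq_top_iff]
  intro y _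
  obtain ⟨y, rfl⟩ := (GradedTensorProduct.of k (polyGrading k n) (extGrading k n)).surjective y
  induction y using TensorProduct.induction_on with
  | zero => rw [map_zero]; exact zero_mem _
  | add a b ha hb => rw [map_add]; exact add_mem (ha trivial) (hb trivial)
  | tmul a b =>
    have : (GradedTensorProduct.of k (polyGrading k n) (extGrading k n)) (a ⊗ₜ[k] b) =
      (GradedTensorProduct.tmul k a 1 * GradedTensorProduct.tmul k 1 b : PolyExt k n) :=
      (GradedTensorProduct.tmul_one_mul_one_tmul _ _ _ _).symm
    rw [this]
    exact mul_mem (hl a) (hr b)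

end PolyExt

/-- The monomials of the model algebra span it and map to a basis. Independence of the images gives
injectivity, so independence of the monomials in the model itself need not be known beforehand. -/
theorem GenRel.exists_algEquiv (h : GenRel x z l)
    (hli : LinearIndependent k (GenRel.monomials x z l))
    (hsp : ⊤ ≤ Submodule.span k (Set.range (GenRel.monomials x z l))) :
    ∃ φ : PolyExt k n ≃ₐ[k] H, (∀ i, φ (PolyExt.x k i) = x i) ∧ φ (PolyExt.ζ k n) = z ∧
      ∀ i, φ (PolyExt.lam k i) = l i := by
  obtain ⟨Φ, hx, hz, hl⟩ := h.exists_lift (k := k)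
  have hΦ : ∀ g, Φ (GenRel.monomials (PolyExt.x k) (PolyExt.ζ k n) (PolyExt.lam k) g) =
      GenRel.monomials x z l g := by
    intro g
    rw [GenRel.monomials, map_mul, map_pow, hz, map_orderedProd, GenRel.monomials]
    congr 2
    · exact funext hx
    · exact funext hl
  have htop := (PolyExt.genRel k n).span_monomials_eq_top (PolyExt.adjoin_eq_top k n)
  have hinj : Function.Injective Φ := by
    rw [injective_iff_map_eq_zero]
    intro y hy
    have hmem : y ∈ Submodule.span k (Set.range (GenRel.monomials (PolyExt.x k) (PolyExt.ζ k n)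
      (PolyExt.lam k))) := htop ▸ Submodule.mem_top
    obtain ⟨c, rfl⟩ := (Finsupp.mem_span_range_iff_exists_finsupp).mp hmem
    have : Finsupp.linearCombination k (GenRel.monomials x z l) c = 0 := by
      rw [← hy, Finsupp.linearCombination_apply, Finsupp.sum, Finsupp.sum, map_sum]
      simp only [map_smul, hΦ]
    rw [(linearIndependent_iff.mp hli) c this, Finsupp.sum_zero_index]
  have hsurj : Function.Surjective Φ := by
    have : ⊤ ≤ LinearMap.range Φ.toLinearMap := by
      refine hsp.trans (Submodule.span_le.mpr ?_)
      rintro _ ⟨g, rfl⟩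
      exact ⟨_, hΦ g⟩
    intro y
    exact this trivial
  exact ⟨AlgEquiv.ofBijective Φ ⟨hinj, hsurj⟩, hx, hz, hl⟩

end Lift

end WittElementary

end SupergroupAlgebra

end

noncomputable section

namespace SupergroupAlgebra

/-! ### Products and pullbacks of classes. -/

section Classes

variable {k : Type u} {A : Type v} [Field k] [CommRing A] [Algebra k A]
  [Module.Finite k A] {ε : A →ₐ[k] k}

theorem classOf_eq_iff {z w : Cochains k A} (hz : d ε z = 0) (hw : d ε w = 0) :
    classOf z hz = classOf w hw ↔ ∃ u, d ε u = z - w := by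
  rw [← sub_eq_zero]
  change cls ε _ - cls ε _ = 0 ↔ _
  rw [← map_sub]
  exact classOf_eq_zero_iff (by rw [map_sub, hz, hw, sub_zero])

theorem d_mul_eq_zero {z w : Cochains k A} (hz : d ε z = 0) (hw : d ε w = 0) :
    d ε (z * w) = 0 := by
  rw [d_mul, hz, hw, zero_mul, mul_zero, add_zero]

theorem d_add_eq_zero {z w : Cochains k A} (hz : d ε z = 0) (hw : d ε w = 0) :
    d ε (z + w) = 0 := by
  rw [map_add, hz, hw, add_zero]

theorem classOf_mul {z w : Cochains k A} (hz : d ε z = 0) (hw : d ε w = 0) :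
    classOf z hz * classOf w hw = classOf (z * w) (d_mul_eq_zero hz hw) := rfl

theorem classOf_add {z w : Cochains k A} (hz : d ε z = 0) (hw : d ε w = 0) :
    classOf z hz + classOf w hw = classOf (z + w) (d_add_eq_zero hz hw) := rfl

theorem classOf_monomials {r : ℕ} {x : Fin r → Cochains k A} {z : Cochains k A}
    {l : Fin r → Cochains k A} (hx : ∀ i, d ε (x i) = 0) (hz : d ε z = 0)
    (hl : ∀ i, d ε (l i) = 0) (g : ℕ × (Fin r → ℕ × Fin 2))
    (h : d ε (WittElementary.GenRel.monomials x z l g) = 0) :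
    classOf (WittElementary.GenRel.monomials x z l g) h =
      WittElementary.GenRel.monomials (fun i => classOf (x i) (hx i)) (classOf z hz)
        (fun i => classOf (l i) (hl i)) g := by
  let x' : Fin r → Cocycles ε := fun i => ⟨x i, hx i⟩
  let z' : Cocycles ε := ⟨z, hz⟩
  let l' : Fin r → Cocycles ε := fun i => ⟨l i, hl i⟩
  have h1 : (Cocycles ε).val (WittElementary.GenRel.monomials x' z' l' g) =
      WittElementary.GenRel.monomials x z l g := by
    rw [WittElementary.GenRel.monomials, map_mul, map_pow, map_orderedProd]
    rfl
  have h2 : cls ε (WittElementary.GenRel.monomials x' z' l' g) =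
      WittElementary.GenRel.monomials (fun i => classOf (x i) (hx i)) (classOf z hz)
        (fun i => classOf (l i) (hl i)) g := by
    rw [WittElementary.GenRel.monomials, map_mul, map_pow, map_orderedProd]
    rfl
  rw [← h2, classOf]
  congr 1
  exact Subtype.ext h1.symm

variable {B : Type w} [CommRing B] [Algebra k B]

theorem pull_form (φ : A →ₐ[k] B) (f : B →ₗ[k] k) :
    pull φ (form f) = form (f ∘ₗ φ.toLinearMap) := by
  rw [form_eq, pull_lof, form_eq]
  rfl

theorem pull_biform (φ : A →ₐ[k] B) (β : B →ₗ[k] B →ₗ[k] k) :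
    pull φ (biform β) = biform (β.compl₁₂ φ.toLinearMap φ.toLinearMap) := by
  rw [biform_eq, pull_lof, biform_eq]
  rfl

end Classes

namespace WittElementary

/-! ### The cohomology algebra of the supergroup scheme. -/

namespace GroupAlg

open SupergroupAlgebra.WittElementary.EvenAlg (top Reduced)

variable {k : Type u} [Field k] {p : ℕ} {m n : ℕ+} [Fact p.Prime] [CharP k p]

/-- The cocycles of the basis of the cohomology algebra. -/
def basisCocycle (c : Fin n → k) (g : ℕ × (Fin n → ℕ × Fin 2)) :
    Cochains k (GroupAlg k p m n) :=
  GenRel.monomials (fun i => biform (xbil (c i) i)) (form (zet k p m n))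
    (fun i => form (lam k p m n i)) g

/-- The cohomological degree of the basis elements. -/
def basisDeg (g : ℕ × (Fin n → ℕ × Fin 2)) : ℕ := g.1 + ∑ i, (2 * (g.2 i).1 + ((g.2 i).2 : ℕ))

/-- The chain of the s_i is followed by the step for σ, whose polynomial generator ζ² and exterior
generator ζ merge into powers of ζ. -/
theorem isModel_basisCocycle (c : Fin n → k) : IsModel (aug k (GroupAlg k p m n))
    (RingHom.ker (aug k (GroupAlg k p m n))) basisDeg (basisCocycle (m := m) (p := p) c) := by
  have h1 := isModel_orderedProd (sIdeal k p m n) (s k p m n) (trunc p m n) (lam k p m n)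
    (fun i => form ∘ₗ xbil (c i) i) sIdeal_last sIdeal_castSucc (fun i => stepData_s (c i) i)
  have h2 := h1.step stepData_σ
  rw [sIdeal_sup_span_σ] at h2
  -- Division by 2 with remainder identifies ζ^c with (ζ²)^(c / 2) ζ^(c % 2).
  let E : ℕ × (Fin n → ℕ × Fin 2) ≃ ℕ × Fin 2 × (Fin n → ℕ × Fin 2) :=
    ((Nat.divModEquiv 2).prodCongr (Equiv.refl _)).trans (Equiv.prodAssoc _ _ _)
  have hE : ∀ g, E g = (g.1 / 2, Fin.ofNat 2 g.1, g.2) := fun g => rfl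
  have hval : ∀ a : ℕ, ((Fin.ofNat 2 a : Fin 2) : ℕ) = a % 2 := fun a => rfl
  refine h2.reindex E (fun g => ?_) (fun g => ?_)
  · rw [hE, basisDeg, stepDeg, hval]
    dsimp only
    omega
  · rw [hE, basisCocycle, GenRel.monomials, stepFam, prep_form_comp, hval, biform_zetSq]
    simp only [prep_form_comp]
    rw [← pow_two, ← pow_mul, ← pow_add, Nat.div_add_mod]

variable (k p m n) in
/-- The class `ζ`. -/
def zetCls : Cohomology k (GroupAlg k p m n) := classOf (form (zet k p m n)) d_zet

variable (k p m n) in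
/-- The classes `λ_i`. -/
def lamCls (i : Fin n) : Cohomology k (GroupAlg k p m n) := classOf (form (lam k p m n i)) (d_lam i)

variable (k p m n) in
/-- The classes of the cocycles `ε χ_i`. -/
def chiCls (i : Fin n) : Cohomology k (GroupAlg k p m n) :=
  classOf (biform (chiAug k p m n i)) (d_chiAug i)

variable (p m) in
/-- The classes of the cocycles `c ζ² - ε χ_i`. -/
def xCls (c : k) (i : Fin n) : Cohomology k (GroupAlg k p m n) :=
  classOf (biform (xbil c i)) (d_xbil c i)

theorem xCls_eq (c : k) (i : Fin n) :
    xCls p m c i = c • (zetCls k p m n * zetCls k p m n) - chiCls k p m n i := by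
  have h : ∀ z w : Cocycles (aug k (GroupAlg k p m n)),
      c • cls _ z - cls _ w = cls _ (c • z - w) := fun z w => by rw [map_sub, map_smul]
  rw [zetCls, classOf_mul, chiCls]
  refine Eq.trans ?_ (h _ _).symm
  rw [xCls, classOf]
  congr 1
  apply Subtype.ext
  change biform (xbil c i) = c • (form (zet k p m n) * form (zet k p m n)) -
    biform (chiAug k p m n i)
  rw [biform_xbil, biform_zetSq]

/-- On a cocycle z the commutator with ε ∘ χ_i is the differential of the inner-face sum for χ_i
applied to z. -/
theorem chiCls_comm (i : Fin n) (h : Cohomology k (GroupAlg k p m n)) :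
    Commute (chiCls k p m n i) h := by
  obtain ⟨z, hz, rfl⟩ := exists_classOf h
  change _ * _ = _ * _
  rw [chiCls, classOf_mul, classOf_mul, eq_comm, classOf_eq_iff]
  refine ⟨bilinInner (chi k p m n i) z, ?_⟩
  have := d_bilinInner (aug k (GroupAlg k p m n)) (chi k p m n i) (chi_hochschild i) z
  rw [hz, map_zero, add_zero] at this
  exact this

theorem d_der (c : Fin n → k) (c' : k) :
    d (aug k (GroupAlg k p m n)) (form (der c c')) = 0 := d_form_eq_zero _ (der_mul _ _)

/-- The coefficient of ηθ is, up to sign, a primitive of the anticommutator. The condition on c' and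
b' excludes the square of ζ, which is nonzero. -/
theorem classOf_der_anticomm (hp : 3 ≤ p) (c b : Fin n → k) (c' b' : k) (h : c' * b' = 0) :
    classOf (form (der c c')) (d_der (p := p) (m := m) c c') *
        classOf (form (der b b')) (d_der b b') +
      classOf (form (der b b')) (d_der b b') * classOf (form (der c c')) (d_der c c') = 0 := by
  obtain ⟨f, hf⟩ := exists_der_anticomm (k := k) (m := m) hp c b c' b' h
  rw [classOf_mul, classOf_mul, classOf_add, classOf_eq_zero_iff]
  refine ⟨form (-f), ?_⟩
  rw [form_mul_form, form_mul_form, ← map_add]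
  refine d_form_eq _ _ _ fun x y => ?_
  simp [hf]
  ring

theorem two_ne_zero_of_char (hp : 3 ≤ p) : (2 : k) ≠ 0 := by
  intro h
  have : ((2 : ℕ) : k) = 0 := by exact_mod_cast h
  rw [CharP.cast_eq_zero_iff k p] at this
  have := Nat.le_of_dvd two_pos this
  omega

/-- Centrality of χ_i reduces relations for x_i to those for ζ², which commutes with λ_j because two
signs cancel. The squares of the λ_i vanish since anticommutation gives 2λ_i² = 0 and p is odd. -/
theorem genRel_classes (hp : 3 ≤ p) (c : Fin n → k) : GenRel (fun i => xCls p m (c i) i)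
    (zetCls k p m n) (lamCls k p m n) := by
  have hzl : ∀ i, zetCls k p m n * lamCls k p m n i + lamCls k p m n i * zetCls k p m n = 0 :=
    fun i => classOf_der_anticomm hp _ _ _ _ (by simp)
  have hx : ∀ i y, Commute (zetCls k p m n * zetCls k p m n) y → Commute (xCls p m (c i) i) y := by
    intro i y hy
    rw [xCls_eq]
    exact (hy.smul_left _).sub_left (chiCls_comm i y)
  have hz : Commute (zetCls k p m n * zetCls k p m n) (zetCls k p m n) :=
    (Commute.refl _).mul_left (Commute.refl _)
  have hl : ∀ i, Commute (zetCls k p m n * zetCls k p m n) (lamCls k p m n i) := by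
    intro i
    have h1 := eq_neg_of_add_eq_zero_left (hzl i)
    change _ * _ = _ * _
    rw [mul_assoc, h1, mul_neg, ← mul_assoc, h1, neg_mul, neg_neg, mul_assoc]
  refine ⟨fun i j => (hx i _ ((hx j _ (hz.mul_right hz).symm.symm).symm)).eq,
    fun i => (hx i _ hz).eq, fun i j => (hx i _ (hl j)).eq, fun i => ?_, fun i j => ?_, hzl⟩
  · have h := classOf_der_anticomm (k := k) (m := m) hp (Pi.single i 1) (Pi.single i 1) 0 0
      (by simp)
    have h2 : (2 : k) • (lamCls k p m n i * lamCls k p m n i) = 0 := by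
      rw [two_smul]
      exact h
    exact (smul_eq_zero.mp h2).resolve_left (two_ne_zero_of_char hp)
  · exact classOf_der_anticomm hp _ _ _ _ (by simp)

theorem classOf_basisCocycle (c : Fin n → k) (g : ℕ × (Fin n → ℕ × Fin 2)) :
    classOf (basisCocycle (m := m) (p := p) c g) ((isModel_basisCocycle c).cocycle g) =
      GenRel.monomials (fun i => xCls p m (c i) i) (zetCls k p m n) (lamCls k p m n) g :=
  classOf_monomials (fun i => d_xbil (c i) i) d_zet d_lam g _

theorem linearIndependent_monomials (c : Fin n → k) : LinearIndependent k
    (GenRel.monomials (fun i => xCls p m (c i) i) (zetCls k p m n) (lamCls k p m n)) := by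
  have h := (isModel_basisCocycle (p := p) (m := m) c).linearIndependent
  simpa only [classOf_basisCocycle] using h

theorem span_monomials (c : Fin n → k) : ⊤ ≤ Submodule.span k (Set.range
    (GenRel.monomials (fun i => xCls p m (c i) i) (zetCls k p m n) (lamCls k p m n))) := by
  intro h _
  obtain ⟨b, rfl⟩ := (isModel_basisCocycle (p := p) (m := m) c).exists_linearCombination h
  simp only [classOf_basisCocycle]
  exact Finsupp.mem_span_range_iff_exists_finsupp.mpr ⟨b, rfl⟩

/-- Every choice of multiples of ζ² in the x_i gives an isomorphism. This freedom is used to match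
the standard classes at m = 1 and to make the inflation maps simple. -/
theorem exists_algEquiv (hp : 3 ≤ p) (c : Fin n → k) :
    ∃ φ : PolyExt k n ≃ₐ[k] Cohomology k (GroupAlg k p m n),
      (∀ i, φ (PolyExt.x k i) = xCls p m (c i) i) ∧ φ (PolyExt.ζ k n) = zetCls k p m n ∧
      ∀ i, φ (PolyExt.lam k i) = lamCls k p m n i :=
  (genRel_classes hp c).exists_algEquiv (linearIndependent_monomials c) (span_monomials c)

/-! ### Bidegrees of the generators. -/

section Degrees

theorem classOf_form_mem_bideg {t : ZMod 2} {f : GroupAlg k p m n →ₗ[k] k}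
    (hf : d (aug k (GroupAlg k p m n)) (form f) = 0)
    (h : ∀ s, ∀ a ∈ par k p m n s, s ≠ t → f a = 0) :
    classOf (form f) hf ∈ bideg k (GroupAlg k p m n) 1 t := by
  refine ⟨⟨form f, hf⟩, ⟨Cochain.ofMultilinear (MultilinearMap.ofSubsingleton k _ k (0 : Fin 1) f),
    fun s a ha hs => ?_, rfl⟩, rfl⟩
  exact h (s 0) (a 0) (ha 0) (by simpa using hs)

theorem classOf_biform_mem_bideg {t : ZMod 2} {B : GroupAlg k p m n →ₗ[k] GroupAlg k p m n →ₗ[k] k}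
    (hB : d (aug k (GroupAlg k p m n)) (biform B) = 0)
    (h : ∀ s s', ∀ a ∈ par k p m n s, ∀ b ∈ par k p m n s', s + s' ≠ t → B a b = 0) :
    classOf (biform B) hB ∈ bideg k (GroupAlg k p m n) 2 t := by
  refine ⟨⟨biform B, hB⟩, ⟨bilinCochain B, fun s a ha hs => ?_, rfl⟩, rfl⟩
  rw [bilinCochain_apply]
  exact h _ _ _ (ha 0) _ (ha 1) (by simpa [Fin.sum_univ_two] using hs)

/-- Each homogeneous part is spanned by the monomials of its parity, so vanishing of forms can be
tested on monomials. -/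
theorem par_induction {P : ZMod 2 → GroupAlg k p m n → Prop}
    (hmon : ∀ α (e : Fin 2), Reduced p m n α → P ((e : ℕ) : ZMod 2) (mon k p m n α e))
    (h0 : ∀ t, P t 0) (hadd : ∀ t a b, P t a → P t b → P t (a + b))
    (hsmul : ∀ t (c : k) a, P t a → P t (c • a)) : ∀ t, ∀ a ∈ par k p m n t, P t a := by
  let S (t : ZMod 2) : Submodule k (GroupAlg k p m n) :=
    { carrier := {a | P t a}
      add_mem' := fun ha hb => hadd t _ _ ha hb
      zero_mem' := h0 t
      smul_mem' := fun c a ha => hsmul t c a ha }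
  refine mem_par_cases (P := P) (fun b => ?_) (fun b => ?_)
  · have : (S 0).mkQ ∘ₗ ev k p m n = 0 := EvenAlg.linearMap_ext fun α hα => by
      rw [LinearMap.comp_apply, LinearMap.zero_apply, Submodule.mkQ_apply,
        Submodule.Quotient.mk_eq_zero]
      exact_mod_cast hmon α 0 hα
    exact (Submodule.Quotient.mk_eq_zero (S 0)).mp (DFunLike.congr_fun this b)
  · have : (S 1).mkQ ∘ₗ od k p m n = 0 := EvenAlg.linearMap_ext fun α hα => by
      rw [LinearMap.comp_apply, LinearMap.zero_apply, Submodule.mkQ_apply,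
        Submodule.Quotient.mk_eq_zero]
      exact_mod_cast hmon α 1 hα
    exact (Submodule.Quotient.mk_eq_zero (S 1)).mp (DFunLike.congr_fun this b)

theorem lamCls_mem_bideg (i : Fin n) : lamCls k p m n i ∈ bideg k (GroupAlg k p m n) 1 0 := by
  refine classOf_form_mem_bideg _ (par_induction (fun α e hα h => ?_) ?_ ?_ ?_)
  · rw [lam_mon, if_neg]
    rintro ⟨-, rfl⟩
    exact h rfl
  · simp
  · intro t a b ha hb h; rw [map_add, ha h, hb h, add_zero]
  · intro t c a ha h; rw [map_smul, ha h, smul_zero]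

theorem zet_eq_zero_of_mem_par : ∀ t, ∀ a ∈ par k p m n t, t ≠ 1 → zet k p m n a = 0 := by
  refine par_induction (fun α e hα h => ?_) ?_ ?_ ?_
  · rw [zet_mon, if_neg]
    rintro ⟨-, rfl⟩
    exact h (by simp)
  · simp
  · intro t a b ha hb h; rw [map_add, ha h, hb h, add_zero]
  · intro t c a ha h; rw [map_smul, ha h, smul_zero]

theorem zetCls_mem_bideg : zetCls k p m n ∈ bideg k (GroupAlg k p m n) 1 1 :=
  classOf_form_mem_bideg _ zet_eq_zero_of_mem_par

theorem chiAug_eq_zero_of_mem_par (i : Fin n) : ∀ t, ∀ a ∈ par k p m n t, ∀ t',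
    ∀ b ∈ par k p m n t', t + t' ≠ 0 → chiAug k p m n i a b = 0 := by
  refine par_induction (fun α e hα => par_induction (fun β f hβ h => ?_) ?_ ?_ ?_) ?_ ?_ ?_
  · rw [chiAug_mon i hα hβ, if_neg]
    rintro ⟨-, h'⟩
    apply h
    have he : e = 0 ∨ e = 1 := by omega
    have hf : f = 0 ∨ f = 1 := by omega
    rcases he with rfl | rfl <;> rcases hf with rfl | rfl
    · simp
    · simp at h'
    · simp at h'
    · rfl
  · simp
  · intro t a b ha hb h; rw [map_add, ha h, hb h, add_zero]
  · intro t c a ha h; rw [map_smul, ha h, smul_zero]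
  · intro t t' b hb h; rw [map_zero, LinearMap.zero_apply]
  · intro t a b ha hb t' y hy h
    rw [map_add, LinearMap.add_apply, ha _ y hy h, hb _ y hy h, add_zero]
  · intro t c a ha t' y hy h
    rw [map_smul, LinearMap.smul_apply, ha _ y hy h, smul_zero]

theorem chiCls_mem_bideg (i : Fin n) : chiCls k p m n i ∈ bideg k (GroupAlg k p m n) 2 0 :=
  classOf_biform_mem_bideg _ fun s s' a ha b hb h => chiAug_eq_zero_of_mem_par i s a ha s' b hb h

theorem zetCls_mul_zetCls_mem_bideg :
    zetCls k p m n * zetCls k p m n ∈ bideg k (GroupAlg k p m n) 2 0 := by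
  have h : zetCls k p m n * zetCls k p m n = classOf (biform (zetSq k p m n)) d_zetSq := by
    rw [zetCls, classOf_mul]
    congr 1
    exact biform_zetSq.symm
  rw [h]
  refine classOf_biform_mem_bideg _ fun s s' a ha b hb h => ?_
  rw [zetSq_apply]
  by_cases hs : s = 1
  · by_cases hs' : s' = 1
    · subst hs hs'
      exact absurd rfl h
    · rw [zet_eq_zero_of_mem_par s' b hb hs', mul_zero]
  · rw [zet_eq_zero_of_mem_par s a ha hs, zero_mul]

theorem xCls_mem_bideg (c : k) (i : Fin n) :
    xCls p m c i ∈ bideg k (GroupAlg k p m n) 2 0 := by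
  rw [xCls_eq]
  exact sub_mem (Submodule.smul_mem _ _ zetCls_mul_zetCls_mem_bideg) (chiCls_mem_bideg i)

end Degrees

end GroupAlg

end WittElementary

end SupergroupAlgebra

end

noncomputable section

namespace SupergroupAlgebra

namespace WittElementary

namespace GroupAlg

open SupergroupAlgebra.WittElementary.EvenAlg (top Reduced)

variable {k : Type u} [Field k] {p : ℕ} {m n : ℕ+} [Fact p.Prime] [CharP k p]

/-! ### Comparison with the standard cocycles at m = 1. -/

section Standard

theorem trunc_one (i : Fin n) : trunc p 1 n i = p := by
  unfold trunc
  split_ifs <;> simp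

theorem reduced_one (α : Fin n → Fin p) : Reduced p 1 n fun j => (α j : ℕ) := fun i => by
  rw [trunc_one]
  exact (α i).2

theorem isStdLam_lamCls (i : Fin n) : IsStdLam p i (lamCls k p 1 n i) := by
  refine ⟨Cochain.ofMultilinear (MultilinearMap.ofSubsingleton k _ k (0 : Fin 1) (lam k p 1 n i)),
    fun α e => ?_, d_lam i, rfl⟩
  rw [mono_eq_mon]
  exact lam_mon i _ e

theorem isStdZeta_zetCls : IsStdZeta p (zetCls k p 1 n) := by
  refine ⟨Cochain.ofMultilinear (MultilinearMap.ofSubsingleton k _ k (0 : Fin 1) (zet k p 1 n)),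
    fun α e => ?_, d_zet, rfl⟩
  rw [mono_eq_mon]
  refine (zet_mon _ e).trans ?_
  exact if_congr (and_congr_left' funext_iff) rfl rfl

theorem exists_single_iff (i : Fin n) (α β : Fin n → ℕ) : (∃ a b : ℕ, a + b = p ∧
    α = Pi.single i a ∧ β = Pi.single i b) ↔ α + β = Pi.single i p := by
  constructor
  · rintro ⟨a, b, rfl, rfl, rfl⟩
    rw [Pi.single_add]
  · intro h
    have key : ∀ j, j ≠ i → α j = 0 ∧ β j = 0 := by
      intro j hj
      have := congr_fun h j
      rw [Pi.single_eq_of_ne hj, Pi.add_apply] at this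
      omega
    refine ⟨α i, β i, by simpa using congr_fun h i, ?_, ?_⟩
    · funext j
      by_cases hj : j = i
      · subst hj; simp
      · rw [Pi.single_eq_of_ne hj, (key j hj).1]
    · funext j
      by_cases hj : j = i
      · subst hj; simp
      · rw [Pi.single_eq_of_ne hj, (key j hj).2]

variable (k) in
/-- The coefficient of `ζ²` in the cocycle which represents `x_i`. -/
def zetaCoeff (m : ℕ+) (i : Fin n) : k := if m = 1 ∧ i = top n then 1 else 0

/-- The cocycle -ε ∘ χ_i already has the prescribed values on even monomials. For i = n the carry of
σ · σ adds the value -1 at (σ, σ), and the summand ζ² cancels exactly this. -/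
theorem isStdX_xCls (i : Fin n) : IsStdX p i (xCls p 1 (zetaCoeff k 1 i) i) := by
  refine ⟨bilinCochain (xbil (zetaCoeff k 1 i) i), fun α β e f => ?_, d_xbil _ i, rfl⟩
  rw [mono_eq_mon, mono_eq_mon, bilinCochain_apply]
  have hα := reduced_one α
  have hβ := reduced_one β
  generalize (fun j => (α j : ℕ)) = α at hα ⊢
  generalize (fun j => (β j : ℕ)) = β at hβ ⊢
  simp only [exists_single_iff]
  simp only [Matrix.cons_val_zero, Matrix.cons_val_one, xbil, LinearMap.add_apply,
    LinearMap.smul_apply, zetSq_apply, zet_mon, chiAug_mon i hα hβ, trunc_one, smul_eq_mul]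
  have he : e = 0 ∨ e = 1 := by omega
  have hf : f = 0 ∨ f = 1 := by omega
  have h2 : (1 + 1 : Fin 2) = 0 := rfl
  have hp := (Fact.out : p.Prime).pos
  have hc : α + β + Pi.single (top n) p = Pi.single i p ↔ i = top n ∧ α = 0 ∧ β = 0 := by
    constructor
    · intro h
      have hi : i = top n := by
        by_contra hi
        have := congr_fun h (top n)
        rw [Pi.single_eq_of_ne (Ne.symm hi)] at this
        simp only [Pi.add_apply, Pi.single_eq_same] at this
        omega
      subst hi
      rw [add_eq_right] at h
      have : ∀ j, α j = 0 ∧ β j = 0 := fun j => by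
        have := congr_fun h j
        simp only [Pi.add_apply, Pi.zero_apply] at this
        omega
      exact ⟨rfl, funext fun j => (this j).1, funext fun j => (this j).2⟩
    · rintro ⟨rfl, rfl, rfl⟩
      simp
  rcases he with rfl | rfl <;> rcases hf with rfl | rfl
  · simp [carry]
  · simp [carry]
  · simp [carry]
  · simp only [carry, h2, and_self, if_true, and_true, hc, zetaCoeff]
    by_cases h1 : i = top n <;> by_cases h3 : α = 0 <;> by_cases h4 : β = 0 <;>
      simp [h1, h3, h4]

end Standard

/-! ### Inflation maps on the generators. -/

section Inflation

theorem inflation_classOf {z : Cochains k (GroupAlg k p m n)}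
    (hz : d (aug k (GroupAlg k p m n)) z = 0) {w : Cochains k (GroupAlg k p (m + 1) n)}
    (hw : d (aug k (GroupAlg k p (m + 1) n)) w = 0) (h : pull (projAlg k p m n) z = w) :
    inflation (proj k p m n) (classOf z hz) = classOf w hw := by
  subst h
  rfl

theorem aug_projAlg (a : GroupAlg k p (m + 1) n) :
    aug k (GroupAlg k p m n) (projAlg k p m n a) = aug k (GroupAlg k p (m + 1) n) a :=
  (proj k p m n).map_counit a

/-- The projection preserves the generators, and both sides are derivations over the augmentation
with the same values on them. -/
theorem der_projAlg (c : Fin n → k) (c' : k) :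
    der c c' ∘ₗ (projAlg k p m n).toLinearMap = der c c' := by
  refine derivation_ext (fun a b => ?_) (der_mul _ _) (fun i => ?_) ?_
  · simp only [LinearMap.comp_apply, AlgHom.toLinearMap_apply, map_mul, der_mul, aug_projAlg]
  · rw [LinearMap.comp_apply, AlgHom.toLinearMap_apply, projAlg_s, der_s, der_s]
  · rw [LinearMap.comp_apply, AlgHom.toLinearMap_apply, projAlg_σ, der_σ, der_σ]

theorem inflation_lamCls (i : Fin n) :
    inflation (proj k p m n) (lamCls k p m n i) = lamCls k p (m + 1) n i :=
  inflation_classOf _ _ (by rw [pull_form, lam, der_projAlg]; rfl)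

theorem inflation_zetCls :
    inflation (proj k p m n) (zetCls k p m n) = zetCls k p (m + 1) n :=
  inflation_classOf _ _ (by rw [pull_form, zet, der_projAlg]; rfl)

theorem projAlg_mon (α : Fin n → ℕ) (e : Fin 2) :
    projAlg k p m n (mon k p (m + 1) n α e) = mon k p m n α e := by
  rw [mon_eq_prod, mon_eq_prod, map_mul, map_prod, map_pow, projAlg_σ]
  simp only [map_pow, projAlg_s]

theorem trunc_of_ne_top {i : Fin n} (hi : i ≠ top n) : trunc p m n i = p := by
  unfold trunc
  rw [if_neg]
  intro h
  apply hi
  apply Fin.ext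
  change (i : ℕ) = (n : ℕ) - 1
  omega

theorem trunc_top : trunc p m n (top n) = p ^ (m : ℕ) := by
  unfold trunc
  rw [if_pos]
  change (n : ℕ) - 1 + 1 = n
  have := n.pos
  omega

theorem trunc_top_lt : trunc p m n (top n) < trunc p (m + 1) n (top n) := by
  rw [trunc_top, trunc_top]
  exact Nat.pow_lt_pow_right (Fact.out : p.Prime).one_lt (by simp)

theorem le_top_of_not_reduced {α : Fin n → ℕ} (hα : Reduced p (m + 1) n α)
    (h : ¬ Reduced p m n α) : trunc p m n (top n) ≤ α (top n) := by
  by_contra h'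
  refine h fun j => ?_
  by_cases hj : j = top n
  · subst hj
    exact not_le.mp h'
  · have := hα j
    rwa [trunc_of_ne_top hj] at this ⊢

theorem chiAug_projAlg_mon (i : Fin n) (α β : Fin n → ℕ) (e f : Fin 2) :
    chiAug k p m n i (projAlg k p m n (mon k p (m + 1) n α e))
        (projAlg k p m n (mon k p (m + 1) n β f)) =
      if Reduced p m n α ∧ Reduced p m n β ∧
        α + β + carry p n e f = Pi.single i (trunc p m n i) ∧ e + f = 0 then 1 else 0 := by
  rw [projAlg_mon, projAlg_mon]
  by_cases hα : Reduced p m n α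
  · by_cases hβ : Reduced p m n β
    · rw [chiAug_mon i hα hβ]
      simp [hα, hβ]
    · rw [mon_eq_zero hβ, map_zero]
      simp [hβ]
  · rw [mon_eq_zero hα, map_zero, LinearMap.zero_apply]
    simp [hα]

/-- The two levels differ only in monomials with a high power of s_n. These do not contribute,
because the total exponent at n must be zero. -/
theorem chiAug_projAlg_of_ne_top {i : Fin n} (hi : i ≠ top n) :
    (chiAug k p m n i).compl₁₂ (projAlg k p m n).toLinearMap (projAlg k p m n).toLinearMap =
      chiAug k p (m + 1) n i := by
  refine bilin_ext fun α β e f hα hβ => ?_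
  rw [LinearMap.compl₁₂_apply, AlgHom.toLinearMap_apply, AlgHom.toLinearMap_apply,
    chiAug_projAlg_mon, chiAug_mon i hα hβ, trunc_of_ne_top hi, trunc_of_ne_top hi]
  refine if_congr ⟨fun h => h.2.2, fun h => ?_⟩ rfl rfl
  have h0 := congr_fun h.1 (top n)
  rw [Pi.single_eq_of_ne hi.symm] at h0
  simp only [Pi.add_apply] at h0
  have h1 := two_le_trunc (p := p) (m := m) (top n)
  refine ⟨?_, ?_, h⟩
  · by_contra hr
    have := le_top_of_not_reduced hα hr
    omega
  · by_contra hr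
    have := le_top_of_not_reduced hβ hr
    omega

theorem inflation_chiCls_of_ne_top {i : Fin n} (hi : i ≠ top n) :
    inflation (proj k p m n) (chiCls k p m n i) = chiCls k p (m + 1) n i :=
  inflation_classOf _ _ (by rw [pull_biform, chiAug_projAlg_of_ne_top hi])

variable (k p m n) in
/-- The coefficient of `s_n^{p^m}` on `kE^-_{m+1,n}`. -/
def powCoeff : GroupAlg k p (m + 1) n →ₗ[k] k :=
  ofMon fun α e => if α = Pi.single (top n) (trunc p m n (top n)) ∧ e = 0 then 1 else 0

theorem powCoeff_mon (α : Fin n → ℕ) (e : Fin 2) : powCoeff k p m n (mon k p (m + 1) n α e) =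
    if α = Pi.single (top n) (trunc p m n (top n)) ∧ e = 0 then 1 else 0 := by
  rw [powCoeff, ofMon_mon]
  by_cases h : Reduced p (m + 1) n α
  · rw [if_pos h]
  · rw [if_neg h, if_neg]
    rintro ⟨rfl, -⟩
    exact h (reduced_single trunc_top_lt)

/-- If one factor already has exponent d at n, a product equal to s_n^d leaves room neither for the
other factor nor for a carry. -/
theorem add_carry_eq_single_iff {α β : Fin n → ℕ} {e f : Fin 2} {d : ℕ} (h : d ≤ α (top n)) :
    (α + β + carry p n e f = Pi.single (top n) d ∧ e + f = 0) ↔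
      (α = Pi.single (top n) d ∧ e = 0) ∧ (β = 0 ∧ f = 0) := by
  constructor
  · rintro ⟨h1, h2⟩
    have h3 : ∀ j, (α + β + carry p n e f) j = α j := by
      intro j
      have h4 := congr_fun h1 j
      by_cases hj : j = top n
      · subst hj
        rw [Pi.single_eq_same] at h4
        simp only [Pi.add_apply] at h4 ⊢
        omega
      · rw [Pi.single_eq_of_ne hj] at h4
        simp only [Pi.add_apply] at h4 ⊢
        omega
    have h4 : ¬ (e = 1 ∧ f = 1) := by
      intro h4
      have := h3 (top n)
      rw [carry, if_pos h4] at this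
      simp only [Pi.add_apply, Pi.single_eq_same] at this
      have := (Fact.out : p.Prime).pos
      omega
    refine ⟨⟨?_, ?_⟩, ?_, ?_⟩
    · rw [← h1]
      exact (funext h3).symm
    · omega
    · funext j
      have := h3 j
      simp only [Pi.add_apply, Pi.zero_apply] at this ⊢
      omega
    · omega
  · rintro ⟨⟨rfl, rfl⟩, rfl, rfl⟩
    simp [carry]

/-- An overflow at level m is a product equal to s_n^{p^m}, which is a nonzero monomial at level m +
1. It is detected by a linear form there, and the two correction terms account for pairs in which
one factor is that monomial already. -/
theorem chiAug_projAlg_top :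
    (chiAug k p m n (top n)).compl₁₂ (projAlg k p m n).toLinearMap (projAlg k p m n).toLinearMap =
      (LinearMap.mul k (GroupAlg k p (m + 1) n)).compr₂ (powCoeff k p m n) -
      (LinearMap.lsmul k k ∘ₗ powCoeff k p m n).compl₂ (aug k (GroupAlg k p (m + 1) n)).toLinearMap
      - (LinearMap.lsmul k k ∘ₗ (aug k (GroupAlg k p (m + 1) n)).toLinearMap).compl₂
        (powCoeff k p m n) := by
  refine bilin_ext fun α β e f hα hβ => ?_
  simp only [LinearMap.compl₁₂_apply, AlgHom.toLinearMap_apply, LinearMap.sub_apply,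
    LinearMap.compr₂_apply, LinearMap.mul_apply', LinearMap.compl₂_apply, LinearMap.comp_apply,
    LinearMap.lsmul_apply, smul_eq_mul, chiAug_projAlg_mon, mon_mul_mon, powCoeff_mon, aug_mon]
  have hd := two_le_trunc (p := p) (m := m) (top n)
  have hz : ∀ α : Fin n → ℕ, trunc p m n (top n) ≤ α (top n) → α ≠ 0 := by
    rintro α h rfl
    simp at h
    omega
  by_cases h1 : Reduced p m n α
  · have h1' : α ≠ Pi.single (top n) (trunc p m n (top n)) := by
      rintro rfl
      simpa using h1 (top n)
    by_cases h2 : Reduced p m n β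
    · have h2' : β ≠ Pi.single (top n) (trunc p m n (top n)) := by
        rintro rfl
        simpa using h2 (top n)
      simp [h1, h2, h1', h2']
    · have h3 := le_top_of_not_reduced hβ h2
      have h4 := add_carry_eq_single_iff (p := p) (β := α) (e := f) (f := e) h3
      have h5 : α + β + carry p n e f = β + α + carry p n f e := by
        rw [add_comm α, carry, carry, if_congr and_comm rfl rfl]
      rw [h5, add_comm e f, if_congr h4 rfl rfl]
      simp only [h2, hz β h3, h1', false_and, and_false, if_false, mul_zero]
      by_cases h6 : β = Pi.single (top n) (trunc p m n (top n)) ∧ f = 0 <;>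
        by_cases h7 : α = 0 ∧ e = 0 <;> simp [h6, h7]
  · have h3 := le_top_of_not_reduced hα h1
    rw [if_congr (add_carry_eq_single_iff h3) rfl rfl]
    simp only [h1, hz α h3, false_and, if_false, zero_mul]
    by_cases h6 : α = Pi.single (top n) (trunc p m n (top n)) ∧ e = 0 <;>
        by_cases h7 : β = 0 ∧ f = 0 <;> simp [h6, h7]

/-- The explicit formula for the pullback is the differential of minus the coefficient of s_n^{p^m}.
-/
theorem inflation_chiCls_top : inflation (proj k p m n) (chiCls k p m n (top n)) = 0 := by
  have hd : d (aug k (GroupAlg k p (m + 1) n))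
      (pull (projAlg k p m n) (biform (chiAug k p m n (top n)))) = 0 := by
    rw [← pull_d (projAlg k p m n) aug_projAlg, d_chiAug, map_zero]
  rw [chiCls, inflation_classOf _ hd rfl, classOf_eq_zero_iff]
  refine ⟨form (-powCoeff k p m n), ?_⟩
  rw [pull_biform, chiAug_projAlg_top]
  refine d_form_eq _ _ _ fun a b => ?_
  simp
  ring

theorem inflation_xCls_of_ne_top (c : k) {i : Fin n} (hi : i ≠ top n) :
    inflation (proj k p m n) (xCls p m c i) = xCls p (m + 1) c i := by
  rw [xCls_eq, xCls_eq, map_sub, map_smul, map_mul, inflation_zetCls,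
    inflation_chiCls_of_ne_top hi]

theorem inflation_xCls_top (c : k) : inflation (proj k p m n) (xCls p m c (top n)) =
    c • (zetCls k p (m + 1) n * zetCls k p (m + 1) n) := by
  rw [xCls_eq, map_sub, map_smul, map_mul, inflation_zetCls, inflation_chiCls_top, sub_zero]

theorem zetaCoeff_of_ne_top (m : ℕ+) {i : Fin n} (hi : i ≠ top n) : zetaCoeff k m i = 0 :=
  if_neg fun h => hi h.2

theorem zetaCoeff_one_top : zetaCoeff k 1 (top n) = 1 := if_pos ⟨rfl, rfl⟩

theorem zetaCoeff_of_two_le {m : ℕ+} (hm : 2 ≤ m) (i : Fin n) : zetaCoeff k m i = 0 :=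
  if_neg fun h => by
    rw [h.1] at hm
    exact absurd hm (by decide)

end Inflation

/-! ### The kernel of inflation in degree (2, 0). -/

section Kernel

variable (k p m n) in
/-- The basis of the cohomology algebra which consists of the monomials in the generators. -/
def basisCls (g : ℕ × (Fin n → ℕ × Fin 2)) : Cohomology k (GroupAlg k p m n) :=
  GenRel.monomials (fun i => xCls p m (zetaCoeff k m i) i) (zetCls k p m n) (lamCls k p m n) g

/-- The exponent of `x_n`. -/
def xTop : ℕ × (Fin n → ℕ × Fin 2) := (0, Pi.single (top n) (1, 0))

/-- The exponent of `ζ²`. -/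
def zetaSq : ℕ × (Fin n → ℕ × Fin 2) := (2, 0)

theorem xTop_ne_zetaSq : (xTop : ℕ × (Fin n → ℕ × Fin 2)) ≠ zetaSq := fun h => by
  have := congr_arg Prod.fst h
  simp [xTop, zetaSq] at this

theorem orderedProd_single {R : Type*} [Monoid R] {r : ℕ} (x l : Fin r → R) (i : Fin r) :
    orderedProd x l (Pi.single i (1, 0)) = x i := by
  induction r with
  | zero => exact i.elim0
  | succ r ih =>
    have h0 : ∀ (r : ℕ) (x l : Fin r → R), orderedProd x l 0 = 1 := by
      intro r x l
      simp [orderedProd]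
    rw [orderedProd_succ]
    cases i using Fin.cases with
    | zero =>
      have h1 : Fin.tail (n := r) (α := fun _ => ℕ × Fin 2) (Pi.single 0 (1, 0)) = 0 := by
        funext j
        simp [Fin.tail]
      rw [h1, h0]
      simp
    | succ i =>
      have h1 : Fin.tail (α := fun _ => ℕ × Fin 2) (Pi.single i.succ (1, 0)) =
          Pi.single i (1, 0) := by
        funext j
        by_cases hj : j = i
        · subst hj; simp [Fin.tail]
        · rw [Fin.tail, Pi.single_eq_of_ne hj, Pi.single_eq_of_ne]
          simpa using hj
      have h2 := ih (Fin.tail x) (Fin.tail l) i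
      rw [h1, h2]
      simp [Fin.tail]

theorem basisCls_xTop : basisCls k p m n xTop = xCls p m (zetaCoeff k m (top n)) (top n) := by
  rw [basisCls, GenRel.monomials, xTop, pow_zero, one_mul]
  exact orderedProd_single _ _ _

theorem basisCls_zetaSq : basisCls k p m n zetaSq = zetCls k p m n * zetCls k p m n := by
  rw [basisCls, GenRel.monomials, zetaSq]
  simp [orderedProd, pow_two]

/-- In degree at most 2, a factor x_n leaves room for nothing else. All monomials other than x_n
itself thus avoid x_n, the only generator not sent to its namesake. -/
theorem inflation_basisCls {g : ℕ × (Fin n → ℕ × Fin 2)} (hg : basisDeg g < 3) (hg' : g ≠ xTop) :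
    inflation (proj k p 1 n) (basisCls k p 1 n g) = basisCls k p (1 + 1) n g := by
  have htop : (g.2 (top n)).1 = 0 := by
    by_contra h
    apply hg'
    have h1 : ∀ j, 2 * (g.2 j).1 + ((g.2 j).2 : ℕ) ≤
        if j = top n then 2 * (g.2 j).1 + ((g.2 j).2 : ℕ) else 0 := by
      intro j
      split_ifs with hj
      · rfl
      · have h2 := Finset.add_le_sum (f := fun j => 2 * (g.2 j).1 + ((g.2 j).2 : ℕ))
          (fun _ _ => Nat.zero_le _) (Finset.mem_univ j) (Finset.mem_univ (top n)) hj
        rw [basisDeg] at hg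
        omega
    have h3 := Finset.single_le_sum (f := fun j => 2 * (g.2 j).1 + ((g.2 j).2 : ℕ))
      (fun _ _ => Nat.zero_le _) (Finset.mem_univ (top n))
    rw [basisDeg] at hg
    refine Prod.ext ?_ (funext fun j => ?_)
    · change g.1 = 0
      omega
    · change g.2 j = (Pi.single (top n) (1, 0) : Fin n → ℕ × Fin 2) j
      have h4 := h1 j
      by_cases hj : j = top n
      · subst hj
        rw [Pi.single_eq_same]
        refine Prod.ext ?_ (Fin.ext ?_)
        · change _ = 1
          omega
        · change _ = 0
          omega
      · rw [if_neg hj] at h4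
        rw [Pi.single_eq_of_ne hj]
        refine Prod.ext ?_ (Fin.ext ?_)
        · change _ = 0
          omega
        · change _ = 0
          omega
  rw [basisCls, GenRel.monomials, map_mul, map_pow, inflation_zetCls, map_orderedProd, basisCls,
    GenRel.monomials, orderedProd, orderedProd]
  congr 4
  funext i
  rw [Function.comp_apply, Function.comp_apply, inflation_lamCls]
  congr 1
  by_cases hi : i = top n
  · subst hi
    rw [htop, pow_zero, pow_zero]
  · rw [inflation_xCls_of_ne_top _ hi, zetaCoeff_of_ne_top _ hi, zetaCoeff_of_ne_top _ hi]

/-- Monomials of lower degree are not excluded here. This is harmless, because inflation preserves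
the basis monomials of every degree below 3 except x_n. -/
theorem exists_combination_of_mem_bideg {h : Cohomology k (GroupAlg k p m n)} {q : ℕ} {t : ZMod 2}
    (hh : h ∈ bideg k (GroupAlg k p m n) q t) : ∃ c : (ℕ × (Fin n → ℕ × Fin 2)) →₀ k,
      (∀ g ∈ c.support, basisDeg g < q + 1) ∧
      h = Finsupp.linearCombination k (basisCls k p m n) c := by
  obtain ⟨⟨z, hz⟩, ⟨f, -, hf⟩, rfl⟩ := hh
  change f.toCochains = z at hf
  obtain ⟨c, hc, h⟩ := (isModel_basisCocycle (p := p) (m := m)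
    (zetaCoeff k m)).mem_span_of_degLT hz (hf ▸ toCochains_mem_degLT (Nat.lt_succ_self q) f)
  refine ⟨c, hc, h.trans ?_⟩
  simp only [classOf_basisCocycle]
  rfl

theorem linearIndependent_basisCls : LinearIndependent k (basisCls k p m n) :=
  linearIndependent_monomials _

/-- Inflation carries the basis monomials of degree at most 2 to basis monomials, injectively except
that x_n and ζ² both go to ζ². Only their difference can be killed. -/
theorem ker_inflation : LinearMap.ker (inflation (proj k p 1 n)).toLinearMap ⊓
    bideg k (GroupAlg k p 1 n) 2 0 =
      Submodule.span k {basisCls k p 1 n zetaSq - basisCls k p 1 n xTop} := by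
  have htop : inflation (proj k p 1 n) (basisCls k p 1 n xTop) = basisCls k p (1 + 1) n zetaSq := by
    rw [basisCls_xTop, inflation_xCls_top, zetaCoeff_one_top, one_smul, basisCls_zetaSq]
  apply le_antisymm
  · rintro h ⟨h1, h2⟩
    obtain ⟨c, hc, rfl⟩ := exists_combination_of_mem_bideg h2
    have hsplit : c = c.erase xTop + Finsupp.single xTop (c xTop) := by
      rw [Finsupp.erase_add_single]
    -- The coefficient of x_n moves to ζ², and the other coefficients stay in place. Independence at
    -- level 2 then determines the whole combination.
    have h3 : Finsupp.linearCombination k (basisCls k p (1 + 1) n)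
        (c.erase xTop + Finsupp.single zetaSq (c xTop)) = 0 := by
      change inflation (proj k p 1 n) _ = 0 at h1
      rw [hsplit, map_add, map_add, Finsupp.linearCombination_single, map_smul, htop,
        Finsupp.linearCombination_apply, Finsupp.sum, map_sum] at h1
      rw [map_add, Finsupp.linearCombination_single, Finsupp.linearCombination_apply, Finsupp.sum,
        ← h1]
      congr 1
      refine Finset.sum_congr rfl fun g hg => ?_
      rw [Finsupp.support_erase, Finset.mem_erase] at hg
      rw [map_smul, inflation_basisCls (hc g hg.2) hg.1]
    have h4 := linearIndependent_iff.mp linearIndependent_basisCls _ h3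
    have h5 := eq_neg_of_add_eq_zero_left h4
    rw [hsplit, h5, map_add, map_neg, Finsupp.linearCombination_single,
      Finsupp.linearCombination_single]
    refine Submodule.mem_span_singleton.mpr ⟨-c xTop, ?_⟩
    rw [smul_sub, neg_smul, neg_smul, sub_neg_eq_add]
  · rw [Submodule.span_singleton_le_iff_mem]
    have h1 : basisCls k p 1 n zetaSq - basisCls k p 1 n xTop = chiCls k p 1 n (top n) := by
      rw [basisCls_zetaSq, basisCls_xTop, xCls_eq, zetaCoeff_one_top, one_smul, sub_sub_cancel]
    rw [h1]
    have h2 : inflation (proj k p 1 n) (chiCls k p 1 n (top n)) = 0 := inflation_chiCls_top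
    exact Submodule.mem_inf.mpr ⟨h2, chiCls_mem_bideg (top n)⟩

theorem basisCls_sub_ne_zero : basisCls k p m n zetaSq - basisCls k p m n xTop ≠ 0 := by
  intro h
  exact xTop_ne_zetaSq (linearIndependent_basisCls.injective (sub_eq_zero.mp h)).symm

end Kernel

end GroupAlg

end WittElementary

end SupergroupAlgebra

end

/-! ### Assembly of the theorem. -/

theorem mainTheorem11 (k : Type u) [Field k] [PerfectField k] (p : ℕ) [Fact p.Prime] [CharP k p]
    (hp : 3 ≤ p) (n : ℕ+) :
    ∃ φ : ∀ m : ℕ+, PolyExt k n ≃ₐ[k] Cohomology k (GroupAlg k p m n),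
      -- the degrees of the generators
      (∀ m : ℕ+,
        (∀ i, φ m (PolyExt.x k i) ∈ bideg k (GroupAlg k p m n) 2 0) ∧
        φ m (PolyExt.ζ k n) ∈ bideg k (GroupAlg k p m n) 1 1 ∧
        (∀ i, φ m (PolyExt.lam k i) ∈ bideg k (GroupAlg k p m n) 1 0)) ∧
      -- for `m = 1` the generators are the standard ones
      (∀ i, IsStdX p i (φ 1 (PolyExt.x k i))) ∧
      IsStdZeta p (φ 1 (PolyExt.ζ k n)) ∧
      (∀ i, IsStdLam p i (φ 1 (PolyExt.lam k i))) ∧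
      -- the inflation maps along `E^-_{m+1,n} → E^-_{m,n}` for `m ≥ 2`
      (∀ m : ℕ+, 2 ≤ m →
        (∀ i, i ≠ EvenAlg.top n →
          inflation (proj k p m n) (φ m (PolyExt.x k i)) = φ (m + 1) (PolyExt.x k i)) ∧
        inflation (proj k p m n) (φ m (PolyExt.x k (EvenAlg.top n))) = 0 ∧
        inflation (proj k p m n) (φ m (PolyExt.ζ k n)) = φ (m + 1) (PolyExt.ζ k n) ∧
        (∀ i, inflation (proj k p m n) (φ m (PolyExt.lam k i)) =
          φ (m + 1) (PolyExt.lam k i))) ∧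
      -- the inflation map along `E^-_{2,n} → E^-_{1,n}`
      (∀ i, i ≠ EvenAlg.top n →
        inflation (proj k p 1 n) (φ 1 (PolyExt.x k i)) = φ (1 + 1) (PolyExt.x k i)) ∧
      inflation (proj k p 1 n) (φ 1 (PolyExt.x k (EvenAlg.top n))) =
        φ (1 + 1) (PolyExt.ζ k n ^ 2) ∧
      inflation (proj k p 1 n) (φ 1 (PolyExt.ζ k n)) = φ (1 + 1) (PolyExt.ζ k n) ∧
      (∀ i, inflation (proj k p 1 n) (φ 1 (PolyExt.lam k i)) =
        φ (1 + 1) (PolyExt.lam k i)) ∧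
      -- its kernel in degree `(2, 0)`
      LinearMap.ker (inflation (proj k p 1 n)).toLinearMap ⊓ bideg k (GroupAlg k p 1 n) 2 0 =
        Submodule.span k {φ 1 (PolyExt.ζ k n ^ 2 - PolyExt.x k (EvenAlg.top n))} ∧
      Module.finrank k ↥(LinearMap.ker (inflation (proj k p 1 n)).toLinearMap ⊓
        bideg k (GroupAlg k p 1 n) 2 0) = 1 := by
  -- The coefficient of ζ² is 1 only for m = 1 and i = n. This makes the generators standard at m =
  -- 1 and yields x_n ↦ ζ² there and x_n ↦ 0 afterwards.
  choose φ hx hz hl using fun m : ℕ+ => GroupAlg.exists_algEquiv (k := k) (m := m) (n := n) hp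
    (GroupAlg.zetaCoeff k m)
  refine ⟨φ, fun m => ⟨fun i => ?_, ?_, fun i => ?_⟩, fun i => ?_, ?_, fun i => ?_,
    fun m hm => ⟨fun i hi => ?_, ?_, ?_, fun i => ?_⟩, fun i hi => ?_, ?_, ?_, fun i => ?_, ?_, ?_⟩
  · rw [hx]; exact GroupAlg.xCls_mem_bideg _ i
  · rw [hz]; exact GroupAlg.zetCls_mem_bideg
  · rw [hl]; exact GroupAlg.lamCls_mem_bideg i
  · rw [hx]; exact GroupAlg.isStdX_xCls i
  · rw [hz]; exact GroupAlg.isStdZeta_zetCls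
  · rw [hl]; exact GroupAlg.isStdLam_lamCls i
  · rw [hx, hx, GroupAlg.inflation_xCls_of_ne_top _ hi, GroupAlg.zetaCoeff_of_ne_top _ hi,
      GroupAlg.zetaCoeff_of_ne_top _ hi]
  · rw [hx, GroupAlg.inflation_xCls_top, GroupAlg.zetaCoeff_of_two_le hm, zero_smul]
  · rw [hz, hz, GroupAlg.inflation_zetCls]
  · rw [hl, hl, GroupAlg.inflation_lamCls]
  · rw [hx, hx, GroupAlg.inflation_xCls_of_ne_top _ hi, GroupAlg.zetaCoeff_of_ne_top _ hi,
      GroupAlg.zetaCoeff_of_ne_top _ hi]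
  · rw [hx, GroupAlg.inflation_xCls_top, GroupAlg.zetaCoeff_one_top, one_smul, map_pow, hz,
      pow_two]
  · rw [hz, hz, GroupAlg.inflation_zetCls]
  · rw [hl, hl, GroupAlg.inflation_lamCls]
  · rw [GroupAlg.ker_inflation, map_sub, map_pow, hz, hx, GroupAlg.basisCls_zetaSq,
      GroupAlg.basisCls_xTop, pow_two]
  · rw [GroupAlg.ker_inflation]
    exact finrank_span_singleton GroupAlg.basisCls_sub_ne_zero
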